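/- Let $\mathbb H=\{z=x+iy: y>0\}$, $G=\mathrm{SL}_2(\mathbb R)$, $k\in\mathbb R$, $s\in\mathbb C$, and $\Delta_k=-y^2\partial_x^2-y^2\partial_y^2+iky\,\partial_x$. For an open set $\Omega\subset\mathbb P^1(\mathbb C)$ let $\mathcal B_{s,k}(\Omega)$ be the space of smooth functions $f$ on $\Omega\cap\mathbb H$ with $\Delta_kf=s(1-s)f$ such that, if $\Omega\cap\mathbb P^1(\mathbb R)\ne\emptyset$, the function $\Phi_{s,k}f$, where $$\Phi_{s,k}(z)=y^{-s}(z+i)^{s+k/2}(\bar z-i)^{s-k/2}\qquad(0<\arg(z+i)<\pi,\ -\pi<\arg(\bar z-i)<0),$$ extends to a real-analytic function $F$ on $\Omega$. For an open set $I\subset\mathbb P^1(\mathbb R)$ let $\mathcal W^\omega_{s,k}(I)=\varinjlim_{\Omega\supset I}\mathcal B_{s,k}(\Omega)$, where $\Omega$ runs over the open sets of $\mathbb P^1(\mathbb C)$ that contain $I$ (analytic boundary germs), and let $\mathcal V^\omega_{s,k}(I)$ be the space of real-analytic functions $I\to\mathbb C$. Let $\mathrm{rest}_{s,k}\colon\mathcal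 W^\omega_{s,k}\to\mathcal V^\omega_{s,k}$ be the morphism induced by $f\mapsto F|_{I}$. For $g=\begin{pmatrix}a&b\\c&d\end{pmatrix}\in G$ put $(f|_kg)(z)=e^{-ik\arg(cz+d)}f(gz)$ with $-\pi<\arg\le\pi$, and for a function $\varphi$ on $I$ define $\varphi|^{\mathrm{prs}}_{s,k}g$ on $g^{-1}I$ by $$(\varphi|^{\mathrm{prs}}_{s,k}g)(t)=(a-ic)^{-s+k/2}(a+ic)^{-s-k/2}\Bigl(\frac{t-i}{t-g^{-1}i}\Bigr)^{s-k/2}\Bigl(\frac{t+i}{t-g^{-1}(-i)}\Bigr)^{s+k/2}\varphi(gt),$$ where $-\pi\le\arg(a-ic)<\pi$, $-\pi<\arg(a+ic)\le\pi$, and the last two powers are continuous on $\mathbb P^1(\mathbb R)$ with value $1$ at $t=\infty$. **Theorem.** Suppose $2s\notin\mathbb Z_{\le0}$ and $2s\ne\pm k$. Then: 1. $\mathrm{rest}_{s,k}\colon\mathcal W^\omega_{s,k}\to\mathcal V^\omega_{s,k}$ commutes with restriction to smaller open sets, and $\mathrm{rest}_{s,k}\colon\mathcal W^\omega_{s,k}(I)\to\mathcal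 V^\omega_{s,k}(I)$ is bijective for each open $I\subset\mathbb P^1(\mathbb R)$. 2. Let $g\in G$, let $I\subset\mathbb P^1(\mathbb R)$ be open, and let $f\in\mathcal B_{s,k}(\Omega)$ with $\Omega\supset I$. Then $f|_kg$, restricted to a suitable open set $\Omega'$ with $g^{-1}I\subset\Omega'\subset g^{-1}\Omega$, is in $\mathcal B_{s,k}(\Omega')$, and on $g^{-1}I$ $$(\mathrm{rest}_{s,k}f)|^{\mathrm{prs}}_{s,k}g=\mathrm{rest}_{s,k}(f|_kg).$$ 3. Let $I\subset\mathbb P^1(\mathbb R)$ be an open interval (a connected open set with more than one point, not equal to $\mathbb P^1(\mathbb R)$). Let $\Omega\subset\mathbb P^1(\mathbb C)$ be an open set that contains $I$, does not contain $i$ and $-i$, is symmetric under complex conjugation, and is convex, by which we mean that some element of $G$ maps it onto a convex subset of $\mathbb C$ (in particular, convex subsets of $\mathbb C$ are allowed). If $\varphi\in\mathcal W^\omega_{s,k}(I)$ and $\mathrm{rest}_{s,k}\varphi$ extends to a holomorphic function on $\Omega$, then $\varphi$ can be represented by some $f\in\mathcal B_{s,k}(\Omega)$, for the same $\Omega$.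 -/

import Mathlib

namespace BoundaryGerm

open Filter Topology TopologicalSpace UpperHalfPlane
open scoped OnePoint

/-! ### The projective lines `P¹(ℝ) ⊆ P¹(ℂ)` and the action of `G = SL₂(ℝ)` -/

/-- The real projective line `P¹(ℝ) = ℝ ∪ {∞}`. -/
abbrev P1R : Type := OnePoint ℝ

/-- The complex projective line `P¹(ℂ) = ℂ ∪ {∞}`. -/
abbrev P1C : Type := OnePoint ℂ

/-- The group `G = SL₂(ℝ)`. -/
abbrev G : Type := Matrix.SpecialLinearGroup (Fin 2) ℝ

/-- The inclusion `P¹(ℝ) ⊆ P¹(ℂ)`. -/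
def realPt (t : P1R) : P1C := OnePoint.map (fun x : ℝ => (x : ℂ)) t

/-- The inclusion of the upper half-plane in `P¹(ℂ)`. -/
def upPt (z : ℍ) : P1C := ((z : ℂ) : OnePoint ℂ)

/-- Complex conjugation on `P¹(ℂ)`. -/
def conjP1 (p : P1C) : P1C := OnePoint.map (fun z : ℂ => starRingEnd ℂ z) p

/-- Fractional linear action of `G` on `P¹(ℝ)`. -/
noncomputable def actR (g : G) (t : P1R) : P1R :=
  (Matrix.SpecialLinearGroup.toGL g : Matrix.GeneralLinearGroup (Fin 2) ℝ) • t

/-- Fractional linear action of `G` on `P¹(ℂ)`. -/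
noncomputable def actC (g : G) (p : P1C) : P1C :=
  (Matrix.GeneralLinearGroup.map Complex.ofRealHom (Matrix.SpecialLinearGroup.toGL g) :
    Matrix.GeneralLinearGroup (Fin 2) ℂ) • p

section Continuity

variable {K : Type} [NontriviallyNormedField K] [ProperSpace K]

theorem tendsto_coe_cobounded :
    Tendsto (fun z : K => (z : OnePoint K)) (Bornology.cobounded K) (𝓝 ∞) := by
  have h := OnePoint.tendsto_coe_infty (X := K)
  rwa [coclosedCompact_eq_cocompact, ← Metric.cobounded_eq_cocompact] at h

theorem continuous_smul_GL [DecidableEq K] (g : Matrix.GeneralLinearGroup (Fin 2) K) :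
    Continuous (fun p : OnePoint K => g • p) := by
  have hdet : g 0 0 * g 1 1 - g 0 1 * g 1 0 ≠ 0 := by
    have := g.det_ne_zero
    rwa [Matrix.det_fin_two] at this
  rw [continuous_iff_continuousAt]
  intro p
  induction p using OnePoint.rec with
  | infty =>
    rw [OnePoint.continuousAt_infty', coclosedCompact_eq_cocompact,
      ← Metric.cobounded_eq_cocompact, OnePoint.smul_infty_eq_ite]
    by_cases hc : g 1 0 = 0
    · have hd : g 1 1 ≠ 0 := by rintro h; simp [hc, h] at hdet
      have ha : g 0 0 ≠ 0 := by rintro h; simp [hc, h] at hdet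
      have heq : ((fun p : OnePoint K => g • p) ∘ (fun z : K => (z : OnePoint K)))
          = (fun z : K => (((g 0 0 / g 1 1) * z + g 0 1 / g 1 1 : K) : OnePoint K)) := by
        funext z
        simp only [Function.comp, OnePoint.smul_some_eq_ite, hc, zero_mul, zero_add, hd, if_false]
        congr 1
        field_simp
      rw [heq, if_pos hc]
      refine tendsto_coe_cobounded.comp ?_
      have h1 : Tendsto (fun z : K => (g 0 0 / g 1 1) * z) (Bornology.cobounded K)
          (Bornology.cobounded K) := Filter.tendsto_mul_left_cobounded (div_ne_zero ha hd)
      rw [← tendsto_norm_atTop_iff_cobounded] at h1 ⊢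
      refine tendsto_atTop_mono (fun z => ?_) (tendsto_atTop_add_const_right _ (-‖g 0 1 / g 1 1‖) h1)
      have := norm_sub_le ((g 0 0 / g 1 1) * z + g 0 1 / g 1 1) (g 0 1 / g 1 1)
      simp only [add_sub_cancel_right] at this
      linarith
    · rw [if_neg hc]
      have hev : (fun z : K => (((g 0 0 + g 0 1 * z⁻¹) / (g 1 0 + g 1 1 * z⁻¹) : K) : OnePoint K))
          =ᶠ[Bornology.cobounded K]
          ((fun p : OnePoint K => g • p) ∘ (fun z : K => (z : OnePoint K))) := by
        have h0 : ∀ᶠ z : K in Bornology.cobounded K, z ≠ 0 := by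
          have := (tendsto_norm_cobounded_atTop (E := K)).eventually (eventually_gt_atTop 0)
          filter_upwards [this] with z hz using norm_pos_iff.mp hz
        have h1 : ∀ᶠ z : K in Bornology.cobounded K, z ≠ -(g 1 1) / g 1 0 := by
          have := (tendsto_norm_cobounded_atTop (E := K)).eventually
            (eventually_gt_atTop ‖-(g 1 1) / g 1 0‖)
          filter_upwards [this] with z hz h
          rw [h] at hz
          exact lt_irrefl _ hz
        filter_upwards [h0, h1] with z hz hz1
        have hne : g 1 0 * z + g 1 1 ≠ 0 := by
          intro h
          apply hz1
          rw [eq_div_iff hc]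
          linear_combination h
        simp only [Function.comp, OnePoint.smul_some_eq_ite, hne, if_false]
        congr 1
        field_simp
      refine Tendsto.congr' hev ?_
      refine (OnePoint.continuous_coe.tendsto _).comp ?_
      have hi := tendsto_inv₀_cobounded (α := K)
      have := ((hi.const_mul (g 0 1)).const_add (g 0 0)).div
        ((hi.const_mul (g 1 1)).const_add (g 1 0)) (by simpa using hc)
      simpa [Pi.div_def] using this
  | coe z =>
    rw [OnePoint.continuousAt_coe]
    by_cases hz : g 1 0 * z + g 1 1 = 0
    · have hnum : g 0 0 * z + g 0 1 ≠ 0 := by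
        intro h
        have hc : g 1 0 = 0 := by
          by_contra hc
          apply hdet
          have : g 1 0 * (g 0 0 * g 1 1 - g 0 1 * g 1 0) = 0 := by
            linear_combination g 1 0 * g 0 0 * hz - g 1 0 * g 1 0 * h
          exact (mul_eq_zero.mp this).resolve_left hc
        have hd : g 1 1 = 0 := by simpa [hc] using hz
        apply hdet
        simp [hc, hd]
      rw [ContinuousAt, ← nhdsNE_sup_pure, tendsto_sup]
      refine ⟨?_, tendsto_pure_nhds _ _⟩
      have hc : g 1 0 ≠ 0 := by
        intro hc
        have hd : g 1 1 = 0 := by simpa [hc] using hz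
        apply hdet
        simp [hc, hd]
      have hne : ∀ᶠ w in 𝓝[≠] z, g 1 0 * w + g 1 1 ≠ 0 := by
        filter_upwards [self_mem_nhdsWithin] with w hw h
        apply hw
        have : g 1 0 * (w - z) = 0 := by linear_combination h - hz
        exact sub_eq_zero.mp ((mul_eq_zero.mp this).resolve_left hc)
      have hval : ((fun p : OnePoint K => g • p) ∘ (fun z : K => (z : OnePoint K))) z = ∞ := by
        simp [OnePoint.smul_some_eq_ite, hz]
      rw [hval]
      have hev : (fun w : K => (((g 0 0 * w + g 0 1) * (g 1 0 * w + g 1 1)⁻¹ : K) : OnePoint K))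
          =ᶠ[𝓝[≠] z] ((fun p : OnePoint K => g • p) ∘ (fun z : K => (z : OnePoint K))) := by
        filter_upwards [hne] with w hw
        simp [OnePoint.smul_some_eq_ite, hw, div_eq_mul_inv]
      refine Tendsto.congr' hev (tendsto_coe_cobounded.comp ?_)
      have hden : Tendsto (fun w : K => g 1 0 * w + g 1 1) (𝓝[≠] z) (𝓝[≠] 0) := by
        refine tendsto_nhdsWithin_iff.mpr ⟨?_, hne⟩
        have : ContinuousAt (fun w : K => g 1 0 * w + g 1 1) z := by fun_prop
        have h := this.tendsto
        rw [hz] at h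
        exact h.mono_left nhdsWithin_le_nhds
      have hinv := tendsto_norm_cobounded_atTop.comp (tendsto_inv₀_nhdsNE_zero.comp hden)
      have hn : Tendsto (fun w : K => ‖g 0 0 * w + g 0 1‖) (𝓝[≠] z) (𝓝 ‖g 0 0 * z + g 0 1‖) := by
        have : ContinuousAt (fun w : K => ‖g 0 0 * w + g 0 1‖) z := by fun_prop
        exact this.tendsto.mono_left nhdsWithin_le_nhds
      rw [← tendsto_norm_atTop_iff_cobounded]
      have := hn.pos_mul_atTop (norm_pos_iff.mpr hnum) hinv
      simpa [Function.comp_def, norm_mul] using this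
    · have hne : ∀ᶠ w in 𝓝 z, g 1 0 * w + g 1 1 ≠ 0 := by
        have : ContinuousAt (fun w : K => g 1 0 * w + g 1 1) z := by fun_prop
        exact this.eventually_ne hz
      have hev : (fun w : K => (((g 0 0 * w + g 0 1) / (g 1 0 * w + g 1 1) : K) : OnePoint K))
          =ᶠ[𝓝 z] ((fun p : OnePoint K => g • p) ∘ (fun z : K => (z : OnePoint K))) := by
        filter_upwards [hne] with w hw
        simp [OnePoint.smul_some_eq_ite, hw]
      refine ContinuousAt.congr ?_ hev
      refine OnePoint.continuous_coe.continuousAt.comp ?_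
      exact ContinuousAt.div (by fun_prop) (by fun_prop) hz

end Continuity

/-- `g⁻¹ I`, for an open set `I` of `P¹(ℝ)`. -/
def preR (g : G) (I : Opens P1R) : Opens P1R :=
  ⟨{t | actR g t ∈ I}, I.isOpen.preimage (continuous_smul_GL _)⟩

/-- `g⁻¹ Ω`, for an open set `Ω` of `P¹(ℂ)`. -/
def preC (g : G) (Ω : Opens P1C) : Opens P1C :=
  ⟨{p | actC g p ∈ Ω}, Ω.isOpen.preimage (continuous_smul_GL _)⟩

theorem actC_realPt (g : G) (t : P1R) : actC g (realPt t) = realPt (actR g t) := by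
  unfold actC actR realPt
  exact (OnePoint.map_smul Complex.ofRealHom _ t).symm

theorem actC_upPt (g : G) (z : ℍ) : actC g (upPt z) = upPt (g • z) := by
  have hne : ((g 1 0 : ℝ) : ℂ) * (z : ℂ) + ((g 1 1 : ℝ) : ℂ) ≠ 0 :=
    UpperHalfPlane.denom_ne_zero (Matrix.SpecialLinearGroup.toGL g) z
  unfold actC upPt
  rw [OnePoint.smul_some_eq_ite, UpperHalfPlane.coe_specialLinearGroup_apply]
  simp [hne]

/-! ### Analyticity on projective lines -/

/-- The coordinate `w = 1 / t` at `∞`: it sends `w ≠ 0` to `1 / w`, and `0` to `∞`. -/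
noncomputable def chartInfty {K : Type} [NontriviallyNormedField K] (w : K) : OnePoint K :=
  open Classical in if w = 0 then ∞ else ((w⁻¹ : K) : OnePoint K)

/-- Analyticity over `𝕜` of a complex-valued function on `P¹(K)` near the point `p`, in the
coordinate `t` if `p ≠ ∞` and in the coordinate `1 / t` if `p = ∞`. -/
def AnalyticAtP1 (𝕜 : Type) {K : Type} [NontriviallyNormedField 𝕜] [NontriviallyNormedField K]
    [NormedSpace 𝕜 K] [NormedSpace 𝕜 ℂ] (F : OnePoint K → ℂ) (p : OnePoint K) : Prop :=
  p.elim (AnalyticAt 𝕜 (fun w : K => F (chartInfty w)) 0)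
    (fun t => AnalyticAt 𝕜 (fun w : K => F (w : OnePoint K)) t)

section AnalyticLemmas

variable {𝕜 K : Type} [NontriviallyNormedField 𝕜] [NontriviallyNormedField K]
    [NormedSpace 𝕜 K] [NormedSpace 𝕜 ℂ]

theorem AnalyticAtP1.zero (p : OnePoint K) : AnalyticAtP1 𝕜 (fun _ : OnePoint K => (0 : ℂ)) p := by
  induction p using OnePoint.rec with
  | infty => exact analyticAt_const
  | coe z => exact analyticAt_const

theorem AnalyticAtP1.add {F F' : OnePoint K → ℂ} {p : OnePoint K}
    (h : AnalyticAtP1 𝕜 F p) (h' : AnalyticAtP1 𝕜 F' p) :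
    AnalyticAtP1 𝕜 (fun q => F q + F' q) p := by
  induction p using OnePoint.rec with
  | infty => exact AnalyticAt.fun_add h h'
  | coe z => exact AnalyticAt.fun_add h h'

end AnalyticLemmas

theorem AnalyticAtP1.const_mul {K : Type} [NontriviallyNormedField K] [NormedSpace ℝ K]
    {F : OnePoint K → ℂ} {p : OnePoint K} (c : ℂ) (h : AnalyticAtP1 ℝ F p) :
    AnalyticAtP1 ℝ (fun q => c * F q) p := by
  induction p using OnePoint.rec with
  | infty => exact AnalyticAt.fun_mul analyticAt_const h
  | coe z => exact AnalyticAt.fun_mul analyticAt_const h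

theorem AnalyticAtP1.comp_realPt {F : P1C → ℂ} {t : P1R}
    (h : AnalyticAtP1 ℝ F (realPt t)) : AnalyticAtP1 ℝ (fun q : P1R => F (realPt q)) t := by
  induction t using OnePoint.rec with
  | infty =>
    have h1 : AnalyticAt ℝ (fun w : ℂ => F (chartInfty w)) ((0 : ℝ) : ℂ) := by
      rw [Complex.ofReal_zero]
      exact h
    have h2 := h1.comp (Complex.ofRealCLM.analyticAt (0 : ℝ))
    refine h2.congr (Eventually.of_forall fun w => ?_)
    by_cases hw : w = 0 <;> simp [chartInfty, realPt, hw]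
  | coe x =>
    have h1 : AnalyticAt ℝ (fun w : ℂ => F (w : OnePoint ℂ)) ((x : ℝ) : ℂ) := h
    exact h1.comp (Complex.ofRealCLM.analyticAt x)

/-! ### The principal series sheaf -/

/-- `V^ω_{s,k}(I)`: the real-analytic functions on the open set `I ⊆ P¹(ℝ)`. -/
def V (I : Opens P1R) : Submodule ℂ (I → ℂ) where
  carrier := {φ | ∃ ψ : P1R → ℂ, (∀ t ∈ I, AnalyticAtP1 ℝ ψ t) ∧ ∀ t : I, ψ t = φ t}
  add_mem' := by
    rintro φ φ' ⟨ψ, h1, h2⟩ ⟨ψ', h1', h2'⟩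
    exact ⟨fun t => ψ t + ψ' t, fun t ht => (h1 t ht).add (h1' t ht), fun t => by simp [h2, h2']⟩
  zero_mem' := ⟨fun _ => 0, fun t _ => AnalyticAtP1.zero t, fun _ => rfl⟩
  smul_mem' := by
    rintro c φ ⟨ψ, h1, h2⟩
    exact ⟨fun t => c * ψ t, fun t ht => (h1 t ht).const_mul c, fun t => by simp [h2]⟩

/-- The restriction map `V^ω_{s,k}(I) → V^ω_{s,k}(J)` for `J ⊆ I`. -/
def V.res {I J : Opens P1R} (h : J ≤ I) : V I →ₗ[ℂ] V J where
  toFun φ := ⟨fun t => φ.1 ⟨t.1, h t.2⟩, by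
    obtain ⟨ψ, h1, h2⟩ := φ.2
    exact ⟨ψ, fun t ht => h1 t (h ht), fun t => h2 ⟨t.1, h t.2⟩⟩⟩
  map_add' _ _ := rfl
  map_smul' _ _ := rfl

/-- The fractional linear transformation `(a z + b) / (c z + d)` at a point `z ∈ ℂ` that is
not real. -/
noncomputable def mob (g : G) (z : ℂ) : ℂ :=
  ((g 0 0 : ℂ) * z + (g 0 1 : ℂ)) / ((g 1 0 : ℂ) * z + (g 1 1 : ℂ))

/-- The factor
`(a - ic)^(-s+k/2) (a + ic)^(-s-k/2) ((t-i)/(t-g⁻¹i))^(s-k/2) ((t+i)/(t-g⁻¹(-i)))^(s+k/2)`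
in the principal series action, with `-π ≤ arg (a - ic) < π` and `-π < arg (a + ic) ≤ π`; thus
`log (a - ic)` is the complex conjugate of `log (a + ic)`. The last two factors equal `1` at
`t = ∞`, and for real `t` their bases are never negative real numbers, so that the principal
branch is the one that is continuous on `P¹(ℝ)`. -/
noncomputable def prsFactor (s : ℂ) (k : ℝ) (g : G) (t : P1R) : ℂ :=
  Complex.exp ((-s + k / 2) * starRingEnd ℂ (Complex.log ((g 0 0 : ℂ) + Complex.I * (g 1 0 : ℂ))))
    * Complex.exp ((-s - k / 2) * Complex.log ((g 0 0 : ℂ) + Complex.I * (g 1 0 : ℂ)))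
    * t.elim 1 (fun x : ℝ =>
        (((x : ℂ) - Complex.I) / ((x : ℂ) - mob g⁻¹ Complex.I)) ^ (s - k / 2)
        * (((x : ℂ) + Complex.I) / ((x : ℂ) - mob g⁻¹ (-Complex.I))) ^ (s + k / 2))

/-- The principal series operator `φ ↦ φ|^prs_{s,k} g` from functions on `I` to functions
on `g⁻¹ I`. -/
noncomputable def prs (s : ℂ) (k : ℝ) (g : G) {I : Opens P1R} (φ : I → ℂ) : preR g I → ℂ :=
  fun t => prsFactor s k g t * φ ⟨actR g t, t.2⟩

/-! ### Eigenfunctions of the Laplace operator of weight `k` -/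

/-- The set `Ω ∩ ℍ`. -/
abbrev UpPart (Ω : Opens P1C) : Type := {z : ℍ // upPt z ∈ Ω}

/-- The set `Ω ∩ ℍ`, as a subset of `ℂ`. -/
def upSet (Ω : Opens P1C) : Set ℂ := {z : ℂ | 0 < z.im ∧ (z : OnePoint ℂ) ∈ Ω}

/-- Extension by zero of a function on `Ω ∩ ℍ` to `ℂ`. -/
noncomputable def zeroExt {Ω : Opens P1C} (f : UpPart Ω → ℂ) : ℂ → ℂ :=
  Function.extend (fun z : UpPart Ω => ((z : ℍ) : ℂ)) f 0

/-- `Δ_k = -y² ∂ₓ² - y² ∂_y² + i k y ∂ₓ`. -/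
noncomputable def weightLaplace (k : ℝ) (u : ℂ → ℂ) (z : ℂ) : ℂ :=
  -(z.im : ℂ) ^ 2 * Laplacian.laplacian u z + Complex.I * k * z.im * fderiv ℝ u z 1

theorem isOpen_upSet (Ω : Opens P1C) : IsOpen (upSet Ω) :=
  (isOpen_lt continuous_const Complex.continuous_im).inter
    (Ω.isOpen.preimage OnePoint.continuous_coe)

theorem upCoe_injective (Ω : Opens P1C) :
    Function.Injective (fun z : UpPart Ω => ((z : ℍ) : ℂ)) :=
  fun _ _ h => Subtype.ext (UpperHalfPlane.ext h)

theorem zeroExt_apply {Ω : Opens P1C} (f : UpPart Ω → ℂ) (z : UpPart Ω) :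
    zeroExt f ((z : ℍ) : ℂ) = f z :=
  (upCoe_injective Ω).extend_apply f 0 z

theorem zeroExt_add {Ω : Opens P1C} (f f' : UpPart Ω → ℂ) :
    zeroExt (f + f') = zeroExt f + zeroExt f' := by
  simpa [zeroExt] using Function.extend_add (fun z : UpPart Ω => ((z : ℍ) : ℂ)) f f' 0 0

theorem zeroExt_smul {Ω : Opens P1C} (c : ℂ) (f : UpPart Ω → ℂ) :
    zeroExt (c • f) = c • zeroExt f := by
  simpa [zeroExt] using Function.extend_smul c (fun z : UpPart Ω => ((z : ℍ) : ℂ)) f 0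

theorem weightLaplace_add (k : ℝ) {u v : ℂ → ℂ} {z : ℂ} (hu : ContDiffAt ℝ 2 u z)
    (hv : ContDiffAt ℝ 2 v z) :
    weightLaplace k (u + v) z = weightLaplace k u z + weightLaplace k v z := by
  unfold weightLaplace
  rw [hu.laplacian_add hv,
    fderiv_add (hu.differentiableAt (by norm_num)) (hv.differentiableAt (by norm_num))]
  simp only [_root_.add_apply]
  ring

theorem weightLaplace_smul (k : ℝ) (c : ℂ) {u : ℂ → ℂ} {z : ℂ} (hu : ContDiffAt ℝ 2 u z) :
    weightLaplace k (c • u) z = c * weightLaplace k u z := by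
  have h1 : Laplacian.laplacian (c • u) z = c * Laplacian.laplacian u z := by
    have := hu.laplacian_CLM_comp_left (l := c • ContinuousLinearMap.id ℝ ℂ)
    simpa [Function.comp_def, Pi.smul_def] using this
  unfold weightLaplace
  rw [h1, fderiv_const_smul (hu.differentiableAt (by norm_num))]
  simp only [_root_.smul_apply, smul_eq_mul]
  ring

theorem weightLaplace_congr (k : ℝ) {u v : ℂ → ℂ} {z : ℂ} (h : u =ᶠ[𝓝 z] v) :
    weightLaplace k u z = weightLaplace k v z := by
  unfold weightLaplace
  rw [(InnerProductSpace.laplacian_congr_nhds h).eq_of_nhds, h.fderiv_eq]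

theorem contDiffAt_of_upSet {Ω : Opens P1C} {u : ℂ → ℂ} (h : ContDiffOn ℝ (⊤ : ℕ∞) u (upSet Ω))
    {z : ℂ} (hz : z ∈ upSet Ω) : ContDiffAt ℝ 2 u z :=
  (h.contDiffAt ((isOpen_upSet Ω).mem_nhds hz)).of_le (WithTop.coe_le_coe.mpr (le_top : (2 : ℕ∞) ≤ ⊤))

/-- `E_{s,k}(Ω ∩ ℍ)`: the smooth functions `f` on `Ω ∩ ℍ` with `Δ_k f = s (1 - s) f`. -/
def E (s : ℂ) (k : ℝ) (Ω : Opens P1C) : Submodule ℂ (UpPart Ω → ℂ) where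
  carrier := {f | ContDiffOn ℝ (⊤ : ℕ∞) (zeroExt f) (upSet Ω) ∧
    ∀ z ∈ upSet Ω, weightLaplace k (zeroExt f) z = s * (1 - s) * zeroExt f z}
  add_mem' := by
    rintro f f' ⟨h1, h2⟩ ⟨h1', h2'⟩
    refine ⟨by rw [zeroExt_add]; exact h1.add h1', fun z hz => ?_⟩
    rw [zeroExt_add, weightLaplace_add k (contDiffAt_of_upSet h1 hz) (contDiffAt_of_upSet h1' hz),
      h2 z hz, h2' z hz, Pi.add_apply]
    ring
  zero_mem' := by
    have h0 : zeroExt (0 : UpPart Ω → ℂ) = fun _ => 0 := by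
      have := zeroExt_smul (0 : ℂ) (0 : UpPart Ω → ℂ)
      rw [zero_smul, zero_smul] at this
      exact this
    refine ⟨by rw [h0]; exact contDiffOn_const, fun z _ => ?_⟩
    rw [h0]
    simp [weightLaplace]
  smul_mem' := by
    rintro c f ⟨h1, h2⟩
    refine ⟨by rw [zeroExt_smul]; exact h1.const_smul c, fun z hz => ?_⟩
    rw [zeroExt_smul, weightLaplace_smul k c (contDiffAt_of_upSet h1 hz), h2 z hz, Pi.smul_apply,
      smul_eq_mul]
    ring

/-- `Φ_{s,k}(z) = y^{-s} (z + i)^{s+k/2} (z̄ - i)^{s-k/2}`; on the upper half-plane the principal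
branch has `arg (z + i) ∈ (0, π)` and `arg (z̄ - i) ∈ (-π, 0)`. -/
noncomputable def Phi (s : ℂ) (k : ℝ) (z : ℍ) : ℂ :=
  (z.im : ℂ) ^ (-s) * ((z : ℂ) + Complex.I) ^ (s + k / 2)
    * (starRingEnd ℂ (z : ℂ) - Complex.I) ^ (s - k / 2)

/-- `F` is real-analytic on `Ω` and extends `Φ_{s,k} f` from `Ω ∩ ℍ` to `Ω`. -/
def IsExt (s : ℂ) (k : ℝ) {Ω : Opens P1C} (f : UpPart Ω → ℂ) (F : P1C → ℂ) : Prop :=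
  (∀ p ∈ Ω, AnalyticAtP1 ℝ F p) ∧ ∀ z : UpPart Ω, F (upPt z) = Phi s k z * f z

/-- `B_{s,k}(Ω)`: the elements `f` of `E_{s,k}(Ω ∩ ℍ)` such that, if `Ω` meets `P¹(ℝ)`, the
function `Φ_{s,k} f` extends to a real-analytic function on `Ω`. -/
def B (s : ℂ) (k : ℝ) (Ω : Opens P1C) : Submodule ℂ (UpPart Ω → ℂ) where
  carrier := {f | f ∈ E s k Ω ∧ ((∃ t : P1R, realPt t ∈ Ω) → ∃ F : P1C → ℂ, IsExt s k f F)}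
  add_mem' := by
    rintro f f' ⟨h1, h2⟩ ⟨h1', h2'⟩
    refine ⟨add_mem h1 h1', fun ht => ?_⟩
    obtain ⟨F, hF, hF2⟩ := h2 ht
    obtain ⟨F', hF', hF2'⟩ := h2' ht
    exact ⟨fun p => F p + F' p, fun p hp => (hF p hp).add (hF' p hp),
      fun z => by simp only [hF2, hF2', Pi.add_apply]; ring⟩
  zero_mem' := ⟨zero_mem _, fun _ =>
    ⟨fun _ => 0, fun p _ => AnalyticAtP1.zero p, fun z => by simp⟩⟩
  smul_mem' := by
    rintro c f ⟨h1, h2⟩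
    refine ⟨Submodule.smul_mem _ c h1, fun ht => ?_⟩
    obtain ⟨F, hF, hF2⟩ := h2 ht
    exact ⟨fun p => c * F p, fun p hp => (hF p hp).const_mul c,
      fun z => by simp only [hF2, Pi.smul_apply, smul_eq_mul]; ring⟩

/-- Restriction of functions from `Ω ∩ ℍ` to `Ω' ∩ ℍ`. -/
def restrictUp {Ω Ω' : Opens P1C} (h : Ω' ≤ Ω) (f : UpPart Ω → ℂ) : UpPart Ω' → ℂ :=
  fun z => f ⟨z.1, h z.2⟩

theorem zeroExt_restrictUp_eqOn {Ω Ω' : Opens P1C} (h : Ω' ≤ Ω) (f : UpPart Ω → ℂ) :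
    Set.EqOn (zeroExt (restrictUp h f)) (zeroExt f) (upSet Ω') := by
  rintro z ⟨hz, hz'⟩
  have h1 := zeroExt_apply (restrictUp h f) ⟨⟨z, hz⟩, hz'⟩
  have h2 := zeroExt_apply f ⟨⟨z, hz⟩, h hz'⟩
  exact h1.trans h2.symm

theorem restrictUp_mem (s : ℂ) (k : ℝ) {Ω Ω' : Opens P1C} (h : Ω' ≤ Ω) {f : UpPart Ω → ℂ}
    (hf : f ∈ B s k Ω) : restrictUp h f ∈ B s k Ω' := by
  obtain ⟨⟨h1, h2⟩, h3⟩ := hf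
  have hsub : upSet Ω' ⊆ upSet Ω := fun z hz => ⟨hz.1, h hz.2⟩
  have heq := zeroExt_restrictUp_eqOn h f
  refine ⟨⟨(h1.mono hsub).congr heq, fun z hz => ?_⟩, ?_⟩
  · rw [weightLaplace_congr k (heq.eventuallyEq_of_mem ((isOpen_upSet Ω').mem_nhds hz)),
      heq hz, h2 z (hsub hz)]
  · rintro ⟨t, ht⟩
    obtain ⟨F, hF, hF2⟩ := h3 ⟨t, h ht⟩
    exact ⟨F, fun p hp => hF p (h hp), fun z => hF2 ⟨z.1, h z.2⟩⟩

/-- The restriction map `B_{s,k}(Ω) → B_{s,k}(Ω')` for `Ω' ⊆ Ω`. -/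
def B.res (s : ℂ) (k : ℝ) {Ω Ω' : Opens P1C} (h : Ω' ≤ Ω) : B s k Ω →ₗ[ℂ] B s k Ω' where
  toFun f := ⟨restrictUp h f.1, restrictUp_mem s k h f.2⟩
  map_add' _ _ := rfl
  map_smul' _ _ := rfl

/-- The operator `|_k g`, `(f|_k g)(z) = e^{-i k arg (c z + d)} f (g z)`, from functions on `Ω ∩ ℍ`
to functions on `g⁻¹ Ω ∩ ℍ`. Here `-π < arg ≤ π`. -/
noncomputable def slash (k : ℝ) (g : G) {Ω : Opens P1C} (f : UpPart Ω → ℂ) :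
    UpPart (preC g Ω) → ℂ := fun z =>
  Complex.exp (-Complex.I * k *
      (Complex.arg ((g 1 0 : ℂ) * ((z : ℍ) : ℂ) + (g 1 1 : ℂ)) : ℝ))
    * f ⟨g • (z : ℍ), by
        have h : actC g (upPt z) ∈ Ω := z.2
        rwa [actC_upPt] at h⟩

/-! ### Boundary germs and the restriction morphism -/

/-- The open sets of `P¹(ℂ)` that contain the subset `I` of `P¹(ℝ)`. -/
def Nbhd (I : Opens P1R) : Type := {Ω : Opens P1C // ∀ t ∈ I, realPt t ∈ Ω}

/-- Neighbourhoods of `I` are ordered by reverse inclusion. -/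
instance (I : Opens P1R) : Preorder (Nbhd I) where
  le Ω Ω' := Ω'.1 ≤ Ω.1
  le_refl _ := le_rfl
  le_trans _ _ _ h h' := le_trans h' h

noncomputable instance (I : Opens P1R) : DecidableEq (Nbhd I) := Classical.decEq _

/-- `W^ω_{s,k}(I)`: the direct limit of the spaces `B_{s,k}(Ω)`, where `Ω` runs over the open sets
of `P¹(ℂ)` that contain `I`. -/
abbrev W (s : ℂ) (k : ℝ) (I : Opens P1R) : Type :=
  Module.DirectLimit (fun Ω : Nbhd I => B s k Ω.1)
    (fun Ω Ω' (h : Ω ≤ Ω') => B.res s k (Ω := Ω.1) (Ω' := Ω'.1) h)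

/-- The section of `W^ω_{s,k}` over `I` that is represented by an element of `B_{s,k}(Ω)`. -/
noncomputable def W.of (s : ℂ) (k : ℝ) (I : Opens P1R) (Ω : Nbhd I) : B s k Ω.1 →ₗ[ℂ] W s k I :=
  Module.DirectLimit.of ℂ (Nbhd I) (fun Ω : Nbhd I => B s k Ω.1)
    (fun Ω Ω' (h : Ω ≤ Ω') => B.res s k (Ω := Ω.1) (Ω' := Ω'.1) h) Ω

/-- The restriction map `W^ω_{s,k}(I) → W^ω_{s,k}(J)` for `J ⊆ I`. -/
noncomputable def W.res (s : ℂ) (k : ℝ) {I J : Opens P1R} (hJ : J ≤ I) : W s k I →ₗ[ℂ] W s k J :=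
  Module.DirectLimit.lift ℂ (Nbhd I) _ _
    (fun Ω => W.of s k J ⟨Ω.1, fun t ht => Ω.2 t (hJ ht)⟩)
    (fun Ω Ω' h f => Module.DirectLimit.of_f
      (G := fun Ω : Nbhd J => B s k Ω.1)
      (f := fun Ω Ω' (h : Ω ≤ Ω') => B.res s k (Ω := Ω.1) (Ω' := Ω'.1) h)
      (i := ⟨Ω.1, fun t ht => Ω.2 t (hJ ht)⟩) (j := ⟨Ω'.1, fun t ht => Ω'.2 t (hJ ht)⟩)
      (hij := h) (x := f))

theorem continuous_chartInfty : Continuous (chartInfty (K := ℂ)) := by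
  rw [continuous_iff_continuousAt]
  intro w
  by_cases hw : w = 0
  · subst hw
    rw [ContinuousAt, ← nhdsNE_sup_pure, tendsto_sup]
    refine ⟨?_, tendsto_pure_nhds _ _⟩
    have h0 : chartInfty (0 : ℂ) = ∞ := by simp [chartInfty]
    rw [h0]
    refine Tendsto.congr' ?_ (tendsto_coe_cobounded.comp tendsto_inv₀_nhdsNE_zero)
    filter_upwards [self_mem_nhdsWithin] with w hw
    have hw' : w ≠ 0 := hw
    simp [chartInfty, hw']
  · have h1 : ContinuousAt (fun w : ℂ => ((w⁻¹ : ℂ) : OnePoint ℂ)) w :=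
      OnePoint.continuous_coe.continuousAt.comp (continuousAt_inv₀ hw)
    refine h1.congr ?_
    filter_upwards [isOpen_ne.mem_nhds hw] with w' hw'
    have : w' ≠ 0 := hw'
    simp [chartInfty, this]

/-- Functions that are real-analytic on `Ω` and coincide on `Ω ∩ ℍ` coincide on `Ω ∩ P¹(ℝ)`. -/
theorem eq_on_real {Ω : Opens P1C} {F F' : P1C → ℂ} (hF : ∀ p ∈ Ω, AnalyticAtP1 ℝ F p)
    (hF' : ∀ p ∈ Ω, AnalyticAtP1 ℝ F' p) (h : ∀ z : UpPart Ω, F (upPt z) = F' (upPt z))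
    {t : P1R} (ht : realPt t ∈ Ω) : F (realPt t) = F' (realPt t) := by
  have key : ∀ (u : ℂ → P1C) (a c : ℂ), Continuous u → u a ∈ Ω →
      (∀ e : ℝ, 0 < e → ∃ z : ℍ, u (a + e * c) = upPt z) →
      ContinuousAt (fun w => F (u w)) a → ContinuousAt (fun w => F' (u w)) a →
      F (u a) = F' (u a) := by
    intro u a c hu ha hz hc hc'
    have hp : Tendsto (fun e : ℝ => a + e * c) (𝓝[>] 0) (𝓝 a) := by
      have h1 : Continuous (fun e : ℝ => a + e * c) := by fun_prop
      have h2 := h1.tendsto 0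
      simp only [Complex.ofReal_zero, zero_mul, add_zero] at h2
      exact h2.mono_left nhdsWithin_le_nhds
    have hev : (fun e : ℝ => F (u (a + e * c))) =ᶠ[𝓝[>] 0] fun e : ℝ => F' (u (a + e * c)) := by
      have hΩ : ∀ᶠ e : ℝ in 𝓝[>] 0, u (a + e * c) ∈ Ω :=
        hp.eventually ((Ω.isOpen.preimage hu).mem_nhds ha)
      filter_upwards [hΩ, self_mem_nhdsWithin] with e he he0
      obtain ⟨z, hz⟩ := hz e he0
      rw [hz] at he ⊢
      exact h ⟨z, he⟩
    exact tendsto_nhds_unique ((hc.tendsto.comp hp).congr' hev) (hc'.tendsto.comp hp)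
  induction t using OnePoint.rec with
  | infty =>
    have h0 : chartInfty (0 : ℂ) = realPt ∞ := by simp [chartInfty, realPt]
    rw [← h0]
    rw [← h0] at ht
    refine key chartInfty 0 (-Complex.I) continuous_chartInfty ht (fun e he => ?_) ?_ ?_
    · refine ⟨⟨(e⁻¹ : ℝ) * Complex.I, by simpa using he⟩, ?_⟩
      have : (0 : ℂ) + e * -Complex.I ≠ 0 := by simp [he.ne']
      simp only [chartInfty, this, if_false, upPt]
      congr 1
      push_cast
      simp [mul_comm]
    · exact AnalyticAt.continuousAt (𝕜 := ℝ) (hF (realPt ∞) (h0 ▸ ht))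
    · exact AnalyticAt.continuousAt (𝕜 := ℝ) (hF' (realPt ∞) (h0 ▸ ht))
  | coe x =>
    refine key (fun w => (w : OnePoint ℂ)) (x : ℂ) Complex.I OnePoint.continuous_coe ht
      (fun e he => ⟨⟨x + e * Complex.I, by simpa using he⟩, rfl⟩) ?_ ?_
    · exact AnalyticAt.continuousAt (𝕜 := ℝ) (hF _ ht)
    · exact AnalyticAt.continuousAt (𝕜 := ℝ) (hF' _ ht)

/-- The value at `t ∈ Ω ∩ P¹(ℝ)` of the real-analytic extension `F` of `Φ_{s,k} f`. -/
noncomputable def boundaryValue (s : ℂ) (k : ℝ) {Ω : Opens P1C} (f : B s k Ω) (t : P1R)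
    (ht : realPt t ∈ Ω) : ℂ :=
  (f.2.2 ⟨t, ht⟩).choose (realPt t)

theorem boundaryValue_eq (s : ℂ) (k : ℝ) {Ω : Opens P1C} (f : B s k Ω) {F : P1C → ℂ}
    (hF : IsExt s k f.1 F) (t : P1R) (ht : realPt t ∈ Ω) :
    boundaryValue s k f t ht = F (realPt t) := by
  have h := (f.2.2 ⟨t, ht⟩).choose_spec
  exact eq_on_real h.1 hF.1 (fun z => (h.2 z).trans (hF.2 z).symm) ht

/-- The map `B_{s,k}(Ω) → V^ω_{s,k}(I)`, for `I ⊆ Ω`, that sends `f` to the restriction to `I` of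
the real-analytic extension of `Φ_{s,k} f` to `Ω`. -/
noncomputable def restB (s : ℂ) (k : ℝ) (I : Opens P1R) (Ω : Nbhd I) : B s k Ω.1 →ₗ[ℂ] V I where
  toFun f := ⟨fun t => boundaryValue s k f t (Ω.2 t t.2), by
    by_cases h : ∃ t : P1R, realPt t ∈ Ω.1
    · obtain ⟨F, hF⟩ := f.2.2 h
      exact ⟨fun t => F (realPt t), fun t ht => (hF.1 _ (Ω.2 t ht)).comp_realPt,
        fun t => (boundaryValue_eq s k f hF t (Ω.2 t t.2)).symm⟩
    · exact ⟨fun _ => 0, fun t _ => AnalyticAtP1.zero t, fun t => (h ⟨t, Ω.2 t t.2⟩).elim⟩⟩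
  map_add' f f' := by
    refine Subtype.ext (funext fun t => ?_)
    obtain ⟨F, hF⟩ := f.2.2 ⟨t, Ω.2 t t.2⟩
    obtain ⟨F', hF'⟩ := f'.2.2 ⟨t, Ω.2 t t.2⟩
    have h : IsExt s k (f + f').1 (fun p => F p + F' p) :=
      ⟨fun p hp => (hF.1 p hp).add (hF'.1 p hp), fun z => by
        simp only [hF.2, hF'.2, Submodule.coe_add, Pi.add_apply]; ring⟩
    have e := boundaryValue_eq s k _ h t (Ω.2 t t.2)
    rw [← boundaryValue_eq s k f hF t (Ω.2 t t.2),
      ← boundaryValue_eq s k f' hF' t (Ω.2 t t.2)] at e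
    exact e
  map_smul' c f := by
    refine Subtype.ext (funext fun t => ?_)
    obtain ⟨F, hF⟩ := f.2.2 ⟨t, Ω.2 t t.2⟩
    have h : IsExt s k (c • f).1 (fun p => c * F p) :=
      ⟨fun p hp => (hF.1 p hp).const_mul c, fun z => by
        simp only [hF.2, Submodule.coe_smul, Pi.smul_apply, smul_eq_mul]; ring⟩
    have e := boundaryValue_eq s k _ h t (Ω.2 t t.2)
    rw [← boundaryValue_eq s k f hF t (Ω.2 t t.2)] at e
    exact e

/-- The restriction morphism `rest_{s,k} : W^ω_{s,k}(I) → V^ω_{s,k}(I)`. -/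
noncomputable def rest (s : ℂ) (k : ℝ) (I : Opens P1R) : W s k I →ₗ[ℂ] V I :=
  Module.DirectLimit.lift ℂ (Nbhd I) _ _ (restB s k I) (by
    intro Ω Ω' hΩ f
    refine Subtype.ext (funext fun t => ?_)
    obtain ⟨F, hF⟩ := f.2.2 ⟨t, Ω.2 t t.2⟩
    have h : IsExt s k (B.res s k (Ω := Ω.1) (Ω' := Ω'.1) hΩ f).1 F :=
      ⟨fun p hp => hF.1 p (hΩ hp), fun z => hF.2 ⟨z.1, hΩ z.2⟩⟩
    exact (boundaryValue_eq s k _ h t (Ω'.2 t t.2)).trans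
      (boundaryValue_eq s k f hF t (Ω.2 t t.2)).symm)

/-- If `I ⊆ Ω`, then `g⁻¹ I ⊆ g⁻¹ Ω`. -/
def Nbhd.pre (g : G) {I : Opens P1R} (Ω : Nbhd I) : Nbhd (preR g I) :=
  ⟨preC g Ω.1, fun t ht => by
    have h : realPt (actR g t) ∈ Ω.1 := Ω.2 _ ht
    rw [← actC_realPt] at h
    exact h⟩

/-! ### Intervals and convex sets -/

/-- Open intervals in `P¹(ℝ)`: connected open sets, not equal to `P¹(ℝ)`, with more than
one point. -/
def IsOpenInterval (I : Opens P1R) : Prop :=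
  IsConnected (I : Set P1R) ∧ (I : Set P1R) ≠ Set.univ ∧ (I : Set P1R).Nontrivial

/-- Convex subsets of `P¹(ℂ)`: the images under elements of `SL₂(ℝ)` of the convex subsets of `ℂ`.
The choice `g = 1` gives the convex subsets of `ℂ` themselves; other `g` are needed for sets that
contain `∞`. -/
def IsConvexP1 (Ω : Set P1C) : Prop :=
  ∃ (g : G) (C : Set ℂ), Convex ℝ C ∧ Ω = (fun z : ℂ => actC g (z : OnePoint ℂ)) '' C

end BoundaryGerm

namespace BoundaryGerm

open Filter Topology TopologicalSpace
open UpperHalfPlane hiding I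
open Complex (I)
open scoped OnePoint ComplexConjugate

/-! Put a = s + k/2, b = s - k/2 and write f = y^s A on ℍ. The eigenvalue equation becomes the
Euler-Poisson-Darboux equation (z - z̄) A_{zz̄} - b A_z + a A_z̄ = 0 (`weightLaplace_imPow_mul`),
while Φ_{s,k} f = (z+i)^a (z̄-i)^b A, and the factor in front of A is real-analytic without zeros
near ℝ. Away from ∞, a boundary germ is therefore a real-analytic solution A of this equation, which
is singular along ℝ, and its boundary value is A|_ℝ times a known factor.

Uniqueness: the equation has exponents 0 and 1 - 2s along y = 0. Differentiated n times in y, it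
expresses (a + b + n) ∂_y^{n+1} A on ℝ through tangential derivatives of normal derivatives of order
at most n. As a + b = 2s is not in ℤ_{≤0}, zero boundary values force all normal derivatives, hence
A, to vanish (`pd_iter_real_eq_zero`, `eq_zero_of_epd`).

Existence: if h is holomorphic and Re a, Re b > 1, then ∫₀¹ t^(a-1) (1-t)^(b-1) h((1-t) z̄ + t z) dt
is a solution with boundary value B(a,b) h (`epd_segIntegral`), where B(a,b) is the beta integral.
Contiguity relations lower a or b by one as long as the new a + b is nonzero (`IsEpdSol.lower_left`,
`IsEpdSol.lower_right`), and so reach all admissible parameters. The construction lives on any open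
set in which h is holomorphic and which contains the segment from z̄ to z with each z; this is why a
convex symmetric Ω does not have to be shrunk.

Group action: `weightLaplace_slash` gives invariance of the equation, and `Phi_mul_autFactor` shows
that f ↦ f|_k g turns the extension F of Φ_{s,k} f into a multiplier times F ∘ g, the multiplier
being the principal series factor on P¹(ℝ). This is the intertwining statement, and it also moves ∞
to a finite point. Local solutions glue by uniqueness (`exists_glued_sol`). For the convex domains,
a rotation fixing ±i reduces Ω to a convex subset of ℂ (`exists_rotation_mul`,
`exists_representative`). -/

/-! ### Wirtinger calculus -/

section Wirtinger

/-- The real-linear map `v ↦ a v + b v̄`. -/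
noncomputable def wd (a b : ℂ) : ℂ →L[ℝ] ℂ :=
  a • ContinuousLinearMap.id ℝ ℂ + b • (Complex.conjCLE : ℂ →L[ℝ] ℂ)

@[simp] theorem wd_apply (a b v : ℂ) : wd a b v = a * v + b * conj v := by
  simp [wd]

/-- The Wirtinger derivative `∂/∂z`. -/
noncomputable def dz (u : ℂ → ℂ) (z : ℂ) : ℂ := (fderiv ℝ u z 1 - I * fderiv ℝ u z I) / 2

/-- The Wirtinger derivative `∂/∂z̄`. -/
noncomputable def dw (u : ℂ → ℂ) (z : ℂ) : ℂ := (fderiv ℝ u z 1 + I * fderiv ℝ u z I) / 2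

theorem clm_eq_wd (l : ℂ →L[ℝ] ℂ) : l = wd ((l 1 - I * l I) / 2) ((l 1 + I * l I) / 2) := by
  ext v
  have h : l v = v.re * l 1 + v.im * l I := by
    conv_lhs => rw [← Complex.re_add_im v]
    have h1 : (v.re : ℂ) = v.re • (1 : ℂ) := by simp
    have h2 : (v.im : ℂ) * I = v.im • I := by simp
    rw [h1, h2, map_add, map_smul, map_smul]
    simp
  have hv : v = v.re + v.im * I := (Complex.re_add_im v).symm
  have hc : conj v = v.re - v.im * I := by
    apply Complex.ext <;> simp
  rw [h, wd_apply, hc]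
  nth_rw 3 [hv]
  linear_combination v.im * l I * Complex.I_sq

theorem _root_.DifferentiableAt.hasFDerivAt_wd {u : ℂ → ℂ} {z : ℂ} (h : DifferentiableAt ℝ u z) :
    HasFDerivAt u (wd (dz u z) (dw u z)) z := by
  have := h.hasFDerivAt
  rwa [clm_eq_wd (fderiv ℝ u z)] at this

section Rules

variable {u v : ℂ → ℂ} {a b a' b' z : ℂ}

/-- With `dw_eq`, this lets Wirtinger derivatives be computed by the `HasFDerivAt` rules below: the
coefficient pair of `wd` is the pair of derivatives along z and z̄. -/
theorem dz_eq (h : HasFDerivAt u (wd a b) z) : dz u z = a := by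
  rw [dz, h.fderiv]
  simp only [wd_apply, map_one, Complex.conj_I]
  linear_combination (-a / 2 + b / 2) * Complex.I_sq

theorem dw_eq (h : HasFDerivAt u (wd a b) z) : dw u z = b := by
  rw [dw, h.fderiv]
  simp only [wd_apply, map_one, Complex.conj_I]
  linear_combination (a / 2 - b / 2) * Complex.I_sq

theorem wd_const (c : ℂ) : HasFDerivAt (fun _ : ℂ => c) (wd 0 0) z := by
  refine (hasFDerivAt_const c z).congr_fderiv ?_
  ext v; simp

theorem wd_add (h : HasFDerivAt u (wd a b) z) (h' : HasFDerivAt v (wd a' b') z) :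
    HasFDerivAt (fun w => u w + v w) (wd (a + a') (b + b')) z := by
  refine (h.add h').congr_fderiv ?_
  ext v; simp; ring

theorem wd_sub (h : HasFDerivAt u (wd a b) z) (h' : HasFDerivAt v (wd a' b') z) :
    HasFDerivAt (fun w => u w - v w) (wd (a - a') (b - b')) z := by
  refine (h.sub h').congr_fderiv ?_
  ext v; simp; ring

theorem wd_mul (h : HasFDerivAt u (wd a b) z) (h' : HasFDerivAt v (wd a' b') z) :
    HasFDerivAt (fun w => u w * v w) (wd (a * v z + u z * a') (b * v z + u z * b')) z := by
  refine (h.mul h').congr_fderiv ?_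
  ext v; simp; ring

theorem wd_const_mul (c : ℂ) (h : HasFDerivAt u (wd a b) z) :
    HasFDerivAt (fun w => c * u w) (wd (c * a) (c * b)) z := by
  refine (h.const_mul c).congr_fderiv ?_
  ext v; simp; ring

theorem wd_id : HasFDerivAt (fun w : ℂ => w) (wd 1 0) z := by
  refine (hasFDerivAt_id z).congr_fderiv ?_
  ext v; simp

theorem wd_conj : HasFDerivAt (fun w : ℂ => conj w) (wd 0 1) z := by
  refine (Complex.conjCLE : ℂ →L[ℝ] ℂ).hasFDerivAt.congr_fderiv ?_
  ext v; simp

theorem wd_outer {φ : ℂ → ℂ} {φ' : ℂ} (hφ : HasDerivAt φ φ' (u z)) (h : HasFDerivAt u (wd a b) z) :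
    HasFDerivAt (fun w => φ (u w)) (wd (φ' * a) (φ' * b)) z := by
  refine ((hφ.hasFDerivAt.restrictScalars ℝ).comp z h).congr_fderiv ?_
  ext v; simp; ring

theorem wd_inner {m : ℂ → ℂ} {m' : ℂ} (h : HasFDerivAt u (wd a b) (m z)) (hm : HasDerivAt m m' z) :
    HasFDerivAt (fun w => u (m w)) (wd (a * m') (b * conj m')) z := by
  refine (h.comp z (hm.hasFDerivAt.restrictScalars ℝ)).congr_fderiv ?_
  ext v; simp; ring

theorem wd_holo {m : ℂ → ℂ} {m' : ℂ} (hm : HasDerivAt m m' z) : HasFDerivAt m (wd m' 0) z := by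
  have := wd_outer (z := z) (u := fun w => w) hm wd_id
  simpa using this

end Rules

theorem dz_congr {u v : ℂ → ℂ} {z : ℂ} (h : u =ᶠ[𝓝 z] v) : dz u z = dz v z := by
  rw [dz, dz, h.fderiv_eq]

theorem dw_congr {u v : ℂ → ℂ} {z : ℂ} (h : u =ᶠ[𝓝 z] v) : dw u z = dw v z := by
  rw [dw, dw, h.fderiv_eq]

theorem _root_.AnalyticAt.fderiv_apply_const {u : ℂ → ℂ} {z : ℂ} (h : AnalyticAt ℝ u z) (v : ℂ) :
    AnalyticAt ℝ (fun w => fderiv ℝ u w v) z :=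
  ((ContinuousLinearMap.apply ℝ ℂ v).analyticAt _).comp h.fderiv

theorem _root_.AnalyticAt.dz {u : ℂ → ℂ} {z : ℂ} (h : AnalyticAt ℝ u z) : AnalyticAt ℝ (dz u) z := by
  unfold BoundaryGerm.dz
  exact ((h.fderiv_apply_const 1).sub (analyticAt_const.mul (h.fderiv_apply_const I))).div_const

theorem _root_.AnalyticAt.dw {u : ℂ → ℂ} {z : ℂ} (h : AnalyticAt ℝ u z) : AnalyticAt ℝ (dw u) z := by
  unfold BoundaryGerm.dw
  exact ((h.fderiv_apply_const 1).add (analyticAt_const.mul (h.fderiv_apply_const I))).div_const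

theorem fderiv_fderiv_apply {u : ℂ → ℂ} {z : ℂ} (h : ContDiffAt ℝ 2 u z) (v w : ℂ) :
    fderiv ℝ (fun x => fderiv ℝ u x v) z w = fderiv ℝ (fderiv ℝ u) z w v := by
  have h1 : DifferentiableAt ℝ (fderiv ℝ u) z :=
    (h.fderiv_right (m := 1) (by norm_num)).differentiableAt (by norm_num)
  rw [fderiv_clm_apply h1 (differentiableAt_const v)]
  simp

theorem differentiableAt_fderiv_apply {u : ℂ → ℂ} {z : ℂ} (h : ContDiffAt ℝ 2 u z) (v : ℂ) :
    DifferentiableAt ℝ (fun x => fderiv ℝ u x v) z :=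
  ((h.fderiv_right (m := 1) (by norm_num)).differentiableAt (by norm_num)).clm_apply
    (differentiableAt_const v)

theorem differentiableAt_dz {u : ℂ → ℂ} {z : ℂ} (h : ContDiffAt ℝ 2 u z) :
    DifferentiableAt ℝ (dz u) z :=
  ((differentiableAt_fderiv_apply h 1).sub
    ((differentiableAt_fderiv_apply h I).const_mul I)).mul_const (2 : ℂ)⁻¹

theorem fderiv_dz_apply {u : ℂ → ℂ} {z : ℂ} (h : ContDiffAt ℝ 2 u z) (w : ℂ) :
    fderiv ℝ (dz u) z w
      = (fderiv ℝ (fderiv ℝ u) z w 1 - I * fderiv ℝ (fderiv ℝ u) z w I) / 2 := by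
  have h1 := (differentiableAt_fderiv_apply h 1).hasFDerivAt
  have h2 := (differentiableAt_fderiv_apply h I).hasFDerivAt
  have h3 : HasFDerivAt (dz u) _ z := (h1.sub (h2.const_mul I)).mul_const (2 : ℂ)⁻¹
  rw [h3.fderiv]
  simp only [_root_.smul_apply, _root_.sub_apply, fderiv_fderiv_apply h, smul_eq_mul]
  ring

theorem fderiv_dw_apply {u : ℂ → ℂ} {z : ℂ} (h : ContDiffAt ℝ 2 u z) (w : ℂ) :
    fderiv ℝ (dw u) z w
      = (fderiv ℝ (fderiv ℝ u) z w 1 + I * fderiv ℝ (fderiv ℝ u) z w I) / 2 := by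
  have h1 := (differentiableAt_fderiv_apply h 1).hasFDerivAt
  have h2 := (differentiableAt_fderiv_apply h I).hasFDerivAt
  have h3 : HasFDerivAt (dw u) _ z := (h1.add (h2.const_mul I)).mul_const (2 : ℂ)⁻¹
  rw [h3.fderiv]
  simp only [_root_.smul_apply, _root_.add_apply, fderiv_fderiv_apply h, smul_eq_mul]
  ring

theorem fderiv_fderiv_symm {u : ℂ → ℂ} {z : ℂ} (h : ContDiffAt ℝ 2 u z) (v w : ℂ) :
    fderiv ℝ (fderiv ℝ u) z v w = fderiv ℝ (fderiv ℝ u) z w v :=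
  (h.isSymmSndFDerivAt (by simp)).eq v w

theorem dz_dw_comm {u : ℂ → ℂ} {z : ℂ} (h : ContDiffAt ℝ 2 u z) : dz (dw u) z = dw (dz u) z := by
  rw [dw, dz, fderiv_dz_apply h, fderiv_dz_apply h, fderiv_dw_apply h, fderiv_dw_apply h,
    fderiv_fderiv_symm h 1 I]
  ring

theorem laplacian_eq_dw_dz {u : ℂ → ℂ} {z : ℂ} (h : ContDiffAt ℝ 2 u z) :
    Laplacian.laplacian u z = 4 * dw (dz u) z := by
  rw [InnerProductSpace.laplacian_eq_iteratedFDeriv_complexPlane]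
  simp only [iteratedFDeriv_two_apply, Matrix.cons_val_zero, Matrix.cons_val_one]
  rw [dw, fderiv_dz_apply h, fderiv_dz_apply h, fderiv_fderiv_symm h 1 I]
  linear_combination fderiv ℝ (fderiv ℝ u) z I I * Complex.I_sq

theorem fderiv_one_eq (u : ℂ → ℂ) (z : ℂ) : fderiv ℝ u z 1 = dz u z + dw u z := by
  rw [dz, dw]; ring

theorem weightLaplace_eq (k : ℝ) {u : ℂ → ℂ} {z : ℂ} (h : ContDiffAt ℝ 2 u z) :
    weightLaplace k u z
      = -4 * (z.im : ℂ) ^ 2 * dw (dz u) z + I * k * z.im * (dz u z + dw u z) := by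
  rw [weightLaplace, laplacian_eq_dw_dz h, fderiv_one_eq]; ring

/-- The Euler-Poisson-Darboux operator `(z - z̄) ∂_z ∂_z̄ - b ∂_z + a ∂_z̄`. -/
noncomputable def epd (a b : ℂ) (A : ℂ → ℂ) (z : ℂ) : ℂ :=
  (z - conj z) * dw (dz A) z - b * dz A z + a * dw A z

theorem wd_imPow (s : ℂ) {z : ℂ} (hz : 0 < z.im) :
    HasFDerivAt (fun w : ℂ => (w.im : ℂ) ^ s)
      (wd (s * (z.im : ℂ) ^ (s - 1) * (-I / 2)) (s * (z.im : ℂ) ^ (s - 1) * (I / 2))) z := by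
  -- Here y = (-i/2)(z - z̄).
  have h1 : HasFDerivAt (fun w : ℂ => (w.im : ℂ)) (wd (-I / 2) (I / 2)) z := by
    have h := wd_const_mul (z := z) (-I / 2) (wd_sub wd_id wd_conj)
    simp only [sub_zero, zero_sub, mul_one] at h
    have e : -I / 2 * -1 = I / 2 := by ring
    rw [e] at h
    refine h.congr_of_eventuallyEq (Eventually.of_forall fun w => ?_)
    simp only [Complex.sub_conj]
    push_cast
    linear_combination (w.im : ℂ) * Complex.I_sq
  refine wd_outer (φ := fun x : ℂ => x ^ s) ?_ h1
  have := (hasDerivAt_id (z.im : ℂ)).cpow_const (c := s) (Or.inl (by simpa using hz))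
  simpa using this

theorem imPow_sub_one (s : ℂ) {y : ℝ} (hy : 0 < y) :
    (y : ℂ) ^ s = (y : ℂ) * (y : ℂ) ^ (s - 1) := by
  have hy' : (y : ℂ) ≠ 0 := by exact_mod_cast hy.ne'
  rw [Complex.cpow_sub _ _ hy', Complex.cpow_one]
  field_simp

theorem contDiffAt_imPow (s : ℂ) {z : ℂ} (hz : 0 < z.im) {n : ℕ∞} :
    ContDiffAt ℝ n (fun w : ℂ => (w.im : ℂ) ^ s) z := by
  have h1 : ContDiffAt ℝ n (fun w : ℂ => (w.im : ℂ)) z :=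
    (Complex.ofRealCLM.comp Complex.imCLM).contDiff.contDiffAt
  have h2 : AnalyticAt ℂ (fun x : ℂ => x ^ s) (z.im : ℂ) :=
    analyticAt_id.cpow analyticAt_const (Or.inl (by simpa using hz))
  exact h2.restrictScalars.contDiffAt.comp z h1

/-- The equation `Δ_k f = s (1 - s) f` for `f = y^s A` is the Euler-Poisson-Darboux equation
for `A`. -/
theorem weightLaplace_imPow_mul (s : ℂ) (k : ℝ) {A : ℂ → ℂ} {z : ℂ} (hz : 0 < z.im)
    (hA : ContDiffAt ℝ 2 A z) :
    weightLaplace k (fun w => (w.im : ℂ) ^ s * A w) z - s * (1 - s) * ((z.im : ℂ) ^ s * A z)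
      = 2 * I * (z.im : ℂ) * (z.im : ℂ) ^ s * epd (s + k / 2) (s - k / 2) A z := by
  have hev : ∀ᶠ w in 𝓝 z, ContDiffAt ℝ 2 A w ∧ 0 < w.im :=
    (hA.eventually (by simp)).and ((isOpen_lt continuous_const Complex.continuous_im).mem_nhds hz)
  have hu : ContDiffAt ℝ 2 (fun w : ℂ => (w.im : ℂ) ^ s * A w) z :=
    (contDiffAt_imPow s hz (n := 2)).mul hA
  have hAd : HasFDerivAt A (wd (dz A z) (dw A z)) z :=
    (hA.differentiableAt (by norm_num)).hasFDerivAt_wd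
  have h1 := wd_mul (wd_imPow s hz) hAd
  -- The formula is needed on a neighbourhood, because it is differentiated once more.
  have hdz : dz (fun w : ℂ => (w.im : ℂ) ^ s * A w) =ᶠ[𝓝 z] fun w =>
      s * (-I / 2) * ((w.im : ℂ) ^ (s - 1) * A w) + (w.im : ℂ) ^ s * dz A w := by
    filter_upwards [hev] with w hw
    rw [dz_eq (wd_mul (wd_imPow s hw.2) (hw.1.differentiableAt (by norm_num)).hasFDerivAt_wd)]
    ring
  have h2 := wd_add (wd_const_mul (s * (-I / 2)) (wd_mul (wd_imPow (s - 1) hz) hAd))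
    (wd_mul (wd_imPow s hz) (differentiableAt_dz hA).hasFDerivAt_wd)
  rw [weightLaplace_eq k hu, dz_eq h1, dw_eq h1, dw_congr hdz, dw_eq h2, epd]
  -- All powers of y are expressed through y^(s-2), so that a single unknown power remains for
  -- `ring`.
  rw [imPow_sub_one s hz, imPow_sub_one (s - 1) hz, Complex.sub_conj]
  push_cast
  generalize (z.im : ℂ) ^ (s - 1 - 1) = Y
  generalize (z.im : ℂ) = y
  ring_nf
  simp only [Complex.I_sq]
  ring

end Wirtinger

/-! ### Equivariance of the Laplace operator -/

section Equivariance

theorem wd_conj_comp {u : ℂ → ℂ} {a b z : ℂ} (h : HasFDerivAt u (wd a b) z) :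
    HasFDerivAt (fun w => conj (u w)) (wd (conj b) (conj a)) z := by
  refine ((Complex.conjCLE : ℂ →L[ℝ] ℂ).hasFDerivAt.comp z h).congr_fderiv ?_
  ext v; simp; ring

theorem det_eq_one (g : G) : (g 0 0 : ℂ) * g 1 1 - g 0 1 * g 1 0 = 1 := by
  have := g.det_coe
  rw [Matrix.det_fin_two] at this
  exact_mod_cast this

/-- The denominator `c z + d`. -/
noncomputable def den (g : G) (z : ℂ) : ℂ := (g 1 0 : ℂ) * z + (g 1 1 : ℂ)

theorem den_ne_zero (g : G) {z : ℂ} (hz : z.im ≠ 0) : den g z ≠ 0 := by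
  intro h
  have h1 := congrArg Complex.im h
  have h2 := congrArg Complex.re h
  simp only [den, Complex.add_im, Complex.mul_im, Complex.ofReal_re, Complex.ofReal_im,
    zero_mul, add_zero, Complex.zero_im, mul_eq_zero, hz, or_false] at h1
  simp only [den, Complex.add_re, Complex.mul_re, Complex.ofReal_re, Complex.ofReal_im,
    zero_mul, sub_zero, Complex.zero_re, h1, zero_add] at h2
  have := det_eq_one g
  simp [h1, h2] at this

theorem conj_den (g : G) (z : ℂ) : conj (den g z) = den g (conj z) := by
  simp [den]

theorem conj_mob (g : G) (z : ℂ) : conj (mob g z) = mob g (conj z) := by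
  simp [mob]

theorem hasDerivAt_den (g : G) (z : ℂ) : HasDerivAt (den g) (g 1 0 : ℂ) z := by
  exact (((hasDerivAt_id z).const_mul (g 1 0 : ℂ)).add_const (g 1 1 : ℂ)).congr_deriv (mul_one _)

theorem hasDerivAt_mob (g : G) {z : ℂ} (hz : den g z ≠ 0) :
    HasDerivAt (mob g) (den g z ^ 2)⁻¹ z := by
  have h1 := ((hasDerivAt_id z).const_mul (g 0 0 : ℂ)).add_const (g 0 1 : ℂ)
  refine (h1.div (hasDerivAt_den g z) hz).congr_deriv ?_
  have := det_eq_one g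
  field_simp
  simp only [id, den]
  linear_combination this

theorem mob_im (g : G) {z : ℂ} (hz : den g z ≠ 0) :
    ((mob g z).im : ℂ) = z.im / (den g z * den g (conj z)) := by
  have hz' : den g (conj z) ≠ 0 := by rw [← conj_den]; simpa using hz
  have h1 : ((mob g z).im : ℂ) = (mob g z - conj (mob g z)) / (2 * I) := by
    rw [Complex.sub_conj]; push_cast; field_simp
  have h2 : (z.im : ℂ) = (z - conj z) / (2 * I) := by
    rw [Complex.sub_conj]; push_cast; field_simp
  rw [h1, h2, conj_mob]
  have hm : ∀ w, mob g w = ((g 0 0 : ℂ) * w + (g 0 1 : ℂ)) / den g w := fun _ => rfl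
  rw [hm, hm]
  field_simp
  simp only [den]
  linear_combination (z - conj z) * det_eq_one g

theorem mob_im_pos (g : G) {z : ℂ} (hz : 0 < z.im) : 0 < (mob g z).im := by
  have hd := den_ne_zero g hz.ne'
  have h1 := mob_im g hd
  rw [← conj_den, Complex.mul_conj] at h1
  have : (mob g z).im = z.im / Complex.normSq (den g z) := by exact_mod_cast h1
  rw [this]
  exact div_pos hz (Complex.normSq_pos.mpr hd)

theorem mob_coe (g : G) (z : ℍ) : mob g (z : ℂ) = ((g • z : ℍ) : ℂ) := by
  rw [UpperHalfPlane.coe_specialLinearGroup_apply]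
  simp [mob]

/-- The automorphy factor `e^{-i k arg (c z + d)}`. -/
noncomputable def autFactor (k : ℝ) (g : G) (z : ℂ) : ℂ :=
  Complex.exp (-I * k * (Complex.arg (den g z) : ℝ))

/-- With D = cz + d, the factor is exp(-(k/2)(log D - conj (log D))), which can be differentiated
when D is off the branch cut. For c = 0 the constant D may lie on the cut, but then the factor is
constant. -/
theorem wd_autFactor (k : ℝ) (g : G) {z : ℂ} (hz : 0 < z.im) :
    HasFDerivAt (autFactor k g)
      (wd (autFactor k g z * (-(k / 2) * (g 1 0) / den g z))
        (autFactor k g z * (k / 2 * (g 1 0) / den g (conj z)))) z := by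
  by_cases hc : g 1 0 = 0
  · have h1 : autFactor k g = fun _ => autFactor k g z := by
      funext w; simp [autFactor, den, hc]
    rw [hc, h1]
    simpa using wd_const (z := z) (autFactor k g z)
  · have hs : den g z ∈ Complex.slitPlane := by
      refine Or.inr ?_
      simpa [den] using ⟨hc, hz.ne'⟩
    have h1 := wd_holo ((hasDerivAt_den g z).clog hs)
    have h2 := wd_const_mul (-(k / 2 : ℂ)) (wd_sub h1 (wd_conj_comp h1))
    have h3 := wd_outer (Complex.hasDerivAt_exp _) h2
    have h4 : (fun w => Complex.exp (-(k / 2 : ℂ) *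
        (Complex.log (den g w) - conj (Complex.log (den g w))))) = autFactor k g := by
      funext w
      rw [autFactor, Complex.sub_conj, Complex.log_im]
      congr 1; push_cast; ring
    have h5 : Complex.exp (-(k / 2 : ℂ) *
        (Complex.log (den g z) - conj (Complex.log (den g z)))) = autFactor k g z := congrFun h4 z
    rw [h4, h5] at h3
    refine h3.congr_fderiv ?_
    congr 1
    · simp; ring
    · rw [← conj_den, map_div₀, Complex.conj_ofReal]; ring

theorem wd_denInv (g : G) {z : ℂ} (hz : den g z ≠ 0) :
    HasFDerivAt (fun w => (den g w)⁻¹) (wd (-(g 1 0 : ℂ) * ((den g z)⁻¹ * (den g z)⁻¹)) 0) z := by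
  refine wd_holo (((hasDerivAt_den g z).inv hz).congr_deriv ?_)
  field_simp

theorem contDiffAt_mob (g : G) {z : ℂ} (hz : den g z ≠ 0) {n : WithTop ℕ∞} :
    ContDiffAt ℝ n (mob g) z := by
  have h1 : ContDiff ℝ n (fun w : ℂ => (g 0 0 : ℂ) * w + (g 0 1 : ℂ)) := by fun_prop
  have h2 : ContDiff ℝ n (fun w : ℂ => (g 1 0 : ℂ) * w + (g 1 1 : ℂ)) := by fun_prop
  have e : mob g = fun w : ℂ => ((g 0 0 : ℂ) * w + (g 0 1 : ℂ)) *
      ((g 1 0 : ℂ) * w + (g 1 1 : ℂ))⁻¹ := by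
    funext w; rw [mob, div_eq_mul_inv]
  rw [e]
  exact h1.contDiffAt.mul (h2.contDiffAt.inv hz)

theorem contDiffAt_autFactor (k : ℝ) (g : G) {z : ℂ} (hz : 0 < z.im) {n : ℕ∞} :
    ContDiffAt ℝ n (autFactor k g) z := by
  by_cases hc : g 1 0 = 0
  · have h1 : autFactor k g = fun _ => autFactor k g z := by
      funext w; simp [autFactor, den, hc]
    rw [h1]
    exact contDiffAt_const
  · have hs : den g z ∈ Complex.slitPlane := by
      refine Or.inr ?_
      simpa [den] using ⟨hc, hz.ne'⟩
    have h1 : ContDiff ℝ n (fun w : ℂ => (g 1 0 : ℂ) * w + (g 1 1 : ℂ)) := by fun_prop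
    have h2 : ContDiffAt ℝ n (fun w => Complex.log (den g w)) z :=
      (analyticAt_clog hs).restrictScalars.contDiffAt.comp (f := den g) z h1.contDiffAt
    have h3 : ContDiffAt ℝ n (fun w => ((Complex.log (den g w)).im : ℂ)) z :=
      (Complex.ofRealCLM.comp Complex.imCLM).contDiff.contDiffAt.comp z h2
    simp only [Complex.log_im] at h3
    exact (contDiffAt_const.mul h3).cexp

/-- A chain rule computation with (gz)' = D⁻² and Im gz = y / (D D̄), where D = cz + d. The terms
produced by the automorphy factor cancel because of 2icy = D - D̄, which is `hc` in the proof. -/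
theorem weightLaplace_slash (k : ℝ) (g : G) {u : ℂ → ℂ} {z : ℂ} (hz : 0 < z.im)
    (hu : ContDiffAt ℝ 2 u (mob g z)) :
    weightLaplace k (fun w => autFactor k g w * u (mob g w)) z
      = autFactor k g z * weightLaplace k u (mob g z) := by
  have hd : den g z ≠ 0 := den_ne_zero g hz.ne'
  have hd' : den g (conj z) ≠ 0 := by rw [← conj_den]; simpa using hd
  have hcont : ContinuousAt (mob g) z := (hasDerivAt_mob g hd).continuousAt
  have hev : ∀ᶠ w in 𝓝 z, ContDiffAt ℝ 2 u (mob g w) ∧ 0 < w.im :=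
    (hcont.eventually (hu.eventually (by simp))).and
      ((isOpen_lt continuous_const Complex.continuous_im).mem_nhds hz)
  have hv : ContDiffAt ℝ 2 (fun w => autFactor k g w * u (mob g w)) z :=
    (contDiffAt_autFactor k g hz (n := 2)).mul (hu.comp z (contDiffAt_mob g hd))
  have first : ∀ w, ContDiffAt ℝ 2 u (mob g w) ∧ 0 < w.im →
      HasFDerivAt (fun w => autFactor k g w * u (mob g w)) _ w := fun w hw =>
    wd_mul (wd_autFactor k g hw.2) (wd_inner (hw.1.differentiableAt (by norm_num)).hasFDerivAt_wd
      (hasDerivAt_mob g (den_ne_zero g hw.2.ne')))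
  have h1 := first z ⟨hu, hz⟩
  have hdz : dz (fun w => autFactor k g w * u (mob g w)) =ᶠ[𝓝 z] fun w =>
      autFactor k g w * (-(k / 2) * (g 1 0) * ((den g w)⁻¹ * u (mob g w))
        + dz u (mob g w) * ((den g w)⁻¹ * (den g w)⁻¹)) := by
    filter_upwards [hev] with w hw
    rw [dz_eq (first w hw)]
    field_simp
  have hi := wd_denInv g hd
  have hm := hasDerivAt_mob g hd
  have h2 := wd_mul (wd_autFactor k g hz) (wd_add
    (wd_const_mul (-(k / 2) * (g 1 0) : ℂ)
      (wd_mul hi (wd_inner (hu.differentiableAt (by norm_num)).hasFDerivAt_wd hm)))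
    (wd_mul (wd_inner (differentiableAt_dz hu).hasFDerivAt_wd hm) (wd_mul hi hi)))
  rw [weightLaplace_eq k hv, weightLaplace_eq k hu, dz_eq h1, dw_eq h1, dw_congr hdz, dw_eq h2,
    mob_im g hd]
  have hc : (g 1 0 : ℂ) * (2 * I * z.im) = den g z - den g (conj z) := by
    have := Complex.sub_conj z
    push_cast at this
    simp only [den]
    linear_combination -(g 1 0 : ℂ) * this
  simp only [map_inv₀, map_pow, conj_den]
  generalize autFactor k g z = j
  generalize hD : den g z = D at *
  generalize hD' : den g (conj z) = D' at *
  generalize u (mob g z) = U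
  generalize dz u (mob g z) = U1
  generalize dw u (mob g z) = U2
  generalize dw (dz u) (mob g z) = U3
  generalize (g 1 0 : ℂ) = c at *
  generalize (z.im : ℂ) = y at *
  field_simp
  linear_combination y * j * (2 * k ^ 2 * c * D * D' * U - 4 * k * D' * U1 + 4 * k * D * U2)
    * (-I * hc + 2 * c * y * Complex.I_sq)

end Equivariance

/-! ### Solutions of the Euler-Poisson-Darboux equation with given diagonal values -/

section Superposition

variable {K : Type} [TopologicalSpace K]

/-- Superposition `a ↦ h ∘ a` on the Banach algebra `C(K, ℂ)`. -/
noncomputable def superpose (h : ℂ → ℂ) (a : C(K, ℂ)) : C(K, ℂ) :=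
  open Classical in if H : Continuous (fun t => h (a t)) then ⟨_, H⟩ else 0

theorem superpose_apply {h : ℂ → ℂ} {U : Set ℂ} (hh : ContinuousOn h U) {a : C(K, ℂ)}
    (ha : ∀ t, a t ∈ U) (t : K) : superpose h a t = h (a t) := by
  have H : Continuous (fun t => h (a t)) := hh.comp_continuous a.continuous ha
  simp [superpose, H]

/-- Taylor expansion under the function symbol: h(a + v) = Σ (h^(n) ∘ a / n!) vⁿ in the Banach
algebra. Compactness of the range of a gives one radius δ for all points. Analyticity of the
parameter integrals, with their first derivative, follows by composition. -/
theorem exists_powerSeries_superpose [CompactSpace K] {h : ℂ → ℂ} {U : Set ℂ} (hU : IsOpen U)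
    (hh : DifferentiableOn ℂ h U) (a : C(K, ℂ)) (ha : ∀ t, a t ∈ U) :
    ∃ p : FormalMultilinearSeries ℂ C(K, ℂ) C(K, ℂ), HasFPowerSeriesAt (superpose h) p a ∧
      ∀ v, p 1 (fun _ => v) = superpose (deriv h) a * v := by
  have hK : IsCompact (Set.range a) := isCompact_range a.continuous
  obtain ⟨δ, hδ, hsub⟩ := hK.exists_cthickening_subset_open hU (by rintro _ ⟨t, rfl⟩; exact ha t)
  have hball : ∀ t, Metric.closedBall (a t) δ ⊆ U := fun t =>
    (Metric.closedBall_subset_cthickening (Set.mem_range_self t) δ).trans hsub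
  obtain ⟨M, hM⟩ := (hK.cthickening (r := δ)).exists_bound_of_continuousOn (hh.continuousOn.mono hsub)
  have hderiv : ∀ n, ContinuousOn (iteratedDeriv n h) U := fun n =>
    ((hh.analyticOnNhd hU).iterated_deriv n |>.continuousOn).congr fun x _ => by
      rw [iteratedDeriv_eq_iterate]
  let c : ℕ → C(K, ℂ) := fun n => ((n.factorial : ℂ)⁻¹) • superpose (iteratedDeriv n h) a
  have hc : ∀ n t, c n t = (n.factorial : ℂ)⁻¹ * iteratedDeriv n h (a t) := fun n t => by
    simp [c, superpose_apply (hderiv n) ha]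
  -- Cauchy's estimate on circles of radius δ, uniformly over the range of a.
  have hcb : ∀ n, ‖c n‖ * δ ^ n ≤ |M| := by
    intro n
    rw [← le_div_iff₀ (by positivity), ContinuousMap.norm_le _ (by positivity)]
    intro t
    rw [hc, norm_mul, norm_inv, Complex.norm_natCast]
    have h1 := Complex.norm_iteratedDeriv_le_of_forall_mem_sphere_norm_le (c := a t) (C := |M|) n hδ
      ((hh.mono ((closure_mono Metric.ball_subset_closedBall).trans
        (by rw [Metric.isClosed_closedBall.closure_eq]; exact hball t))).diffContOnCl)
      (fun z hz => (hM z (Metric.closedBall_subset_cthickening (Set.mem_range_self t) δ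
        (Metric.sphere_subset_closedBall hz))).trans (le_abs_self M))
    rw [inv_mul_le_iff₀ (by positivity), ← mul_div_assoc]
    exact h1
  let p : FormalMultilinearSeries ℂ C(K, ℂ) C(K, ℂ) := fun n =>
    c n • ContinuousMultilinearMap.mkPiAlgebraFin ℂ n C(K, ℂ)
  have hp : ∀ n v, p n (fun _ => v) = c n * v ^ n := fun n v => by
    simp [p]
  refine ⟨p, ⟨ENNReal.ofReal δ, ?_, by simpa using hδ, ?_⟩, fun v => ?_⟩
  -- As `K` may be empty, ‖1‖ = 1 cannot be assumed; `max 1 ‖1‖` bounds the product map in every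
  -- degree, including degree 0.
  · refine p.le_radius_of_bound (r := δ.toNNReal) (|M| * max 1 ‖(1 : C(K, ℂ))‖) fun n => ?_
    rw [Real.coe_toNNReal _ hδ.le]
    have hpn : ‖p n‖ ≤ ‖c n‖ * max 1 ‖(1 : C(K, ℂ))‖ := by
      refine ContinuousMultilinearMap.opNorm_le_bound (by positivity) fun m => ?_
      have h1 : p n m = c n * ContinuousMultilinearMap.mkPiAlgebraFin ℂ n C(K, ℂ) m := by simp [p]
      rw [h1, mul_assoc]
      refine (norm_mul_le _ _).trans (mul_le_mul_of_nonneg_left ?_ (norm_nonneg _))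
      exact (ContinuousMultilinearMap.le_opNorm _ _).trans (mul_le_mul_of_nonneg_right
        ContinuousMultilinearMap.norm_mkPiAlgebraFin_le (by positivity))
    calc ‖p n‖ * δ ^ n ≤ ‖c n‖ * max 1 ‖(1 : C(K, ℂ))‖ * δ ^ n := by gcongr
      _ = (‖c n‖ * δ ^ n) * max 1 ‖(1 : C(K, ℂ))‖ := by ring
      _ ≤ |M| * max 1 ‖(1 : C(K, ℂ))‖ := by gcongr; exact hcb n
  · intro y hy
    have hy' : ‖y‖ < δ := by simpa using hy
    have hyt : ∀ t, ‖y t‖ < δ := fun t => (y.norm_coe_le_norm t).trans_lt hy'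
    have hmem : ∀ t, (a + y) t ∈ Metric.ball (a t) δ := fun t => by simpa using hyt t
    simp only [hp]
    have hs : Summable fun n => c n * y ^ n := by
      have hq : ‖y‖ / δ < 1 := (div_lt_one hδ).mpr hy'
      refine Summable.of_norm_bounded (g := fun n => |M| * max 1 ‖(1 : C(K, ℂ))‖ * (‖y‖ / δ) ^ n)
        ((summable_geometric_of_lt_one (by positivity) hq).mul_left _) fun n => ?_
      calc ‖c n * y ^ n‖ ≤ ‖c n‖ * (max 1 ‖(1 : C(K, ℂ))‖ * ‖y‖ ^ n) := by
            refine (norm_mul_le _ _).trans ?_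
            gcongr
            rcases n.eq_zero_or_pos with rfl | hn
            · simp
            · exact (norm_pow_le' y hn).trans
                (le_mul_of_one_le_left (by positivity) (le_max_left _ _))
        _ = (‖c n‖ * δ ^ n) * max 1 ‖(1 : C(K, ℂ))‖ * (‖y‖ / δ) ^ n := by
            rw [div_pow]; field_simp
        _ ≤ _ := by gcongr; exact hcb n
    have he : superpose h (a + y) = ∑' n, c n * y ^ n := by
      ext t
      rw [superpose_apply hh.continuousOn (fun t => hball t (Metric.ball_subset_closedBall (hmem t))),
        ← ContinuousMap.tsum_apply hs]
      have := (Complex.hasSum_taylorSeries_on_ball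
        (hh.mono (Metric.ball_subset_closedBall.trans (hball t))) (hmem t)).tsum_eq
      rw [← this]
      refine tsum_congr fun n => ?_
      simp [hc]
      ring
    rw [he]
    exact hs.hasSum
  · rw [hp, pow_one]
    congr 1
    ext t
    have := hderiv 1
    rw [iteratedDeriv_one] at this
    rw [hc, superpose_apply this ha, iteratedDeriv_one]
    simp

/-! ### Integrals over the segments from z̄ to z -/

/-- The curve `z ↦ (t ↦ (1 - t) z̄ + t z)` of segments. -/
noncomputable def segMap : ℂ →L[ℝ] C(unitInterval, ℂ) :=
  ((ContinuousLinearMap.toSpanSingleton ℂ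
      (⟨fun t => 1 - (t : ℝ), by fun_prop⟩ : C(unitInterval, ℂ))).restrictScalars ℝ).comp
        (Complex.conjCLE : ℂ →L[ℝ] ℂ)
    + (ContinuousLinearMap.toSpanSingleton ℂ
      (⟨fun t => (t : ℝ), by fun_prop⟩ : C(unitInterval, ℂ))).restrictScalars ℝ

theorem segMap_apply (z : ℂ) (t : unitInterval) :
    segMap z t = (1 - (t : ℝ)) * conj z + (t : ℝ) * z := by
  simp [segMap, mul_comm]

/-- Integration over `[0, 1]` against a continuous weight. -/
noncomputable def integralCLM (ρ : C(unitInterval, ℂ)) : C(unitInterval, ℂ) →L[ℂ] ℂ :=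
  LinearMap.mkContinuous
    { toFun := fun φ => ∫ t, ρ t * φ t
      map_add' := fun φ ψ => by
        simp only [ContinuousMap.add_apply, mul_add]
        exact MeasureTheory.integral_add
          ((ρ * φ).continuous.integrable_of_hasCompactSupport (HasCompactSupport.of_compactSpace _))
          ((ρ * ψ).continuous.integrable_of_hasCompactSupport (HasCompactSupport.of_compactSpace _))
      map_smul' := fun c φ => by
        simp only [ContinuousMap.smul_apply, smul_eq_mul, RingHom.id_apply,
          ← MeasureTheory.integral_const_mul]
        congr 1; funext t; ring } ‖ρ‖ (fun φ => by
      have h := MeasureTheory.norm_integral_le_of_norm_le_const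
        (μ := (MeasureTheory.volume : MeasureTheory.Measure unitInterval)) (C := ‖ρ‖ * ‖φ‖)
        (f := fun t => ρ t * φ t) (Eventually.of_forall fun t => by
          rw [norm_mul]
          gcongr
          · exact ρ.norm_coe_le_norm t
          · exact φ.norm_coe_le_norm t)
      simpa using h)

theorem integralCLM_apply (ρ φ : C(unitInterval, ℂ)) : integralCLM ρ φ = ∫ t, ρ t * φ t := rfl

/-- `∫₀¹ ρ(t) h((1 - t) z̄ + t z) dt`. -/
noncomputable def segIntegral (ρ : C(unitInterval, ℂ)) (h : ℂ → ℂ) (z : ℂ) : ℂ :=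
  integralCLM ρ (superpose h (segMap z))

/-- The open set `U` contains the segments from `z̄` to `z`, for `z ∈ U`. -/
def VertConvex (U : Set ℂ) : Prop := ∀ z ∈ U, ∀ t : unitInterval, segMap z t ∈ U

/-- The weights `t` and `1 - t`. -/
noncomputable def unitCoe : C(unitInterval, ℂ) := ⟨fun t => (t : ℝ), by fun_prop⟩

/-- The integral is a continuous linear functional composed with the analytic superposition operator
and the real-linear `segMap`. Since (1-t) z̄ + t z has z-derivative t and z̄-derivative 1-t, these
weights appear in the derivatives. -/
theorem segIntegral_main (ρ : C(unitInterval, ℂ)) {h : ℂ → ℂ} {U : Set ℂ} (hU : IsOpen U)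
    (hV : VertConvex U) (hh : DifferentiableOn ℂ h U) {z : ℂ} (hz : z ∈ U) :
    AnalyticAt ℝ (segIntegral ρ h) z ∧ HasFDerivAt (segIntegral ρ h)
      (wd (segIntegral (unitCoe * ρ) (deriv h) z) (segIntegral ((1 - unitCoe) * ρ) (deriv h) z))
      z := by
  obtain ⟨p, hp, hp1⟩ := exists_powerSeries_superpose hU hh (segMap z) (hV z hz)
  constructor
  · exact ((integralCLM ρ).restrictScalars ℝ).analyticAt _ |>.comp
      (AnalyticAt.comp (hp.analyticAt.restrictScalars (𝕜 := ℝ)) (segMap.analyticAt z))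
  · have h1 := hp.hasFDerivAt.restrictScalars ℝ
    refine (((integralCLM ρ).restrictScalars ℝ).hasFDerivAt.comp z
      (h1.comp z segMap.hasFDerivAt)).congr_fderiv ?_
    ext v
    simp only [ContinuousLinearMap.comp_apply, ContinuousLinearMap.coe_restrictScalars',
      wd_apply, segIntegral]
    have e : continuousMultilinearCurryFin1 ℂ C(unitInterval, ℂ) C(unitInterval, ℂ) (p 1) (segMap v)
      = superpose (deriv h) (segMap z) * segMap v := (by
        rw [← hp1, continuousMultilinearCurryFin1_apply]
        exact congrArg (p 1) (funext fun i => by fin_cases i; rfl))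
    rw [e]
    generalize superpose (deriv h) (segMap z) = φ
    have e2 : ∀ c, integralCLM (unitCoe * ρ) φ * v + integralCLM ((1 - unitCoe) * ρ) φ * c
      = integralCLM ρ (φ * (v • unitCoe + c • (1 - unitCoe))) := by
      intro c
      have e3 : ∀ η : C(unitInterval, ℂ), integralCLM (η * ρ) φ = integralCLM ρ (φ * η) := by
        intro η
        rw [integralCLM_apply, integralCLM_apply]
        congr 1; funext t; simp; ring
      rw [e3, e3, mul_add, map_add, mul_smul_comm, mul_smul_comm, map_smul, map_smul]
      simp [mul_comm]
    rw [e2]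
    congr 2
    ext t
    simp [segMap_apply, unitCoe]
    ring

theorem VertConvex.conj_mem {U : Set ℂ} (hV : VertConvex U) {z : ℂ} (hz : z ∈ U) : conj z ∈ U := by
  have := hV z hz 0
  rwa [segMap_apply, show ((0 : unitInterval) : ℝ) = 0 from rfl, Complex.ofReal_zero, sub_zero,
    one_mul, zero_mul, add_zero] at this

theorem integral_unitInterval (f : ℝ → ℂ) :
    ∫ t : unitInterval, f t = ∫ t in (0 : ℝ)..1, f t := by
  rw [intervalIntegral.integral_of_le zero_le_one, ← MeasureTheory.integral_Icc_eq_integral_Ioc]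
  exact MeasureTheory.integral_subtype_comap measurableSet_Icc f

theorem continuous_ofReal_cpow {c : ℂ} (hc : 0 < c.re) : Continuous (fun t : ℝ => (t : ℂ) ^ c) :=
  continuous_iff_continuousAt.mpr fun t => Complex.continuousAt_ofReal_cpow_const t c (Or.inl hc)

theorem continuous_one_sub_cpow {c : ℂ} (hc : 0 < c.re) :
    Continuous (fun t : ℝ => (1 - (t : ℂ)) ^ c) := by
  have := (continuous_ofReal_cpow hc).comp (continuous_const.sub continuous_id : Continuous fun t : ℝ => 1 - t)
  simpa [Function.comp_def] using this

/-- The beta weight `t^(a-1) (1-t)^(b-1)`. -/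
noncomputable def betaWeight (a b : ℂ) (ha : 1 < a.re) (hb : 1 < b.re) : C(unitInterval, ℂ) :=
  ⟨fun t => ((t : ℝ) : ℂ) ^ (a - 1) * (1 - ((t : ℝ) : ℂ)) ^ (b - 1),
    ((continuous_ofReal_cpow (by simpa using ha)).comp continuous_subtype_val).mul
      ((continuous_one_sub_cpow (by simpa using hb)).comp continuous_subtype_val)⟩

/-- For H = h' along the segment, the right-hand side is the integrand obtained by applying the
Euler-Poisson-Darboux operator under the integral sign. -/
theorem hasDerivAt_beta_mul {a b : ℂ} {H : ℝ → ℂ} {H' : ℂ} {t : ℝ} (ht : t ∈ Set.Ioo (0 : ℝ) 1)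
    (hH : HasDerivAt H H' t) :
    HasDerivAt (fun t : ℝ => (t : ℂ) ^ a * (1 - (t : ℂ)) ^ b * H t)
      ((t : ℂ) ^ (a - 1) * (1 - (t : ℂ)) ^ (b - 1)
        * ((a * (1 - t) - b * t) * H t + (1 - t) * t * H')) t := by
  have h0 : (t : ℂ) ≠ 0 := by exact_mod_cast ht.1.ne'
  have h1 : (1 - (t : ℂ)) ≠ 0 := by
    rw [sub_ne_zero]; exact_mod_cast ht.2.ne'
  have d0 : HasDerivAt (fun t : ℝ => (t : ℂ) ^ a) (a * (t : ℂ) ^ (a - 1)) t := by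
    have := (hasDerivAt_id (t : ℂ)).cpow_const (c := a) (Or.inl (by simpa using ht.1))
    simpa using this.comp_ofReal
  have d1 : HasDerivAt (fun t : ℝ => (1 - (t : ℂ)) ^ b) (-(b * (1 - (t : ℂ)) ^ (b - 1))) t := by
    have := ((hasDerivAt_id (t : ℂ)).const_sub 1).cpow_const (c := b)
      (Or.inl (by simpa using ht.2))
    simpa using this.comp_ofReal
  refine ((d0.mul d1).mul hH).congr_deriv ?_
  have e0 : (t : ℂ) ^ a = (t : ℂ) ^ (a - 1) * t := by
    rw [Complex.cpow_sub _ _ h0, Complex.cpow_one]; field_simp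
  have e1 : (1 - (t : ℂ)) ^ b = (1 - (t : ℂ)) ^ (b - 1) * (1 - t) := by
    rw [Complex.cpow_sub _ _ h1, Complex.cpow_one]; field_simp
  simp only [Pi.mul_apply]
  rw [e0, e1]
  ring

theorem hasDerivAt_segment (z : ℂ) (t : ℝ) :
    HasDerivAt (fun t : ℝ => (1 - (t : ℂ)) * conj z + t * z) (z - conj z) t := by
  have h : HasDerivAt (fun t : ℝ => (t : ℂ)) 1 t := Complex.ofRealCLM.hasDerivAt
  exact ((h.const_sub 1).mul_const (conj z) |>.add (h.mul_const z)).congr_deriv (by ring)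

/-- Under the integral sign the operator produces d/dt of t^a (1-t)^b h'((1-t) z̄ + t z), which
vanishes at both ends. Real parts greater than 1, rather than positive, make the weight continuous
on [0, 1]. -/
theorem epd_segIntegral {a b : ℂ} (ha : 1 < a.re) (hb : 1 < b.re) {h : ℂ → ℂ} {U : Set ℂ}
    (hU : IsOpen U) (hV : VertConvex U) (hh : DifferentiableOn ℂ h U) {z : ℂ} (hz : z ∈ U) :
    epd a b (segIntegral (betaWeight a b ha hb) h) z = 0 := by
  set ρ := betaWeight a b ha hb with hρ
  have h' : DifferentiableOn ℂ (deriv h) U := hh.deriv hU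
  have h'' : DifferentiableOn ℂ (deriv (deriv h)) U := h'.deriv hU
  have e1 := segIntegral_main ρ hU hV hh hz
  have e2 := segIntegral_main (unitCoe * ρ) hU hV h' hz
  have hdz : dz (segIntegral ρ h) =ᶠ[𝓝 z] segIntegral (unitCoe * ρ) (deriv h) := by
    filter_upwards [hU.mem_nhds hz] with w hw
    exact dz_eq (segIntegral_main ρ hU hV hh hw).2
  rw [epd, dw_congr hdz, dw_eq e2.2, dz_eq e1.2, dw_eq e1.2]
  have hseg : ∀ t : unitInterval, segMap z t ∈ U := hV z hz
  rw [← smul_eq_mul (z - conj z), ← smul_eq_mul b, ← smul_eq_mul a, segIntegral, segIntegral,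
    segIntegral, ← map_smul, ← map_smul, ← map_smul, integralCLM_apply, integralCLM_apply,
    integralCLM_apply]
  have hint : ∀ (η φ : C(unitInterval, ℂ)), MeasureTheory.Integrable (fun t => η t * φ t) :=
    fun η φ => (η * φ).continuous.integrable_of_hasCompactSupport (HasCompactSupport.of_compactSpace _)
  rw [← MeasureTheory.integral_sub (hint _ _) (hint _ _)]
  refine (MeasureTheory.integral_add ((hint _ _).sub (hint _ _)) (hint _ _)).symm.trans ?_
  let ζ : ℝ → ℂ := fun t => (1 - (t : ℂ)) * conj z + t * z
  have hζ : ∀ t ∈ Set.Icc (0 : ℝ) 1, ζ t ∈ U := fun t ht => by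
    have := hseg ⟨t, ht⟩
    rwa [segMap_apply] at this
  let D : ℝ → ℂ := fun t => (t : ℂ) ^ (a - 1) * (1 - (t : ℂ)) ^ (b - 1)
        * ((a * (1 - t) - b * t) * deriv h (ζ t)
          + (1 - t) * t * (deriv (deriv h) (ζ t) * (z - conj z)))
  have hζc : Continuous ζ := by fun_prop
  have hcd : ContinuousOn (fun t => deriv h (ζ t)) (Set.Icc 0 1) :=
    h'.continuousOn.comp hζc.continuousOn hζ
  have hcd2 : ContinuousOn (fun t => deriv (deriv h) (ζ t)) (Set.Icc 0 1) :=
    h''.continuousOn.comp hζc.continuousOn hζ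
  have c0 : ∀ c : ℂ, 0 < c.re → ContinuousOn (fun t : ℝ => (t : ℂ) ^ c) (Set.Icc 0 1) :=
    fun c hc => (continuous_ofReal_cpow hc).continuousOn
  have c1 : ∀ c : ℂ, 0 < c.re → ContinuousOn (fun t : ℝ => (1 - (t : ℂ)) ^ c) (Set.Icc 0 1) :=
    fun c hc => (continuous_one_sub_cpow hc).continuousOn
  have ha0 : a ≠ 0 := by rintro rfl; simp at ha; linarith
  have hb0 : b ≠ 0 := by rintro rfl; simp at hb; linarith
  have hD : ∫ t in (0 : ℝ)..1, D t = 0 := by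
    rw [intervalIntegral.integral_eq_sub_of_hasDerivAt_of_le zero_le_one
      (f := fun t : ℝ => (t : ℂ) ^ a * (1 - (t : ℂ)) ^ b * deriv h (ζ t))]
    · simp [ha0, hb0]
    · exact ((c0 a (by linarith)).mul (c1 b (by linarith))).mul hcd
    · intro t ht
      have hd := (h'.differentiableAt (hU.mem_nhds (hζ t (Set.Ioo_subset_Icc_self ht)))).hasDerivAt
      exact hasDerivAt_beta_mul ht (hd.comp t (hasDerivAt_segment z t))
    · refine ContinuousOn.intervalIntegrable ?_
      rw [Set.uIcc_of_le zero_le_one]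
      refine ((c0 (a - 1) (by simpa using ha)).mul (c1 (b - 1) (by simpa using hb))).mul ?_
      refine ((Continuous.continuousOn (by fun_prop)).mul hcd).add
        ((Continuous.continuousOn (by fun_prop)).mul (hcd2.mul continuousOn_const))
  rw [← hD, ← integral_unitInterval]
  congr 1
  funext t
  simp only [ContinuousMap.smul_apply, smul_eq_mul, superpose_apply h'.continuousOn hseg,
    superpose_apply h''.continuousOn hseg, D, hρ, betaWeight, ContinuousMap.mul_apply,
    ContinuousMap.sub_apply, ContinuousMap.one_apply, unitCoe, ContinuousMap.coe_mk, segMap_apply, ζ,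
    Pi.sub_apply]
  ring

theorem segIntegral_real (ρ : C(unitInterval, ℂ)) {h : ℂ → ℂ} {U : Set ℂ} (hh : ContinuousOn h U)
    {x : ℝ} (hx : (x : ℂ) ∈ U) : segIntegral ρ h x = (∫ t, ρ t) * h x := by
  have h1 : ∀ t, segMap (x : ℂ) t = x := fun t => by
    rw [segMap_apply, Complex.conj_ofReal]; ring
  rw [segIntegral, integralCLM_apply, ← MeasureTheory.integral_mul_const]
  congr 1; funext t
  rw [superpose_apply hh (fun t => by rw [h1]; exact hx), h1]

/-- From B(a,b) Γ(a+b) = Γ(a) Γ(b) and the absence of zeros of Γ in the right half-plane. -/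
theorem integral_betaWeight_ne_zero {a b : ℂ} (ha : 1 < a.re) (hb : 1 < b.re) :
    ∫ t, betaWeight a b ha hb t ≠ 0 := by
  have h1 : ∫ t, betaWeight a b ha hb t = Complex.betaIntegral a b :=
    integral_unitInterval fun t : ℝ => (t : ℂ) ^ (a - 1) * (1 - (t : ℂ)) ^ (b - 1)
  rw [h1]
  have h2 := Complex.Gamma_mul_Gamma_eq_betaIntegral (s := a) (t := b) (by linarith) (by linarith)
  intro h
  rw [h, mul_zero] at h2
  exact mul_ne_zero (Complex.Gamma_ne_zero_of_re_pos (by linarith))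
    (Complex.Gamma_ne_zero_of_re_pos (by linarith)) h2

/-! ### Contiguity relations and existence for general parameters -/

/-- `A` is a real-analytic solution of the Euler-Poisson-Darboux equation on `U` whose restriction
to the real axis is `h`. -/
structure IsEpdSol (a b : ℂ) (U : Set ℂ) (h A : ℂ → ℂ) : Prop where
  analytic : ∀ z ∈ U, AnalyticAt ℝ A z
  eqn : ∀ z ∈ U, epd a b A z = 0
  real : ∀ x : ℝ, (x : ℂ) ∈ U → A x = h x

theorem _root_.AnalyticAt.contDiffAt_two {u : ℂ → ℂ} {z : ℂ} (h : AnalyticAt ℝ u z) :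
    ContDiffAt ℝ 2 u z := h.contDiffAt

theorem analyticAt_conj (z : ℂ) : AnalyticAt ℝ (fun w : ℂ => conj w) z :=
  (Complex.conjCLE : ℂ →L[ℝ] ℂ).analyticAt z

/-- The correction term vanishes on ℝ, so the boundary value is kept. By the equation for B, the
z-derivative of the new function collapses to a/(a+b) (B_z + B_z̄), and its equation becomes a
multiple of that of B. -/
theorem IsEpdSol.lower_left {a b : ℂ} {U : Set ℂ} (hU : IsOpen U) {h B : ℂ → ℂ} (hab : a + b ≠ 0)
    (hB : IsEpdSol (a + 1) b U h B) :
    IsEpdSol a b U h (fun z => B z - (a + b)⁻¹ * ((z - conj z) * dw B z)) := by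
  have an : ∀ z ∈ U, AnalyticAt ℝ (fun z => B z - (a + b)⁻¹ * ((z - conj z) * dw B z)) z :=
    fun z hz => (hB.analytic z hz).sub (analyticAt_const.mul
      (((analyticAt_id.sub (analyticAt_conj z)).mul (hB.analytic z hz).dw)))
  have first : ∀ z ∈ U, HasFDerivAt (fun z => B z - (a + b)⁻¹ * ((z - conj z) * dw B z)) _ z :=
    fun z hz => wd_sub (hB.analytic z hz).differentiableAt.hasFDerivAt_wd
      (wd_const_mul _ (wd_mul (wd_sub wd_id wd_conj)
        (hB.analytic z hz).dw.differentiableAt.hasFDerivAt_wd))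
  refine ⟨an, fun z hz => ?_, fun x hx => by simp [hB.real x hx]⟩
  have hdz : dz (fun z => B z - (a + b)⁻¹ * ((z - conj z) * dw B z)) =ᶠ[𝓝 z]
      fun w => (a / (a + b)) * (dz B w + dw B w) := by
    filter_upwards [hU.mem_nhds hz] with w hw
    rw [dz_eq (first w hw), dz_dw_comm (hB.analytic w hw).contDiffAt_two]
    have := hB.eqn w hw
    rw [epd] at this
    field_simp
    linear_combination -this
  have h2 := wd_const_mul (a / (a + b)) (wd_add
    (hB.analytic z hz).dz.differentiableAt.hasFDerivAt_wd
    (hB.analytic z hz).dw.differentiableAt.hasFDerivAt_wd)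
  rw [epd, dw_congr hdz, hdz.eq_of_nhds, dw_eq h2, dw_eq (first z hz)]
  have := hB.eqn z hz
  rw [epd] at this
  field_simp
  linear_combination a * this

/-- The mirror image of `IsEpdSol.lower_left`: now the z̄-derivative collapses, to b/(a+b) (B_z +
B_z̄). -/
theorem IsEpdSol.lower_right {a b : ℂ} {U : Set ℂ} (hU : IsOpen U) {h B : ℂ → ℂ} (hab : a + b ≠ 0)
    (hB : IsEpdSol a (b + 1) U h B) :
    IsEpdSol a b U h (fun z => B z + (a + b)⁻¹ * ((z - conj z) * dz B z)) := by
  have an : ∀ z ∈ U, AnalyticAt ℝ (fun z => B z + (a + b)⁻¹ * ((z - conj z) * dz B z)) z :=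
    fun z hz => (hB.analytic z hz).add (analyticAt_const.mul
      (((analyticAt_id.sub (analyticAt_conj z)).mul (hB.analytic z hz).dz)))
  have first : ∀ z ∈ U, HasFDerivAt (fun z => B z + (a + b)⁻¹ * ((z - conj z) * dz B z)) _ z :=
    fun z hz => wd_add (hB.analytic z hz).differentiableAt.hasFDerivAt_wd
      (wd_const_mul _ (wd_mul (wd_sub wd_id wd_conj)
        (hB.analytic z hz).dz.differentiableAt.hasFDerivAt_wd))
  refine ⟨an, fun z hz => ?_, fun x hx => by simp [hB.real x hx]⟩
  have hdw : dw (fun z => B z + (a + b)⁻¹ * ((z - conj z) * dz B z)) =ᶠ[𝓝 z]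
      fun w => (b / (a + b)) * (dz B w + dw B w) := by
    filter_upwards [hU.mem_nhds hz] with w hw
    rw [dw_eq (first w hw)]
    have := hB.eqn w hw
    rw [epd] at this
    field_simp
    linear_combination this
  have h2 := wd_const_mul (b / (a + b)) (wd_add
    (hB.analytic z hz).dz.differentiableAt.hasFDerivAt_wd
    (hB.analytic z hz).dw.differentiableAt.hasFDerivAt_wd)
  -- The order of differentiation is exchanged because the z̄-derivative is the one with the simple
  -- form.
  rw [epd, ← dz_dw_comm (an z hz).contDiffAt_two, dz_congr hdw, hdw.eq_of_nhds, dz_eq h2,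
    dz_eq (first z hz), dz_dw_comm (hB.analytic z hz).contDiffAt_two]
  have := hB.eqn z hz
  rw [epd] at this
  field_simp
  linear_combination b * this

theorem exists_isEpdSol_of_re {a b : ℂ} (ha : 1 < a.re) (hb : 1 < b.re) {U : Set ℂ} (hU : IsOpen U)
    (hV : VertConvex U) {h : ℂ → ℂ} (hh : DifferentiableOn ℂ h U) : ∃ A, IsEpdSol a b U h A := by
  set ρ := betaWeight a b ha hb
  have hc : DifferentiableOn ℂ (fun z => (∫ t, ρ t)⁻¹ * h z) U := hh.const_mul _
  refine ⟨segIntegral ρ (fun z => (∫ t, ρ t)⁻¹ * h z), fun z hz => (segIntegral_main ρ hU hV hc hz).1,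
    fun z hz => epd_segIntegral ha hb hU hV hc hz, fun x hx => ?_⟩
  rw [segIntegral_real ρ hc.continuousOn hx, mul_inv_cancel_left₀ (integral_betaWeight_ne_zero ha hb)]

/-- Both parameters are raised by N into the range of the integral formula and then lowered in turn.
A step from (a+1, b+1) through (a+1, b) to (a, b) divides by a+b+1 and by a+b; the hypothesis
excludes exactly such zeros. -/
theorem exists_isEpdSol {U : Set ℂ} (hU : IsOpen U) (hV : VertConvex U) {h : ℂ → ℂ}
    (hh : DifferentiableOn ℂ h U) {a b : ℂ} (hab : ∀ n : ℕ, a + b ≠ -(n : ℂ)) :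
    ∃ A, IsEpdSol a b U h A := by
  have key : ∀ (N : ℕ) (a b : ℂ), (∀ n : ℕ, a + b ≠ -(n : ℂ)) → 1 < (a + N).re → 1 < (b + N).re →
      ∃ A, IsEpdSol a b U h A := by
    intro N
    induction N with
    | zero =>
      intro a b _ ha hb
      exact exists_isEpdSol_of_re (by simpa using ha) (by simpa using hb) hU hV hh
    | succ N ih =>
      intro a b hab ha hb
      obtain ⟨A, hA⟩ := ih (a + 1) (b + 1)
        (fun n hn => hab (n + 2) (by push_cast; linear_combination hn))
        (by push_cast at ha; simpa [add_assoc, add_comm (1 : ℝ)] using ha)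
        (by push_cast at hb; simpa [add_assoc, add_comm (1 : ℝ)] using hb)
      have h1 := hA.lower_right hU (b := b) (fun hn => hab 1 (by push_cast; linear_combination hn))
      exact ⟨_, h1.lower_left hU (by simpa using hab 0)⟩
  obtain ⟨N, hN⟩ := exists_nat_gt (max (1 - a.re) (1 - b.re))
  have := max_lt_iff.mp hN
  exact key N a b hab (by simp; linarith) (by simp; linarith)

end Superposition

/-! ### Uniqueness of solutions with given diagonal values -/

section Uniqueness

/-- The directional derivative `∂_v u`. -/
noncomputable def pd (v : ℂ) (u : ℂ → ℂ) : ℂ → ℂ := fun z => fderiv ℝ u z v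

variable {D : Set ℂ} {u u' : ℂ → ℂ}

theorem pd_congr (hD : IsOpen D) (h : Set.EqOn u u' D) (v : ℂ) :
    Set.EqOn (pd v u) (pd v u') D := fun z hz => by
  rw [pd, pd, (h.eventuallyEq_of_mem (hD.mem_nhds hz)).fderiv_eq]

theorem analyticOnNhd_pd (h : AnalyticOnNhd ℝ u D) (v : ℂ) : AnalyticOnNhd ℝ (pd v u) D :=
  fun z hz => (h z hz).fderiv_apply_const v

theorem analyticOnNhd_pd_iter (h : AnalyticOnNhd ℝ u D) (v : ℂ) (n : ℕ) :
    AnalyticOnNhd ℝ ((pd v)^[n] u) D := by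
  induction n with
  | zero => exact h
  | succ n ih => rw [Function.iterate_succ_apply']; exact analyticOnNhd_pd ih v

theorem pd_comm (h : AnalyticOnNhd ℝ u D) (v w : ℂ) :
    Set.EqOn (pd v (pd w u)) (pd w (pd v u)) D := fun z hz => by
  have hc := (h z hz).contDiffAt_two
  exact (fderiv_fderiv_apply hc w v).trans
    ((fderiv_fderiv_symm hc v w).trans (fderiv_fderiv_apply hc v w).symm)

theorem pd_iter_comm (hD : IsOpen D) (h : AnalyticOnNhd ℝ u D) (v w : ℂ) (n : ℕ) :
    Set.EqOn ((pd v)^[n] (pd w u)) (pd w ((pd v)^[n] u)) D := by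
  induction n with
  | zero => exact fun _ _ => rfl
  | succ n ih =>
    rw [Function.iterate_succ_apply', Function.iterate_succ_apply']
    exact (pd_congr hD ih v).trans (pd_comm (analyticOnNhd_pd_iter h v n) v w)

theorem pd_iter_linear (hD : IsOpen D) (h : AnalyticOnNhd ℝ u D) (h' : AnalyticOnNhd ℝ u' D)
    (v c c' : ℂ) (n : ℕ) : Set.EqOn ((pd v)^[n] fun z => c * u z + c' * u' z)
      (fun z => c * (pd v)^[n] u z + c' * (pd v)^[n] u' z) D := by
  induction n with
  | zero => exact fun _ _ => rfl
  | succ n ih =>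
    simp only [Function.iterate_succ_apply']
    refine (pd_congr hD ih v).trans fun z hz => ?_
    have h1 := (analyticOnNhd_pd_iter h v n z hz).differentiableAt.hasFDerivAt.const_mul c
    have h2 := (analyticOnNhd_pd_iter h' v n z hz).differentiableAt.hasFDerivAt.const_mul c'
    simp only [pd]
    have h3 := (h1.add h2).fderiv
    simp only [Pi.add_def] at h3
    rw [h3]
    simp

theorem pd_one_real (hD : IsOpen D) (h : AnalyticOnNhd ℝ u D)
    (h0 : ∀ x : ℝ, (x : ℂ) ∈ D → u x = 0) (x : ℝ) (hx : (x : ℂ) ∈ D) : pd 1 u x = 0 := by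
  have h1 : HasDerivAt (fun t : ℝ => u t) (fderiv ℝ u x 1) x := by
    have hc : HasDerivAt (fun t : ℝ => (t : ℂ)) 1 x := Complex.ofRealCLM.hasDerivAt
    exact (h x hx).differentiableAt.hasFDerivAt.comp_hasDerivAt x hc
  have h2 : (fun t : ℝ => u t) =ᶠ[𝓝 x] fun _ => 0 := by
    filter_upwards [(hD.preimage Complex.continuous_ofReal).mem_nhds hx] with t ht using h0 t ht
  exact h1.unique ((hasDerivAt_const x (0 : ℂ)).congr_of_eventuallyEq h2)

/-- In real coordinates the operator is, up to a constant, y (∂_x² + ∂_y²) + (a+b) ∂_y - i(a-b) ∂_x,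
which makes the singularity at y = 0 visible. -/
theorem epd_eq_pd {A : ℂ → ℂ} {a b z : ℂ} (hA : AnalyticAt ℝ A z) :
    2 * I * epd a b A z = -((z.im : ℂ) * (pd 1 (pd 1 A) z + pd I (pd I A) z)
      + ((a + b) * pd I A z + -I * (a - b) * pd 1 A z)) := by
  have hc := hA.contDiffAt_two
  have h1 := laplacian_eq_dw_dz hc
  rw [InnerProductSpace.laplacian_eq_iteratedFDeriv_complexPlane] at h1
  simp only [iteratedFDeriv_two_apply, Matrix.cons_val_zero, Matrix.cons_val_one] at h1
  have h2 := Complex.sub_conj z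
  push_cast at h2
  rw [epd, h2]
  have e1 : pd 1 (pd 1 A) z = _ := fderiv_fderiv_apply hc 1 1
  have e2 : pd I (pd I A) z = _ := fderiv_fderiv_apply hc I I
  rw [e1, e2, h1]
  generalize dw (dz A) z = X
  rw [dz, dw, pd, pd]
  linear_combination (4 * (z.im : ℂ) * X + (a + b) * fderiv ℝ A z I) * Complex.I_sq

/-- The normal derivatives of a solution satisfy a recursion on the real axis. -/
theorem epd_normal_recursion (hD : IsOpen D) {A : ℂ → ℂ} (hA : AnalyticOnNhd ℝ A D) {a b : ℂ}
    (heq : ∀ z ∈ D, epd a b A z = 0) (n : ℕ) {z : ℂ} (hz : z ∈ D) :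
    (z.im : ℂ) * (pd I)^[n] (fun w => 1 * pd 1 (pd 1 A) w + 1 * pd I (pd I A) w) z
      + n * (pd I)^[n - 1] (fun w => 1 * pd 1 (pd 1 A) w + 1 * pd I (pd I A) w) z
      + (pd I)^[n] (fun w => (a + b) * pd I A w + -I * (a - b) * pd 1 A w) z = 0 := by
  -- The redundant factors 1 put the Laplacian into the shape of `pd_iter_linear`.
  have hL : AnalyticOnNhd ℝ (fun w => 1 * pd 1 (pd 1 A) w + 1 * pd I (pd I A) w) D := fun w hw =>
    (analyticAt_const.mul (analyticOnNhd_pd (analyticOnNhd_pd hA 1) 1 w hw)).add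
      (analyticAt_const.mul (analyticOnNhd_pd (analyticOnNhd_pd hA I) I w hw))
  have hQ : AnalyticOnNhd ℝ (fun w => (a + b) * pd I A w + -I * (a - b) * pd 1 A w) D := fun w hw =>
    (analyticAt_const.mul (analyticOnNhd_pd hA I w hw)).add
      (analyticAt_const.mul (analyticOnNhd_pd hA 1 w hw))
  generalize hLg : (fun w => 1 * pd 1 (pd 1 A) w + 1 * pd I (pd I A) w) = L at *
  generalize hQg : (fun w => (a + b) * pd I A w + -I * (a - b) * pd 1 A w) = Q at *
  induction n generalizing z with
  | zero =>
    have h1 := epd_eq_pd (a := a) (b := b) (hA z hz)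
    rw [heq z hz] at h1
    have h2 := congrFun hLg z
    have h3 := congrFun hQg z
    simp only [Function.iterate_zero, id, Nat.cast_zero]
    rw [← h2, ← h3]
    linear_combination h1
  | succ n ih =>
    have h0 : (fun w => (w.im : ℂ) * (pd I)^[n] L w + n * (pd I)^[n - 1] L w + (pd I)^[n] Q w)
        =ᶠ[𝓝 z] fun _ => 0 := by
      filter_upwards [hD.mem_nhds hz] with w hw using ih hw
    have him : HasFDerivAt (fun w : ℂ => (w.im : ℂ)) (Complex.ofRealCLM.comp Complex.imCLM) z :=
      (Complex.ofRealCLM.comp Complex.imCLM).hasFDerivAt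
    have d1 := him.mul (analyticOnNhd_pd_iter hL I n z hz).differentiableAt.hasFDerivAt
    have d2 := (analyticOnNhd_pd_iter hL I (n - 1) z hz).differentiableAt.hasFDerivAt.const_mul (n : ℂ)
    have d3 := (analyticOnNhd_pd_iter hQ I n z hz).differentiableAt.hasFDerivAt
    have h1 := ((d1.add d2).add d3).unique ((hasFDerivAt_const (0 : ℂ) z).congr_of_eventuallyEq h0)
    have h2 := congrArg (fun l : ℂ →L[ℝ] ℂ => l I) h1
    -- For n = 0 the truncated n - 1 is harmless, since the term is multiplied by n.
    have hn : (n : ℂ) * fderiv ℝ ((pd I)^[n - 1] L) z I = n * (pd I)^[n] L z := by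
      rcases n.eq_zero_or_pos with rfl | hpos
      · simp
      · obtain ⟨m, rfl⟩ := Nat.exists_eq_succ_of_ne_zero hpos.ne'
        rw [Nat.succ_sub_one, Function.iterate_succ_apply', pd]
    simp only [_root_.add_apply, _root_.smul_apply, smul_eq_mul, ContinuousLinearMap.comp_apply,
      Complex.imCLM_apply, Complex.I_im, Complex.ofRealCLM_apply, Complex.ofReal_one, mul_one,
      _root_.zero_apply] at h2
    rw [hn] at h2
    rw [Nat.add_sub_cancel, Function.iterate_succ_apply', Function.iterate_succ_apply', pd, pd]
    push_cast
    linear_combination h2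

/-- At y = 0 the recursion loses its first term. By induction the x-derivatives of the normal
derivatives of order at most n vanish on the axis, which leaves (a + b + n) ∂_y^{n+1} A = 0. -/
theorem pd_iter_real_eq_zero (hD : IsOpen D) {A : ℂ → ℂ} (hA : AnalyticOnNhd ℝ A D) {a b : ℂ}
    (hab : ∀ n : ℕ, a + b ≠ -(n : ℂ)) (heq : ∀ z ∈ D, epd a b A z = 0)
    (h0 : ∀ x : ℝ, (x : ℂ) ∈ D → A x = 0) (n : ℕ) :
    ∀ x : ℝ, (x : ℂ) ∈ D → (pd I)^[n] A x = 0 := by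
  induction n using Nat.strong_induction_on with
  | _ n ih =>
    rcases n with _ | n
    · exact h0
    intro x hx
    have h1 := epd_normal_recursion hD hA heq n hx
    have hA1 := analyticOnNhd_pd hA 1
    have hA11 := analyticOnNhd_pd hA1 1
    have hAI := analyticOnNhd_pd hA I
    have hAII := analyticOnNhd_pd hAI I
    have hx1 : (pd I)^[n] (pd 1 A) x = 0 := by
      rw [pd_iter_comm hD hA I 1 n hx]
      exact pd_one_real hD (analyticOnNhd_pd_iter hA I n) (ih n n.lt_succ_self) x hx
    have hL : (n : ℂ) * (pd I)^[n - 1] (fun w => 1 * pd 1 (pd 1 A) w + 1 * pd I (pd I A) w) x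
        = n * (pd I)^[n + 1] A x := by
      rcases n with _ | m
      · simp
      · rw [Nat.add_sub_cancel, pd_iter_linear hD hA11 hAII I 1 1 m hx]
        have e1 : (pd I)^[m] (pd 1 (pd 1 A)) x = 0 := by
          rw [pd_iter_comm hD hA1 I 1 m hx]
          refine pd_one_real hD (analyticOnNhd_pd_iter hA1 I m) (fun y hy => ?_) x hx
          rw [pd_iter_comm hD hA I 1 m hy]
          exact pd_one_real hD (analyticOnNhd_pd_iter hA I m) (ih m (by omega)) y hy
        simp only [e1, Function.iterate_succ_apply]
        ring
    rw [pd_iter_linear hD hAI hA1 I _ _ n hx, hL] at h1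
    simp only [hx1, Complex.ofReal_im, ← Function.iterate_succ_apply (pd I) n A] at h1
    have h2 : (a + b + n) * (pd I)^[n + 1] A x = 0 := by
      simp only [Complex.ofReal_zero] at h1
      linear_combination h1
    exact (mul_eq_zero.mp h2).resolve_left fun h => hab n (by linear_combination h)

theorem iteratedDeriv_vertical (hD : IsOpen D) {A : ℂ → ℂ} (hA : AnalyticOnNhd ℝ A D) (x : ℝ) (n : ℕ) :
    ∀ y : ℝ, ((x : ℂ) + y * I) ∈ D →
      iteratedDeriv n (fun y : ℝ => A (x + y * I)) y = (pd I)^[n] A (x + y * I) := by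
  induction n with
  | zero => intro y _; simp
  | succ n ih =>
    intro y hy
    rw [iteratedDeriv_succ, Function.iterate_succ_apply', pd]
    have hc : Continuous fun y : ℝ => (x : ℂ) + y * I := by fun_prop
    have hev : iteratedDeriv n (fun y : ℝ => A (x + y * I)) =ᶠ[𝓝 y]
        fun y : ℝ => (pd I)^[n] A (x + y * I) := by
      filter_upwards [(hD.preimage hc).mem_nhds hy] with y' hy' using ih y' hy'
    rw [hev.deriv_eq]
    have hd : HasDerivAt (fun y : ℝ => (x : ℂ) + y * I) I y := by
      have h : HasDerivAt (fun t : ℝ => (t : ℂ)) 1 y := Complex.ofRealCLM.hasDerivAt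
      exact ((h.mul_const I).const_add (x : ℂ)).congr_deriv (one_mul _)
    exact ((analyticOnNhd_pd_iter hA I n _ hy).differentiableAt.hasFDerivAt.comp_hasDerivAt y hd).deriv

theorem eventually_eq_zero_of_iteratedDeriv {f : ℝ → ℂ} {y : ℝ} (hf : AnalyticAt ℝ f y)
    (h : ∀ n, iteratedDeriv n f y = 0) : f =ᶠ[𝓝 y] 0 := by
  have h1 : analyticOrderAt f y = ⊤ := by
    refine ENat.eq_top_iff_forall_ge.mpr fun n => ?_
    exact (natCast_le_analyticOrderAt_iff_iteratedDeriv_eq_zero hf).mpr fun i _ => h i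
  exact analyticOrderAt_eq_top.mp h1

/-- All normal derivatives vanish near x₀ on the axis, so A vanishes on short vertical segments,
hence near x₀, hence on the whole disc by the identity theorem. -/
theorem eq_zero_of_epd {a b : ℂ} (hab : ∀ n : ℕ, a + b ≠ -(n : ℂ)) {A : ℂ → ℂ} {x₀ r : ℝ}
    (hA : AnalyticOnNhd ℝ A (Metric.ball (x₀ : ℂ) r))
    (heq : ∀ z ∈ Metric.ball (x₀ : ℂ) r, 0 < z.im → epd a b A z = 0)
    (h0 : ∀ᶠ x : ℝ in 𝓝 x₀, A x = 0) : ∀ z ∈ Metric.ball (x₀ : ℂ) r, A z = 0 := by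
  intro z hz
  have hr : 0 < r := Metric.pos_of_mem_ball hz
  have hpre : IsPreconnected (Metric.ball (x₀ : ℂ) r) := (convex_ball _ _).isPreconnected
  -- The equation is given on the upper half-disc only; its left side is analytic on the disc, so it
  -- continues across the axis.
  have heq' : ∀ z ∈ Metric.ball (x₀ : ℂ) r, epd a b A z = 0 := by
    have han : AnalyticOnNhd ℝ (epd a b A) (Metric.ball (x₀ : ℂ) r) := fun w hw => by
      have := hA w hw
      exact ((((analyticAt_id.sub (analyticAt_conj w)).mul this.dz.dw).sub
        (analyticAt_const.mul this.dz)).add (analyticAt_const.mul this.dw))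
    have hw : (x₀ : ℂ) + (r / 2 : ℝ) * I ∈ Metric.ball (x₀ : ℂ) r := by
      simp only [Metric.mem_ball, dist_self_add_left, norm_mul, Complex.norm_I, mul_one,
        Complex.norm_real, Real.norm_eq_abs]
      rw [abs_of_pos (by positivity)]; linarith
    refine han.eqOn_zero_of_preconnected_of_eventuallyEq_zero hpre hw ?_
    have hw' : 0 < ((x₀ : ℂ) + (r / 2 : ℝ) * I).im := by simpa using hr
    filter_upwards [Metric.isOpen_ball.mem_nhds hw,
      (isOpen_lt continuous_const Complex.continuous_im).mem_nhds hw'] with v hv hv'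
    exact heq v hv hv'
  -- The boundary values vanish only near x₀, so the argument along vertical lines is made on a
  -- smaller disc.
  obtain ⟨ε, hε, hε0⟩ := Metric.eventually_nhds_iff_ball.mp h0
  set δ := min ε r
  have hδ : 0 < δ := lt_min hε hr
  set D := Metric.ball (x₀ : ℂ) δ
  have hDo : IsOpen D := Metric.isOpen_ball
  have hDr : D ⊆ Metric.ball (x₀ : ℂ) r := Metric.ball_subset_ball (min_le_right _ _)
  have hAD : AnalyticOnNhd ℝ A D := hA.mono hDr
  have hreal : ∀ x : ℝ, (x : ℂ) ∈ D → A x = 0 := fun x hx => by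
    refine hε0 x ?_
    have h1 : dist (x : ℂ) x₀ < δ := hx
    rw [Complex.dist_of_im_eq (by simp)] at h1
    exact lt_of_lt_of_le h1 (min_le_left ε r)
  refine hA.eqOn_zero_of_preconnected_of_eventuallyEq_zero hpre (Metric.mem_ball_self hr) ?_ hz
  filter_upwards [Metric.ball_mem_nhds _ hδ] with w hw
  have hline : Continuous fun y : ℝ => (w.re : ℂ) + y * I := by fun_prop
  have hw0 : ((w.re : ℝ) : ℂ) ∈ D := by
    rw [Metric.mem_ball, dist_eq_norm] at hw
    rw [Metric.mem_ball, dist_eq_norm]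
    refine lt_of_le_of_lt ?_ hw
    rw [← Complex.ofReal_sub, Complex.norm_real]
    simpa using Complex.abs_re_le_norm (w - x₀)
  have hf : AnalyticOnNhd ℝ (fun y : ℝ => A (w.re + y * I)) {y : ℝ | (w.re : ℂ) + y * I ∈ D} :=
    fun y hy => (hAD _ hy).comp (f := fun y : ℝ => (w.re : ℂ) + y * I)
      (analyticAt_const.add ((Complex.ofRealCLM.analyticAt y).mul analyticAt_const))
  have hconv : Convex ℝ {y : ℝ | (w.re : ℂ) + y * I ∈ D} := by
    intro y hy y' hy' s t hs ht hst
    have := convex_ball (x₀ : ℂ) δ hy hy' hs ht hst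
    have e : s • ((w.re : ℂ) + y * I) + t • ((w.re : ℂ) + y' * I)
        = (w.re : ℂ) + ((s • y + t • y' : ℝ) : ℂ) * I := by
      have : (s : ℂ) + t = 1 := by exact_mod_cast hst
      simp only [Complex.real_smul, smul_eq_mul]
      push_cast
      linear_combination (w.re : ℂ) * this
    rw [e] at this
    exact this
  have h0mem : (0 : ℝ) ∈ {y : ℝ | (w.re : ℂ) + y * I ∈ D} := by simpa using hw0
  have hzero := hf.eqOn_zero_of_preconnected_of_eventuallyEq_zero hconv.isPreconnected h0mem
    (eventually_eq_zero_of_iteratedDeriv (hf 0 h0mem) fun n => by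
      rw [iteratedDeriv_vertical hDo hAD w.re n 0 h0mem]
      simpa using pd_iter_real_eq_zero hDo hAD hab (fun z hz => heq' z (hDr hz)) hreal n w.re hw0)
  have hwm : w.im ∈ {y : ℝ | (w.re : ℂ) + y * I ∈ D} := by
    rw [Set.mem_ofPred_eq, Complex.re_add_im]; exact hw
  have := hzero hwm
  simpa [Complex.re_add_im] using this

end Uniqueness

/-! ### Analyticity in arbitrary projective charts -/

section Charts

variable {𝕜 K : Type} [NontriviallyNormedField 𝕜] [NontriviallyNormedField K] [NormedAlgebra 𝕜 K]
  [NormedSpace 𝕜 ℂ] [DecidableEq K]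

/-- The change of coordinates m'⁻¹ m is fractional linear and finite at z, hence analytic there. -/
theorem analyticAt_smul_transfer {F : OnePoint K → ℂ} {m m' : Matrix.GeneralLinearGroup (Fin 2) K}
    {z z' : K} (h : m • (z : OnePoint K) = m' • (z' : OnePoint K))
    (hF : AnalyticAt 𝕜 (fun w : K => F (m' • (w : OnePoint K))) z') :
    AnalyticAt 𝕜 (fun w : K => F (m • (w : OnePoint K))) z := by
  set n := m'⁻¹ * m with hn
  have hnz : n • (z : OnePoint K) = z' := by rw [hn, mul_smul, h, inv_smul_smul]
  rw [OnePoint.smul_some_eq_ite] at hnz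
  split_ifs at hnz with hd
  · exact (OnePoint.infty_ne_coe _ hnz).elim
  have hz' : (n 0 0 * z + n 0 1) / (n 1 0 * z + n 1 1) = z' := OnePoint.coe_injective hnz
  have hi : AnalyticAt 𝕜 (fun w : K => w) z := analyticAt_id
  have hden : AnalyticAt 𝕜 (fun w : K => n 1 0 * w + n 1 1) z :=
    (analyticAt_const.mul hi).add analyticAt_const
  have han : AnalyticAt 𝕜 (fun w : K => (n 0 0 * w + n 0 1) / (n 1 0 * w + n 1 1)) z :=
    ((analyticAt_const.mul hi).add analyticAt_const).div hden hd
  rw [← hz'] at hF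
  refine (AnalyticAt.comp (f := fun w : K => (n 0 0 * w + n 0 1) / (n 1 0 * w + n 1 1))
    hF han).congr ?_
  filter_upwards [hden.continuousAt.eventually_ne hd] with w hw
  have : m • (w : OnePoint K) = m' • (n • (w : OnePoint K)) := by rw [hn, mul_smul, smul_inv_smul]
  rw [this, OnePoint.smul_some_eq_ite, if_neg hw]
  rfl

/-- The matrix of the coordinate at infinity. -/
noncomputable def flipGL (K : Type) [NontriviallyNormedField K] :
    Matrix.GeneralLinearGroup (Fin 2) K :=
  Matrix.GeneralLinearGroup.mkOfDetNeZero !![0, 1; 1, 0] (by simp [Matrix.det_fin_two])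

theorem flipGL_smul (w : K) : flipGL K • (w : OnePoint K) = chartInfty w := by
  rw [OnePoint.smul_some_eq_ite]
  by_cases hw : w = 0 <;>
    simp [flipGL, chartInfty, hw, Matrix.GeneralLinearGroup.mkOfDetNeZero]

/-- Every element of GL₂ may serve as a chart, not only the identity and the inversion of the
definition. Invariance of analyticity under the group is then immediate. -/
theorem analyticAtP1_smul_iff {F : OnePoint K → ℂ} (m : Matrix.GeneralLinearGroup (Fin 2) K) (z : K) :
    AnalyticAtP1 𝕜 F (m • (z : OnePoint K)) ↔
      AnalyticAt 𝕜 (fun w : K => F (m • (w : OnePoint K))) z := by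
  have h : ∃ (m' : Matrix.GeneralLinearGroup (Fin 2) K) (z' : K),
      m • (z : OnePoint K) = m' • (z' : OnePoint K) ∧ (AnalyticAtP1 𝕜 F (m • (z : OnePoint K)) ↔
        AnalyticAt 𝕜 (fun w : K => F (m' • (w : OnePoint K))) z') := by
    generalize m • (z : OnePoint K) = p
    induction p using OnePoint.rec with
    | infty =>
      refine ⟨flipGL K, 0, ?_, ?_⟩
      · rw [flipGL_smul]; simp [chartInfty]
      · simp only [flipGL_smul]; rfl
    | coe t =>
      refine ⟨1, t, (one_smul _ _).symm, ?_⟩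
      simp only [one_smul]; rfl
  obtain ⟨m', z', h1, h2⟩ := h
  exact h2.trans ⟨analyticAt_smul_transfer h1, analyticAt_smul_transfer h1.symm⟩

theorem exists_smul_coe (p : OnePoint K) :
    ∃ (m : Matrix.GeneralLinearGroup (Fin 2) K) (z : K), p = m • (z : OnePoint K) := by
  induction p using OnePoint.rec with
  | infty => exact ⟨flipGL K, 0, by rw [flipGL_smul]; simp [chartInfty]⟩
  | coe t => exact ⟨1, t, (one_smul _ _).symm⟩

theorem AnalyticAtP1.comp_smul {F : OnePoint K → ℂ} (g : Matrix.GeneralLinearGroup (Fin 2) K)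
    {p : OnePoint K} (h : AnalyticAtP1 𝕜 F (g • p)) : AnalyticAtP1 𝕜 (fun q => F (g • q)) p := by
  obtain ⟨m, z, rfl⟩ := exists_smul_coe p
  rw [analyticAtP1_smul_iff]
  rw [← mul_smul, analyticAtP1_smul_iff] at h
  simpa only [mul_smul] using h

theorem AnalyticAtP1.congr {F F' : OnePoint K → ℂ} {p : OnePoint K} [ProperSpace K]
    (h : AnalyticAtP1 𝕜 F p) (h' : F =ᶠ[𝓝 p] F') : AnalyticAtP1 𝕜 F' p := by
  obtain ⟨m, z, rfl⟩ := exists_smul_coe p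
  rw [analyticAtP1_smul_iff] at h ⊢
  exact h.congr (((continuous_smul_GL m).comp OnePoint.continuous_coe).continuousAt.eventually h')

end Charts

/-! ### Group laws and analyticity for the actions on the projective lines -/

section Actions

variable {𝕜 : Type} [NontriviallyNormedField 𝕜] [NormedAlgebra 𝕜 ℂ]

theorem actC_one (p : P1C) : actC 1 p = p := by simp [actC]

theorem actC_mul (g h : G) (p : P1C) : actC (g * h) p = actC g (actC h p) := by
  simp [actC, mul_smul]

theorem actR_one (t : P1R) : actR 1 t = t := by simp [actR]

theorem actR_mul (g h : G) (t : P1R) : actR (g * h) t = actR g (actR h t) := by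
  simp [actR, mul_smul]

theorem actC_inv_actC (g : G) (p : P1C) : actC g⁻¹ (actC g p) = p := by
  rw [← actC_mul, inv_mul_cancel, actC_one]

theorem actC_actC_inv (g : G) (p : P1C) : actC g (actC g⁻¹ p) = p := by
  rw [← actC_mul, mul_inv_cancel, actC_one]

theorem actR_inv_actR (g : G) (t : P1R) : actR g⁻¹ (actR g t) = t := by
  rw [← actR_mul, inv_mul_cancel, actR_one]

theorem actR_actR_inv (g : G) (t : P1R) : actR g (actR g⁻¹ t) = t := by
  rw [← actR_mul, mul_inv_cancel, actR_one]

theorem continuous_actC (g : G) : Continuous (actC g) := continuous_smul_GL _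

theorem continuous_actR (g : G) : Continuous (actR g) := continuous_smul_GL _

theorem AnalyticAtP1.comp_actC {F : P1C → ℂ} (g : G) {p : P1C}
    (h : AnalyticAtP1 𝕜 F (actC g p)) : AnalyticAtP1 𝕜 (fun q => F (actC g q)) p :=
  AnalyticAtP1.comp_smul _ h

theorem AnalyticAtP1.comp_actR {F : P1R → ℂ} (g : G) {t : P1R}
    (h : AnalyticAtP1 ℝ F (actR g t)) : AnalyticAtP1 ℝ (fun q => F (actR g q)) t :=
  AnalyticAtP1.comp_smul _ h

theorem actC_coe (g : G) {z : ℂ} (hz : den g z ≠ 0) : actC g (z : P1C) = (mob g z : ℂ) := by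
  unfold actC
  rw [OnePoint.smul_some_eq_ite]
  have : den g z = ((g 1 0 : ℝ) : ℂ) * z + ((g 1 1 : ℝ) : ℂ) := rfl
  simp [← this, hz, mob]

theorem conjP1_actC (g : G) (p : P1C) : conjP1 (actC g p) = actC g (conjP1 p) := by
  unfold conjP1 actC
  rw [show (fun z : ℂ => starRingEnd ℂ z) = ⇑(starRingEnd ℂ) from rfl, OnePoint.map_smul]
  congr 1
  ext i j
  simp

theorem AnalyticAtP1.mul {K : Type} [NontriviallyNormedField K] [NormedSpace ℝ K]
    {F F' : OnePoint K → ℂ} {p : OnePoint K} (h : AnalyticAtP1 ℝ F p) (h' : AnalyticAtP1 ℝ F' p) :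
    AnalyticAtP1 ℝ (fun q => F q * F' q) p := by
  induction p using OnePoint.rec with
  | infty => exact AnalyticAt.fun_mul h h'
  | coe z => exact AnalyticAt.fun_mul h h'

theorem AnalyticAtP1.inv {K : Type} [NontriviallyNormedField K] [NormedSpace ℝ K]
    {F : OnePoint K → ℂ} {p : OnePoint K} (h : AnalyticAtP1 ℝ F p) (h0 : F p ≠ 0) :
    AnalyticAtP1 ℝ (fun q => (F q)⁻¹) p := by
  induction p using OnePoint.rec with
  | infty => exact AnalyticAt.fun_inv h (by simpa [chartInfty] using h0)
  | coe z => exact AnalyticAt.fun_inv h h0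

end Actions

/-! ### The multiplier relating the two actions -/

section Multiplier

theorem eq_of_exp_eq {x y : ℂ} (h : Complex.exp x = Complex.exp y) (h1 : x.im - y.im < 2 * Real.pi)
    (h2 : y.im - x.im < 2 * Real.pi) : x = y := by
  obtain ⟨n, hn⟩ := Complex.exp_eq_exp_iff_exists_int.mp h
  have him : x.im - y.im = n * (2 * Real.pi) := by
    rw [hn]; simp
  have hpi := Real.pi_pos
  have hn0 : n = 0 := by
    have h3 : (n : ℝ) < 1 := by
      by_contra hc; push Not at hc; nlinarith
    have h4 : (-1 : ℝ) < n := by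
      by_contra hc; push Not at hc; nlinarith
    have h3' : n < 1 := by exact_mod_cast h3
    have h4' : -1 < n := by exact_mod_cast h4
    omega
  simpa [hn0] using hn

theorem arg_mem_of_im_pos {z : ℂ} (hz : 0 < z.im) : 0 < z.arg ∧ z.arg < Real.pi := by
  have h1 := Complex.arg_nonneg_iff.mpr hz.le
  have h2 : z.arg ≠ 0 := fun h => by
    have := (Complex.arg_eq_zero_iff.mp h).2; linarith
  have h3 : z.arg ≠ Real.pi := fun h => by
    have := (Complex.arg_eq_pi_iff.mp h).2; linarith
  exact ⟨lt_of_le_of_ne h1 (Ne.symm h2), lt_of_le_of_ne (Complex.arg_le_pi z) h3⟩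

theorem arg_neg_of_im_neg {z : ℂ} (hz : z.im < 0) : z.arg < 0 := Complex.arg_neg_iff.mpr hz

/-- The point `g⁻¹(-i)` of the lower half-plane. -/
noncomputable def pole (g : G) : ℂ := mob g⁻¹ (-I)

theorem inv_apply (g : G) : g⁻¹ 0 0 = g 1 1 ∧ g⁻¹ 0 1 = -g 0 1 ∧ g⁻¹ 1 0 = -g 1 0 ∧ g⁻¹ 1 1 = g 0 0 := by
  rw [Matrix.SpecialLinearGroup.SL2_inv_expl]
  simp

theorem conj_pole (g : G) : conj (pole g) = mob g⁻¹ I := by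
  rw [pole, conj_mob]; simp

theorem pole_im (g : G) : (pole g).im < 0 := by
  have h := mob_im_pos g⁻¹ (z := I) (by simp)
  rw [← conj_pole, Complex.conj_im] at h
  linarith

/-- The number `a + i c`. -/
noncomputable def colNum (g : G) : ℂ := (g 0 0 : ℂ) + I * (g 1 0 : ℂ)

theorem colNum_ne_zero (g : G) : colNum g ≠ 0 := by
  intro h
  have h1 := congrArg Complex.re h
  have h2 := congrArg Complex.im h
  simp [colNum] at h1 h2
  have := det_eq_one g
  simp [h1, h2] at this

theorem mob_add_I_mul_den (g : G) {z : ℂ} (hz : den g z ≠ 0) :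
    (mob g z + I) * den g z = colNum g * (z - pole g) := by
  obtain ⟨h1, h2, h3, h4⟩ := inv_apply g
  have hc := colNum_ne_zero g
  have hp : pole g = (-(g 1 1 : ℂ) * I - g 0 1) / colNum g := by
    rw [pole, mob, h1, h2, h3, h4]
    congr 1
    · push_cast; ring
    · rw [colNum]; push_cast; ring
  have hm : mob g z = ((g 0 0 : ℂ) * z + g 0 1) / den g z := rfl
  rw [hp, hm]
  field_simp
  simp only [den, colNum]
  ring

/-- The logarithm of (gz + i)(cz + d) = (a + ic)(z - g⁻¹(-i)). No multiple of 2πi appears, because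
the imaginary parts of both sides differ by less than 2π. -/
theorem log_mob_add_I (g : G) {z : ℂ} (hz : 0 < z.im) :
    Complex.log (mob g z + I)
      = Complex.log (colNum g) + Complex.log (z - pole g) - Complex.log (den g z) := by
  have hd := den_ne_zero g hz.ne'
  have hm := mob_im_pos g hz
  have hp := pole_im g
  have i1 : 0 < (mob g z + I).im := by simp; linarith
  have i2 : 0 < (z - pole g).im := by simp; linarith
  have n1 : mob g z + I ≠ 0 := fun h => by simp [h] at i1
  have n2 : z - pole g ≠ 0 := fun h => by simp [h] at i2
  rw [eq_sub_iff_add_eq]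
  obtain ⟨a1, b1⟩ := arg_mem_of_im_pos i1
  obtain ⟨a2, b2⟩ := arg_mem_of_im_pos i2
  have hpi := Real.pi_pos
  -- The imaginary parts of cz + d and a + ic have the sign of c, so both arguments lie in the same
  -- interval of length π. If c = 0, both numbers are real of equal sign and the arguments coincide.
  have key : (den g z).arg - (colNum g).arg < Real.pi ∧ (colNum g).arg - (den g z).arg < Real.pi := by
    rcases lt_trichotomy (g 1 0) 0 with hc | hc | hc
    · have j1 : (colNum g).im < 0 := by simpa [colNum] using hc
      have j2 : (den g z).im < 0 := by simpa [den] using mul_neg_of_neg_of_pos hc hz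
      have := arg_neg_of_im_neg j1
      have := arg_neg_of_im_neg j2
      have := Complex.neg_pi_lt_arg (colNum g)
      have := Complex.neg_pi_lt_arg (den g z)
      constructor <;> linarith
    · have hdet : g 0 0 * g 1 1 = 1 := by
        have := g.det_coe
        rw [Matrix.det_fin_two, hc] at this
        simpa using this
      have e1 : colNum g = (g 0 0 : ℝ) := by simp [colNum, hc]
      have e2 : den g z = (g 1 1 : ℝ) := by simp [den, hc]
      have : (colNum g).arg = (den g z).arg := by
        rw [e1, e2]
        rcases lt_trichotomy (g 0 0) 0 with ha | ha | ha
        · have : g 1 1 < 0 := by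
            by_contra h; push Not at h; nlinarith
          rw [Complex.arg_ofReal_of_neg ha, Complex.arg_ofReal_of_neg this]
        · rw [ha] at hdet; simp at hdet
        · have : 0 ≤ g 1 1 := by
            by_contra h; push Not at h; nlinarith
          rw [Complex.arg_ofReal_of_nonneg ha.le, Complex.arg_ofReal_of_nonneg this]
      rw [this]
      constructor <;> linarith
    · have j1 : 0 < (colNum g).im := by simpa [colNum] using hc
      have j2 : 0 < (den g z).im := by simpa [den] using mul_pos hc hz
      have := arg_mem_of_im_pos j1
      have := arg_mem_of_im_pos j2
      constructor <;> linarith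
  refine eq_of_exp_eq ?_ ?_ ?_
  · rw [Complex.exp_add, Complex.exp_add, Complex.exp_log n1, Complex.exp_log hd,
      Complex.exp_log n2, Complex.exp_log (colNum_ne_zero g), mob_add_I_mul_den g hd]
  · simp only [Complex.add_im, Complex.log_im]; linarith
  · simp only [Complex.add_im, Complex.log_im]; linarith

theorem log_div_of_im_pos {z w : ℂ} (hz : 0 < z.im) (hw : 0 < w.im) :
    Complex.log (z / w) = Complex.log z - Complex.log w ∧ (z / w).arg ≠ Real.pi := by
  obtain ⟨a1, b1⟩ := arg_mem_of_im_pos hz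
  obtain ⟨a2, b2⟩ := arg_mem_of_im_pos hw
  have hz0 : z ≠ 0 := fun h => by simp [h] at hz
  have hw0 : w ≠ 0 := fun h => by simp [h] at hw
  have h3 := Complex.neg_pi_lt_arg (z / w)
  have h4 := Complex.arg_le_pi (z / w)
  have h : Complex.log (z / w) = Complex.log z - Complex.log w := by
    refine eq_of_exp_eq ?_ ?_ ?_
    · rw [Complex.exp_sub, Complex.exp_log hz0, Complex.exp_log hw0,
        Complex.exp_log (div_ne_zero hz0 hw0)]
    · simp only [Complex.sub_im, Complex.log_im]; linarith
    · simp only [Complex.sub_im, Complex.log_im]; linarith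
  refine ⟨h, fun hpi => ?_⟩
  have := congrArg Complex.im h
  simp only [Complex.sub_im, Complex.log_im] at this
  linarith

/-- The extension of the factor of the principal series action to `P¹(ℂ)`. -/
noncomputable def mulFactor (s : ℂ) (k : ℝ) (g : G) (q : P1C) : ℂ :=
  Complex.exp ((-s + k / 2) * conj (Complex.log (colNum g)))
    * Complex.exp ((-s - k / 2) * Complex.log (colNum g))
    * q.elim 1 (fun z : ℂ =>
        ((conj z - I) / (conj z - mob g⁻¹ I)) ^ (s - k / 2) * ((z + I) / (z - pole g)) ^ (s + k / 2))

theorem prsFactor_eq (s : ℂ) (k : ℝ) (g : G) (t : P1R) :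
    prsFactor s k g t = mulFactor s k g (realPt t) := by
  induction t using OnePoint.rec with
  | infty => rfl
  | coe x =>
    simp only [prsFactor, mulFactor, realPt, OnePoint.map_some, OnePoint.elim_some, colNum, pole,
      Complex.conj_ofReal]

theorem mulFactor_coe_ne_zero (s : ℂ) (k : ℝ) (g : G) {z : ℂ} (h1 : z ≠ -I) (h2 : z ≠ pole g) :
    mulFactor s k g z ≠ 0 := by
  have e1 : z + I ≠ 0 := fun h => h1 (eq_neg_of_add_eq_zero_left h)
  have e2 : z - pole g ≠ 0 := sub_ne_zero.mpr h2
  have e3 : (conj z - I) / (conj z - mob g⁻¹ I) = conj ((z + I) / (z - pole g)) := by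
    rw [← conj_pole]; simp [sub_eq_add_neg]
  simp only [mulFactor, OnePoint.elim_some, e3]
  refine mul_ne_zero (mul_ne_zero (Complex.exp_ne_zero _) (Complex.exp_ne_zero _)) (mul_ne_zero ?_ ?_)
  · rw [Complex.cpow_ne_zero_iff]
    left; rw [Ne, map_eq_zero]; exact div_ne_zero e1 e2
  · rw [Complex.cpow_ne_zero_iff]
    left; exact div_ne_zero e1 e2

theorem prsFactor_ne_zero (s : ℂ) (k : ℝ) (g : G) (t : P1R) : prsFactor s k g t ≠ 0 := by
  rw [prsFactor_eq]
  induction t using OnePoint.rec with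
  | infty =>
    simp [mulFactor, realPt]
  | coe x =>
    refine mulFactor_coe_ne_zero s k g (fun h => ?_) (fun h => ?_)
    · have := congrArg Complex.im h; simp at this
    · have := congrArg Complex.im h; have := pole_im g; simp at *; linarith

theorem Phi_eq_exp (s : ℂ) (k : ℝ) (z : ℍ) :
    Phi s k z = Complex.exp (-s * Real.log z.im + (s + k / 2) * Complex.log ((z : ℂ) + I)
      + (s - k / 2) * conj (Complex.log ((z : ℂ) + I))) := by
  have i1 : 0 < ((z : ℂ) + I).im := by
    have := z.im_pos; simp; linarith
  have n1 : (z : ℂ) + I ≠ 0 := fun h => by simp [h] at i1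
  have e : conj (z : ℂ) - I = conj ((z : ℂ) + I) := by simp [sub_eq_add_neg]
  have n2 : conj ((z : ℂ) + I) ≠ 0 := by rw [Ne, map_eq_zero]; exact n1
  have n3 : (z.im : ℂ) ≠ 0 := by exact_mod_cast z.im_ne_zero
  rw [Phi, e, Complex.cpow_def_of_ne_zero n3, Complex.cpow_def_of_ne_zero n1,
    Complex.cpow_def_of_ne_zero n2, Complex.log_conj _ (arg_mem_of_im_pos i1).2.ne,
    ← Complex.exp_add, ← Complex.exp_add, Complex.ofReal_log z.im_pos.le]
  congr 1
  ring

theorem log_smul_im (g : G) (z : ℍ) :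
    Real.log (g • z).im = Real.log z.im - 2 * (Complex.log (den g z)).re := by
  have hd := den_ne_zero g (z := (z : ℂ)) z.im_ne_zero
  have h1 := mob_im g hd
  rw [← conj_den, Complex.mul_conj, mob_coe] at h1
  have h2 : (g • z).im = z.im / Complex.normSq (den g z) := by
    have : ((g • z : ℍ) : ℂ).im = (z : ℂ).im / Complex.normSq (den g z) := by exact_mod_cast h1
    exact this
  rw [h2, Real.log_div z.im_ne_zero (Complex.normSq_pos.mpr hd).ne', Complex.normSq_eq_norm_sq,
    Real.log_pow, Complex.log_re]
  norm_num

/-- Both sides are exponentials of linear combinations of log (z+i), log (z - g⁻¹(-i)), log (cz+d),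
log (a+ic), their conjugates and log y. `log_mob_add_I` and `log_smul_im` make the exponents equal,
not merely equal modulo 2πi. -/
theorem Phi_mul_autFactor (s : ℂ) (k : ℝ) (g : G) (z : ℍ) :
    Phi s k z * autFactor k g z = mulFactor s k g (upPt z) * Phi s k (g • z) := by
  have i1 : 0 < ((z : ℂ) + I).im := by
    have := z.im_pos; simp; linarith
  have i2 : 0 < ((z : ℂ) - pole g).im := by
    have := z.im_pos; have := pole_im g; simp; linarith
  have n1 : (z : ℂ) + I ≠ 0 := fun h => by simp [h] at i1
  have n2 : (z : ℂ) - pole g ≠ 0 := fun h => by simp [h] at i2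
  obtain ⟨l1, l2⟩ := log_div_of_im_pos i1 i2
  have e3 : (conj (z : ℂ) - I) / (conj (z : ℂ) - mob g⁻¹ I)
      = conj (((z : ℂ) + I) / ((z : ℂ) - pole g)) := by
    rw [← conj_pole]; simp [sub_eq_add_neg]
  have n3 := div_ne_zero n1 n2
  have n4 : conj (((z : ℂ) + I) / ((z : ℂ) - pole g)) ≠ 0 := by
    rw [Ne, map_eq_zero]; exact n3
  rw [Phi_eq_exp, Phi_eq_exp, autFactor, mulFactor, upPt, OnePoint.elim_some, e3,
    Complex.cpow_def_of_ne_zero n3, Complex.cpow_def_of_ne_zero n4, Complex.log_conj _ l2, l1,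
    ← mob_coe, log_mob_add_I g z.im_pos, log_smul_im]
  simp only [← Complex.exp_add]
  congr 1
  have hre : ((Complex.log (den g z)).re : ℂ)
      = (Complex.log (den g z) + conj (Complex.log (den g z))) / 2 := by
    rw [Complex.add_conj]; push_cast; ring
  have him : ((Complex.arg (den g z) : ℝ) : ℂ)
      = (Complex.log (den g z) - conj (Complex.log (den g z))) / (2 * I) := by
    rw [Complex.sub_conj, Complex.log_im]; push_cast; field_simp
  push_cast
  rw [hre, him]
  simp only [map_sub, map_add]
  field_simp
  ring

/-- The segment from `-i` to `g⁻¹(-i)`, on which the multiplier may be singular. -/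
def cut (g : G) : Set P1C := (fun z : ℂ => (z : OnePoint ℂ)) '' segment ℝ (-I) (pole g)

theorem isClosed_cut (g : G) : IsClosed (cut g) := by
  refine (IsCompact.image ?_ OnePoint.continuous_coe).isClosed
  rw [segment_eq_image]
  exact isCompact_Icc.image (by fun_prop)

/-- The cut lies in the lower half-plane, so removing it from a domain costs no point of ℍ or of
P¹(ℝ). -/
theorem im_neg_of_mem_cut {g : G} {z : ℂ} (h : z ∈ segment ℝ (-I) (pole g)) : z.im < 0 := by
  have hc : Convex ℝ {z : ℂ | z.im < 0} := convex_halfSpace_im_lt 0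
  exact hc.segment_subset (by simp) (pole_im g) h

theorem realPt_notMem_cut (g : G) (t : P1R) : realPt t ∉ cut g := by
  rintro ⟨z, hz, h⟩
  induction t using OnePoint.rec with
  | infty => exact OnePoint.coe_ne_infty _ h
  | coe x =>
    have : z = (x : ℂ) := OnePoint.coe_injective h
    have h2 := im_neg_of_mem_cut hz
    rw [this] at h2; simp at h2

/-- If (z + i)/(z - p) = -r with r ≥ 0, then z = (-i + r p)/(1 + r) divides the segment from -i to p
= g⁻¹(-i). -/
theorem div_mem_slitPlane {g : G} {z : ℂ} (h : z ∉ segment ℝ (-I) (pole g)) :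
    (z + I) / (z - pole g) ∈ Complex.slitPlane := by
  rw [Complex.mem_slitPlane_iff_not_le_zero]
  intro hle
  apply h
  obtain ⟨r, hr, hr'⟩ : ∃ r : ℝ, 0 ≤ r ∧ (z + I) / (z - pole g) = -(r : ℂ) := by
    rw [Complex.le_def] at hle
    refine ⟨-((z + I) / (z - pole g)).re, by simpa using hle.1, ?_⟩
    apply Complex.ext <;> simp [hle.2]
  -- At the pole the quotient has the default value 0; this point is an end of the segment.
  by_cases hz : z = pole g
  · rw [hz]; exact right_mem_segment ℝ _ _
  have hz' : z - pole g ≠ 0 := sub_ne_zero.mpr hz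
  rw [div_eq_iff hz'] at hr'
  refine ⟨1 / (1 + r), r / (1 + r), by positivity, by positivity, by field_simp, ?_⟩
  have h1 : (1 + r : ℂ) ≠ 0 := by
    have : (1 + r : ℝ) ≠ 0 := by positivity
    exact_mod_cast this
  simp only [Complex.real_smul]
  push_cast
  field_simp
  linear_combination -hr'

theorem slitPlane_conj {z : ℂ} (hz : z ∈ Complex.slitPlane) : conj z ∈ Complex.slitPlane := by
  rw [Complex.mem_slitPlane_iff] at *
  simpa using hz

theorem analyticAt_cpow_conj {r : ℂ → ℂ} {z : ℂ} (hr : AnalyticAt ℝ r z) (a : ℂ)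
    (hs : r z ∈ Complex.slitPlane) : AnalyticAt ℝ (fun w => r w ^ a) z :=
  AnalyticAt.comp (g := fun x : ℂ => x ^ a)
    (analyticAt_id.cpow analyticAt_const hs : AnalyticAt ℂ (fun x : ℂ => x ^ a) (r z)).restrictScalars hr

theorem analyticAtP1_mulFactor (s : ℂ) (k : ℝ) (g : G) {q : P1C} (hq : q ∉ cut g) :
    AnalyticAtP1 ℝ (mulFactor s k g) q := by
  have hconj : ∀ z : ℂ, (conj z - I) / (conj z - mob g⁻¹ I) = conj ((z + I) / (z - pole g)) := by
    intro z; rw [← conj_pole]; simp [sub_eq_add_neg]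
  induction q using OnePoint.rec with
  | infty =>
    refine AnalyticAt.mul analyticAt_const ?_
    -- The quotient (z + i)/(z - g⁻¹(-i)) in the coordinate w = 1/z, where it is regular with value
    -- 1 at w = 0.
    let r : ℂ → ℂ := fun w => (1 + I * w) / (1 - pole g * w)
    have hr0 : r 0 = 1 := by simp [r]
    have hr : AnalyticAt ℝ r 0 := by
      have h1 : AnalyticAt ℂ r 0 :=
        AnalyticAt.div (by fun_prop) (by fun_prop) (by simp)
      exact h1.restrictScalars
    have hs : r 0 ∈ Complex.slitPlane := by rw [hr0]; simp
    have hcs : conj (r 0) ∈ Complex.slitPlane := slitPlane_conj hs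
    have hcr : AnalyticAt ℝ (fun w => conj (r w)) 0 := (analyticAt_conj (r 0)).comp hr
    refine ((analyticAt_cpow_conj hcr (s - k / 2) hcs).mul
      (analyticAt_cpow_conj hr (s + k / 2) hs)).congr (Eventually.of_forall fun w => ?_)
    by_cases hw : w = 0
    · subst hw; simp [chartInfty, hr0]
    · have e : (w⁻¹ + I) / (w⁻¹ - pole g) = r w := by
        have h1 : w⁻¹ + I = w⁻¹ * (1 + I * w) := by field_simp
        have h2 : w⁻¹ - pole g = w⁻¹ * (1 - pole g * w) := by field_simp
        rw [h1, h2, mul_div_mul_left _ _ (inv_ne_zero hw)]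
      simp only [chartInfty, hw, if_false, OnePoint.elim_some, hconj, e, Pi.mul_apply]
  | coe z =>
    have hz : z ∉ segment ℝ (-I) (pole g) := fun h => hq ⟨z, h, rfl⟩
    have hs := div_mem_slitPlane hz
    have hzp : z - pole g ≠ 0 := by
      intro h; rw [h, div_zero] at hs; simp at hs
    let r : ℂ → ℂ := fun w => (w + I) / (w - pole g)
    have hr : AnalyticAt ℝ r z := by
      have h1 : AnalyticAt ℂ r z := AnalyticAt.div (by fun_prop) (by fun_prop) hzp
      exact h1.restrictScalars
    have hcr : AnalyticAt ℝ (fun w => conj (r w)) z := (analyticAt_conj (r z)).comp hr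
    refine AnalyticAt.mul analyticAt_const ?_
    refine ((analyticAt_cpow_conj hcr (s - k / 2) (slitPlane_conj hs)).mul
      (analyticAt_cpow_conj hr (s + k / 2) hs)).congr (Eventually.of_forall fun w => ?_)
    simp only [OnePoint.elim_some, hconj, Pi.mul_apply]
    rfl

end Multiplier

/-! ### The action of `G` on boundary germs -/

section Slash

/-- The part of `g⁻¹ Ω` on which the multiplier is regular. -/
noncomputable def slashDomain (g : G) (Ω : Opens P1C) : Opens P1C :=
  preC g Ω ⊓ ⟨(cut g)ᶜ, (isClosed_cut g).isOpen_compl⟩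

theorem slashDomain_le (g : G) (Ω : Opens P1C) : slashDomain g Ω ≤ preC g Ω := inf_le_left

theorem mem_slashDomain {g : G} {Ω : Opens P1C} {p : P1C} :
    p ∈ slashDomain g Ω ↔ actC g p ∈ Ω ∧ p ∉ cut g := Iff.rfl

theorem realPt_mem_slashDomain {g : G} {Ω : Opens P1C} {t : P1R} :
    realPt t ∈ slashDomain g Ω ↔ realPt (actR g t) ∈ Ω := by
  rw [mem_slashDomain, actC_realPt]
  exact and_iff_left (realPt_notMem_cut g t)

theorem upPt_notMem_cut (g : G) (z : ℍ) : upPt z ∉ cut g := by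
  rintro ⟨w, hw, h⟩
  have h1 : w = (z : ℂ) := OnePoint.coe_injective h
  have h2 := im_neg_of_mem_cut hw
  rw [h1] at h2
  exact (z.im_pos.trans h2).false

theorem upPt_mem_slashDomain {g : G} {Ω : Opens P1C} {z : ℍ} :
    upPt z ∈ slashDomain g Ω ↔ upPt (g • z) ∈ Ω := by
  rw [mem_slashDomain, actC_upPt]
  exact and_iff_left (upPt_notMem_cut g z)

theorem zeroExt_slash (k : ℝ) (g : G) {Ω Ω' : Opens P1C} (f : UpPart Ω → ℂ) (h : Ω' ≤ preC g Ω) :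
    Set.EqOn (zeroExt (restrictUp h (slash k g f)))
      (fun z => autFactor k g z * zeroExt f (mob g z)) (upSet Ω') := by
  rintro z ⟨hz, hz'⟩
  let w : UpPart Ω' := ⟨⟨z, hz⟩, hz'⟩
  have hw : actC g (upPt w.1) ∈ Ω := h w.2
  rw [actC_upPt] at hw
  have h1 := zeroExt_apply (restrictUp h (slash k g f)) w
  have h2 := zeroExt_apply f ⟨g • w.1, hw⟩
  have h3 : ((g • w.1 : ℍ) : ℂ) = mob g z := (mob_coe g w.1).symm
  change zeroExt f ((g • w.1 : ℍ) : ℂ) = _ at h2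
  rw [h3] at h2
  change _ = autFactor k g z * zeroExt f (mob g z)
  rw [h2]
  exact h1

theorem mob_mem_upSet {g : G} {Ω Ω' : Opens P1C} (h : Ω' ≤ preC g Ω) {z : ℂ} (hz : z ∈ upSet Ω') :
    mob g z ∈ upSet Ω := by
  refine ⟨mob_im_pos g hz.1, ?_⟩
  have := h hz.2
  rw [← actC_coe g (den_ne_zero g hz.1.ne')]
  exact this

theorem slash_mem_E (s : ℂ) (k : ℝ) (g : G) {Ω Ω' : Opens P1C} {f : UpPart Ω → ℂ}
    (hf : f ∈ E s k Ω) (h : Ω' ≤ preC g Ω) : restrictUp h (slash k g f) ∈ E s k Ω' := by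
  have heq := zeroExt_slash k g f h
  obtain ⟨h1, h2⟩ := hf
  constructor
  · refine ContDiffOn.congr (fun z hz => ContDiffAt.contDiffWithinAt ?_) heq
    have hm := mob_mem_upSet h hz
    exact (contDiffAt_autFactor k g hz.1).mul ((h1.contDiffAt ((isOpen_upSet Ω).mem_nhds hm)).comp z
      (contDiffAt_mob g (den_ne_zero g hz.1.ne')))
  · intro z hz
    have hm := mob_mem_upSet h hz
    rw [weightLaplace_congr k (heq.eventuallyEq_of_mem ((isOpen_upSet Ω').mem_nhds hz)), heq hz,
      weightLaplace_slash k g hz.1 (contDiffAt_of_upSet h1 hm), h2 _ hm]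
    ring

/-- By `Phi_mul_autFactor`, multiplication by Φ_{s,k} converts the automorphy factor into the
multiplier, which is analytic off the cut. -/
theorem isExt_slash (s : ℂ) (k : ℝ) (g : G) {Ω : Opens P1C} {f : UpPart Ω → ℂ} {F : P1C → ℂ}
    (hF : IsExt s k f F) : IsExt s k (restrictUp (slashDomain_le g Ω) (slash k g f))
      (fun q => mulFactor s k g q * F (actC g q)) := by
  refine ⟨fun p hp => ?_, fun z => ?_⟩
  · obtain ⟨h1, h2⟩ := mem_slashDomain.mp hp
    exact (analyticAtP1_mulFactor s k g h2).mul ((hF.1 _ h1).comp_actC g)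
  · have hz : upPt (g • z.1) ∈ Ω := upPt_mem_slashDomain.mp z.2
    have h1 := hF.2 ⟨g • z.1, hz⟩
    have h2 := Phi_mul_autFactor s k g z.1
    simp only [actC_upPt]
    rw [h1]
    change mulFactor s k g (upPt z.1) * (Phi s k (g • z.1) * f ⟨g • z.1, hz⟩)
      = Phi s k z.1 * (autFactor k g z.1 * f ⟨g • z.1, hz⟩)
    linear_combination -(f ⟨g • z.1, hz⟩) * h2

theorem slash_mem_B (s : ℂ) (k : ℝ) (g : G) {Ω : Opens P1C} {f : UpPart Ω → ℂ} (hf : f ∈ B s k Ω) :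
    restrictUp (slashDomain_le g Ω) (slash k g f) ∈ B s k (slashDomain g Ω) := by
  refine ⟨slash_mem_E s k g hf.1 _, ?_⟩
  rintro ⟨t, ht⟩
  obtain ⟨F, hF⟩ := hf.2 ⟨actR g t, realPt_mem_slashDomain.mp ht⟩
  exact ⟨_, isExt_slash s k g hF⟩

/-- The operator `|_k g` on `B_{s,k}`. -/
noncomputable def slashB (s : ℂ) (k : ℝ) (g : G) {Ω : Opens P1C} (f : B s k Ω) :
    B s k (slashDomain g Ω) := ⟨_, slash_mem_B s k g f.2⟩

theorem boundaryValue_slashB (s : ℂ) (k : ℝ) (g : G) {Ω : Opens P1C} (f : B s k Ω) {t : P1R}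
    (ht : realPt t ∈ slashDomain g Ω) (ht' : realPt (actR g t) ∈ Ω) :
    boundaryValue s k (slashB s k g f) t ht
      = prsFactor s k g t * boundaryValue s k f (actR g t) ht' := by
  obtain ⟨F, hF⟩ := f.2.2 ⟨_, ht'⟩
  rw [boundaryValue_eq s k _ (isExt_slash s k g hF) t ht, boundaryValue_eq s k f hF _ ht',
    prsFactor_eq, actC_realPt]

theorem rest_of (s : ℂ) (k : ℝ) (I : Opens P1R) (Ω : Nbhd I) (f : B s k Ω.1) :
    rest s k I (W.of s k I Ω f) = restB s k I Ω f :=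
  Module.DirectLimit.lift_of _ _ _

/-- The formula of `isExt_slash` for the extension is read off at real points, where the multiplier
is `prsFactor`. -/
theorem rest_slash (s : ℂ) (k : ℝ) (g : G) (I : Opens P1R) (Ω : Nbhd I) (f : B s k Ω.1) :
    ∃ (Ω' : Nbhd (preR g I)) (hΩ' : Ω'.1 ≤ (Ω.pre g).1)
      (hfg : restrictUp hΩ' (slash k g f.1) ∈ B s k Ω'.1),
      prs s k g (rest s k I (W.of s k I Ω f)).1 =
        (rest s k (preR g I) (W.of s k (preR g I) Ω' ⟨restrictUp hΩ' (slash k g f.1), hfg⟩)).1 := by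
  have hN : ∀ t ∈ preR g I, realPt t ∈ slashDomain g Ω.1 := fun t ht =>
    realPt_mem_slashDomain.mpr (Ω.2 _ ht)
  refine ⟨⟨slashDomain g Ω.1, hN⟩, slashDomain_le g Ω.1, slash_mem_B s k g f.2, ?_⟩
  funext t
  have e1 := congrArg (fun φ : V I => φ.1 ⟨actR g t, t.2⟩) (rest_of s k I Ω f)
  have e2 := congrArg (fun φ : V (preR g I) => φ.1 t)
    (rest_of s k (preR g I) ⟨slashDomain g Ω.1, hN⟩ (slashB s k g f))
  refine Eq.trans ?_ e2.symm
  rw [prs, e1]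
  exact (boundaryValue_slashB s k g f (hN t t.2) (Ω.2 _ t.2)).symm

instance (I : Opens P1R) : Nonempty (Nbhd I) := ⟨⟨⊤, fun _ _ => trivial⟩⟩

instance (I : Opens P1R) : IsDirectedOrder (Nbhd I) := ⟨fun Ω Ω' =>
  ⟨⟨Ω.1 ⊓ Ω'.1, fun t ht => ⟨Ω.2 t ht, Ω'.2 t ht⟩⟩,
    (inf_le_left : Ω.1 ⊓ Ω'.1 ≤ Ω.1), (inf_le_right : Ω.1 ⊓ Ω'.1 ≤ Ω'.1)⟩⟩

theorem W.exists_of (s : ℂ) (k : ℝ) {I : Opens P1R} (φ : W s k I) :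
    ∃ (Ω : Nbhd I) (f : B s k Ω.1), W.of s k I Ω f = φ :=
  Module.DirectLimit.exists_of φ

theorem rest_res (s : ℂ) (k : ℝ) (I J : Opens P1R) (hJ : J ≤ I) (φ : W s k I) :
    rest s k J (W.res s k hJ φ) = V.res hJ (rest s k I φ) := by
  obtain ⟨Ω, f, rfl⟩ := W.exists_of s k φ
  have h : W.res s k hJ (W.of s k I Ω f)
      = W.of s k J ⟨Ω.1, fun t ht => Ω.2 t (hJ ht)⟩ f := Module.DirectLimit.lift_of _ _ _
  rw [h, rest_of s k I]
  exact rest_of s k J ⟨Ω.1, fun t ht => Ω.2 t (hJ ht)⟩ f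

end Slash

/-! ### Local solutions -/

section Solutions

/-- A branch of `(z + i)^a` on the complement of a vertical half-line. -/
noncomputable def powP (a z : ℂ) : ℂ :=
  Complex.exp (a * (Complex.log (1 - I * z) + Real.pi / 2 * I))

/-- A branch of `(z - i)^b` on the complement of a vertical half-line. -/
noncomputable def powQ (b z : ℂ) : ℂ :=
  Complex.exp (b * (Complex.log (1 + I * z) - Real.pi / 2 * I))

/-- The factor `(z + i)^(s+k/2) (z̄ - i)^(s-k/2)`. -/
noncomputable def weightM (s : ℂ) (k : ℝ) (z : ℂ) : ℂ :=
  powP (s + k / 2) z * powQ (s - k / 2) (conj z)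

/-- The complement of the half-line from `-i` to `-i∞`. -/
def slitDomain : Set ℂ := {z | 1 - I * z ∈ Complex.slitPlane}

theorem isOpen_slitDomain : IsOpen slitDomain :=
  Complex.isOpen_slitPlane.preimage (by fun_prop : Continuous fun z : ℂ => 1 - I * z)

theorem mem_slitDomain_of_im {z : ℂ} (hz : -1 < z.im) : z ∈ slitDomain := by
  refine Or.inl ?_
  simp; linarith

theorem one_add_mem_slitPlane {z : ℂ} (hz : conj z ∈ slitDomain) : 1 + I * z ∈ Complex.slitPlane := by
  have := slitPlane_conj hz
  simpa using this

theorem weightM_ne_zero (s : ℂ) (k : ℝ) (z : ℂ) : weightM s k z ≠ 0 :=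
  mul_ne_zero (Complex.exp_ne_zero _) (Complex.exp_ne_zero _)

theorem analyticAt_powP (a : ℂ) {z : ℂ} (hz : z ∈ slitDomain) : AnalyticAt ℂ (powP a) z := by
  have h : AnalyticAt ℂ (fun w => Complex.log (1 - I * w)) z :=
    AnalyticAt.clog (by fun_prop) hz
  exact (analyticAt_const.mul (h.add analyticAt_const)).cexp

theorem analyticAt_powQ (b : ℂ) {z : ℂ} (hz : conj z ∈ slitDomain) : AnalyticAt ℂ (powQ b) z := by
  have h : AnalyticAt ℂ (fun w => Complex.log (1 + I * w)) z :=
    AnalyticAt.clog (by fun_prop) (one_add_mem_slitPlane hz)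
  exact (analyticAt_const.mul (h.sub analyticAt_const)).cexp

theorem analyticAt_weightM (s : ℂ) (k : ℝ) {z : ℂ} (hz : z ∈ slitDomain) :
    AnalyticAt ℝ (weightM s k) z :=
  (analyticAt_powP _ hz).restrictScalars.mul
    (AnalyticAt.comp (g := powQ (s - k / 2))
      (analyticAt_powQ _ (by simpa using hz)).restrictScalars (analyticAt_conj z))

theorem Phi_ne_zero (s : ℂ) (k : ℝ) (z : ℍ) : Phi s k z ≠ 0 := by
  rw [Phi_eq_exp]; exact Complex.exp_ne_zero _

/-- On ℍ, z + i = i(1 - iz) and arg i = π/2, so `powP` agrees with the principal power. Its cut is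
vertical instead of horizontal, so a convex symmetric domain that omits ±i does not meet it. -/
theorem imPow_mul_Phi (s : ℂ) (k : ℝ) (z : ℍ) :
    (z.im : ℂ) ^ s * Phi s k z = weightM s k z := by
  have i1 : 0 < ((z : ℂ) + I).im := by
    have := z.im_pos; simp; linarith
  have n1 : (z : ℂ) + I ≠ 0 := fun h => by simp [h] at i1
  have hz : (z : ℂ) ∈ slitDomain := mem_slitDomain_of_im (by have := z.im_pos; simp; linarith)
  have hs : 1 - I * (z : ℂ) ∈ Complex.slitPlane := hz
  have n2 : 1 - I * (z : ℂ) ≠ 0 := Complex.slitPlane_ne_zero hs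
  have n3 : (z.im : ℂ) ≠ 0 := by exact_mod_cast z.im_ne_zero
  have hlog : Complex.log ((z : ℂ) + I) = Complex.log (1 - I * z) + Real.pi / 2 * I := by
    obtain ⟨a1, b1⟩ := arg_mem_of_im_pos i1
    have := Complex.neg_pi_lt_arg (1 - I * (z : ℂ))
    have := Complex.arg_le_pi (1 - I * (z : ℂ))
    have hpi := Real.pi_pos
    have him : (Complex.log (1 - I * z) + Real.pi / 2 * I).im
        = (1 - I * (z : ℂ)).arg + Real.pi / 2 := by
      simp [Complex.log_im]
    refine eq_of_exp_eq ?_ ?_ ?_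
    · rw [Complex.exp_add, Complex.exp_log n1, Complex.exp_log n2, Complex.exp_pi_div_two_mul_I]
      linear_combination (z : ℂ) * Complex.I_sq
    · rw [him, Complex.log_im]; linarith
    · rw [him, Complex.log_im]; linarith
  have hc : conj (Complex.log (1 - I * (z : ℂ))) = Complex.log (1 + I * conj (z : ℂ)) := by
    rw [← Complex.log_conj _ (Complex.slitPlane_arg_ne_pi hs)]
    simp
  have hc2 : conj ((Real.pi : ℂ) / 2 * I) = -((Real.pi : ℂ) / 2 * I) := by
    have : (Real.pi : ℂ) / 2 = ((Real.pi / 2 : ℝ) : ℂ) := by push_cast; rfl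
    rw [map_mul, Complex.conj_I, this, Complex.conj_ofReal, mul_neg]
  rw [Phi_eq_exp, hlog, map_add, hc, hc2, weightM, powP, powQ, Complex.cpow_def_of_ne_zero n3,
    ← Complex.exp_add, ← Complex.exp_add, Complex.ofReal_log z.im_pos.le]
  congr 1
  ring

/-- `F` is real-analytic on `Ω`, and `F / Φ_{s,k}` is an eigenfunction on `Ω ∩ ℍ`. -/
structure Sol (s : ℂ) (k : ℝ) (Ω : Opens P1C) (F : P1C → ℂ) : Prop where
  analytic : ∀ p ∈ Ω, AnalyticAtP1 ℝ F p
  eqn : ∀ z ∈ upSet Ω, epd (s + k / 2) (s - k / 2) (fun w : ℂ => F w / weightM s k w) z = 0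

variable {s : ℂ} {k : ℝ} {Ω Ω' : Opens P1C} {F F' : P1C → ℂ}

theorem analyticAt_div_weightM (h : ∀ p ∈ Ω, AnalyticAtP1 ℝ F p) {z : ℂ} (hz : (z : P1C) ∈ Ω)
    (hz' : z ∈ slitDomain) : AnalyticAt ℝ (fun w : ℂ => F w / weightM s k w) z :=
  AnalyticAt.div (h _ hz) (analyticAt_weightM s k hz') (weightM_ne_zero s k z)

theorem mem_slitDomain_of_upSet {z : ℂ} (hz : z ∈ upSet Ω) : z ∈ slitDomain :=
  mem_slitDomain_of_im (by linarith [hz.1])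

theorem zeroExt_eqOn_of_ext {f : UpPart Ω → ℂ} (h : ∀ z : UpPart Ω, F (upPt z) = Phi s k z * f z) :
    Set.EqOn (zeroExt f) (fun w : ℂ => (w.im : ℂ) ^ s * (F w / weightM s k w)) (upSet Ω) := by
  rintro z ⟨hz, hz'⟩
  let w : UpPart Ω := ⟨⟨z, hz⟩, hz'⟩
  have h1 := zeroExt_apply f w
  have h2 := h w
  have h3 := imPow_mul_Phi s k w.1
  change zeroExt f z = f w at h1
  change F z = _ at h2
  change (z.im : ℂ) ^ s * _ = weightM s k z at h3
  rw [h1]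
  change f w = (z.im : ℂ) ^ s * (F z / weightM s k z)
  rw [← mul_div_assoc, eq_div_iff (weightM_ne_zero s k z), h2, ← h3]
  ring

/-- Here f = y^s (F / weightM), and `weightLaplace_imPow_mul` carries a factor 2iy · y^s without
zeros on ℍ, so the two equations are equivalent. `Sol.mem_B` is the converse. -/
theorem Sol.of_isExt {f : UpPart Ω → ℂ} (hf : f ∈ E s k Ω) (hF : IsExt s k f F) : Sol s k Ω F := by
  refine ⟨hF.1, fun z hz => ?_⟩
  have heq := zeroExt_eqOn_of_ext hF.2
  have h1 := hf.2 z hz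
  have hA := analyticAt_div_weightM (s := s) (k := k) hF.1 hz.2 (mem_slitDomain_of_upSet hz)
  have h2 := weightLaplace_imPow_mul s k hz.1 hA.contDiffAt_two
  rw [weightLaplace_congr k (heq.eventuallyEq_of_mem ((isOpen_upSet Ω).mem_nhds hz)), heq hz] at h1
  rw [h1, sub_self] at h2
  have hy : (z.im : ℂ) ≠ 0 := by exact_mod_cast hz.1.ne'
  have hne : 2 * I * (z.im : ℂ) * (z.im : ℂ) ^ s ≠ 0 :=
    mul_ne_zero (mul_ne_zero (mul_ne_zero two_ne_zero Complex.I_ne_zero) hy)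
      (by rw [Complex.cpow_ne_zero_iff]; exact Or.inl hy)
  exact (mul_eq_zero.mp h2.symm).resolve_left hne

theorem Sol.isExt (h : Sol s k Ω F) :
    IsExt s k (fun z : UpPart Ω => F (upPt z) / Phi s k z) F :=
  ⟨h.analytic, fun z => (mul_div_cancel₀ _ (Phi_ne_zero s k z.1)).symm⟩

theorem Sol.mem_B (h : Sol s k Ω F) : (fun z : UpPart Ω => F (upPt z) / Phi s k z) ∈ B s k Ω := by
  refine ⟨⟨?_, fun z hz => ?_⟩, fun _ => ⟨F, h.isExt⟩⟩
  · refine ContDiffOn.congr (fun z hz => ContDiffAt.contDiffWithinAt ?_) (zeroExt_eqOn_of_ext h.isExt.2)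
    exact (contDiffAt_imPow s hz.1).mul
      (analyticAt_div_weightM h.analytic hz.2 (mem_slitDomain_of_upSet hz)).contDiffAt
  · have heq := zeroExt_eqOn_of_ext h.isExt.2
    have hA := analyticAt_div_weightM (s := s) (k := k) h.analytic hz.2 (mem_slitDomain_of_upSet hz)
    have h2 := weightLaplace_imPow_mul s k hz.1 hA.contDiffAt_two
    rw [h.eqn z hz, mul_zero, sub_eq_zero] at h2
    rw [weightLaplace_congr k (heq.eventuallyEq_of_mem ((isOpen_upSet Ω).mem_nhds hz)), heq hz]
    exact h2

/-- The element of `B_{s,k}(Ω)` given by a solution. -/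
noncomputable def Sol.toB (h : Sol s k Ω F) : B s k Ω := ⟨_, h.mem_B⟩

theorem Sol.mono (h : Sol s k Ω F) (hle : Ω' ≤ Ω) : Sol s k Ω' F :=
  ⟨fun p hp => h.analytic p (hle hp), fun z hz => h.eqn z ⟨hz.1, hle hz.2⟩⟩

theorem epd_congr {a b : ℂ} {A A' : ℂ → ℂ} {z : ℂ} (h : A =ᶠ[𝓝 z] A') :
    epd a b A z = epd a b A' z := by
  have h1 : dz A =ᶠ[𝓝 z] dz A' := by
    filter_upwards [h.eventuallyEq_nhds] with w hw using dz_congr hw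
  rw [epd, epd, dz_congr h, dw_congr h, dw_congr h1]

theorem epd_sub {a b : ℂ} {A A' : ℂ → ℂ} {z : ℂ} (h : AnalyticAt ℝ A z) (h' : AnalyticAt ℝ A' z) :
    epd a b (fun w => A w - A' w) z = epd a b A z - epd a b A' z := by
  have first : ∀ w, AnalyticAt ℝ A w → AnalyticAt ℝ A' w →
      HasFDerivAt (fun w => A w - A' w) _ w := fun w hw hw' =>
    wd_sub hw.differentiableAt.hasFDerivAt_wd hw'.differentiableAt.hasFDerivAt_wd
  have hdz : dz (fun w => A w - A' w) =ᶠ[𝓝 z] fun w => dz A w - dz A' w := by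
    filter_upwards [h.eventually_analyticAt, h'.eventually_analyticAt] with w hw hw'
    exact dz_eq (first w hw hw')
  have h2 := wd_sub h.dz.differentiableAt.hasFDerivAt_wd h'.dz.differentiableAt.hasFDerivAt_wd
  rw [epd, epd, epd, dw_congr hdz, dw_eq h2, dz_eq (first z h h'), dw_eq (first z h h')]
  ring

theorem Sol.sub (h : Sol s k Ω F) (h' : Sol s k Ω F') : Sol s k Ω (fun p => F p - F' p) := by
  refine ⟨fun p hp => ?_, fun z hz => ?_⟩
  · have := (h.analytic p hp).add ((h'.analytic p hp).const_mul (-1))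
    simpa [sub_eq_add_neg] using this
  · have hz' := mem_slitDomain_of_upSet hz
    simp only [sub_div]
    rw [epd_sub (analyticAt_div_weightM h.analytic hz.2 hz')
      (analyticAt_div_weightM h'.analytic hz.2 hz'), h.eqn z hz, h'.eqn z hz, sub_zero]

theorem Sol.slash (h : Sol s k Ω F) (g : G) :
    Sol s k (slashDomain g Ω) (fun q => mulFactor s k g q * F (actC g q)) :=
  Sol.of_isExt (slash_mem_E s k g h.mem_B.1 _) (isExt_slash s k g h.isExt)

/-- A function that is locally equal to solutions is a solution. -/
theorem Sol.of_local (h : ∀ p ∈ Ω, ∃ (N : Opens P1C) (F' : P1C → ℂ), p ∈ N ∧ Sol s k N F' ∧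
    ∀ q ∈ N, F q = F' q) : Sol s k Ω F := by
  refine ⟨fun p hp => ?_, fun z hz => ?_⟩
  · obtain ⟨N, F', hN, hF', he⟩ := h p hp
    exact (hF'.analytic p hN).congr (by
      filter_upwards [N.isOpen.mem_nhds hN] with q hq using (he q hq).symm)
  · obtain ⟨N, F', hN, hF', he⟩ := h _ hz.2
    rw [← hF'.eqn z ⟨hz.1, hN⟩]
    refine epd_congr ?_
    filter_upwards [(N.isOpen.preimage OnePoint.continuous_coe).mem_nhds hN] with w hw
    rw [he _ hw]

theorem Sol.eq_zero_on_ball (hs : ∀ n : ℕ, 2 * s ≠ -(n : ℂ)) (h : Sol s k Ω F) {x₀ r : ℝ}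
    (hΩ : ∀ z ∈ Metric.ball (x₀ : ℂ) r, (z : P1C) ∈ Ω) (hT : Metric.ball (x₀ : ℂ) r ⊆ slitDomain)
    (h0 : ∀ᶠ x : ℝ in 𝓝 x₀, F ((x : ℂ) : P1C) = 0) :
    ∀ z ∈ Metric.ball (x₀ : ℂ) r, F z = 0 := by
  intro z hz
  have h1 := eq_zero_of_epd (a := s + k / 2) (b := s - k / 2)
    (A := fun w : ℂ => F w / weightM s k w) (x₀ := x₀) (r := r)
    (fun n hn => hs n (by linear_combination hn))
    (fun w hw => analyticAt_div_weightM h.analytic (hΩ w hw) (hT hw))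
    (fun w hw hw' => h.eqn w ⟨hw', hΩ w hw⟩)
    (by filter_upwards [h0] with x hx; rw [hx, zero_div]) z hz
  exact (div_eq_zero_iff.mp h1).resolve_right (weightM_ne_zero s k z)

/-- After transport by g the problem lives on a Euclidean disc with real centre. The multiplier has
no zeros there, because -i and g⁻¹(-i) both belong to the cut. -/
theorem Sol.eq_zero_on_image (hs : ∀ n : ℕ, 2 * s ≠ -(n : ℂ)) (h : Sol s k Ω F) (g : G) {x₀ r : ℝ}
    (hΩ : ∀ z ∈ Metric.ball (x₀ : ℂ) r, actC g z ∈ Ω)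
    (hT : Metric.ball (x₀ : ℂ) r ⊆ slitDomain)
    (hc : ∀ z ∈ Metric.ball (x₀ : ℂ) r, (z : P1C) ∉ cut g)
    (h0 : ∀ᶠ t in 𝓝 (actR g (x₀ : P1R)), F (realPt t) = 0) :
    ∀ z ∈ Metric.ball (x₀ : ℂ) r, F (actC g z) = 0 := by
  intro z hz
  have h1 := (h.slash g).eq_zero_on_ball hs (x₀ := x₀) (r := r)
    (fun w hw => ⟨hΩ w hw, hc w hw⟩) hT (by
      have hcont : Continuous fun x : ℝ => actR g (x : P1R) :=
        (continuous_actR g).comp OnePoint.continuous_coe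
      filter_upwards [hcont.continuousAt.eventually h0] with x hx
      have e : actC g ((x : ℂ) : P1C) = realPt (actR g (x : P1R)) := actC_realPt g (x : P1R)
      rw [e, hx, mul_zero]) z hz
  refine (mul_eq_zero.mp h1).resolve_left (mulFactor_coe_ne_zero s k g (fun h => ?_) (fun h => ?_))
  · exact hc z hz ⟨z, by rw [h]; exact left_mem_segment ℝ _ _, rfl⟩
  · exact hc z hz ⟨z, by rw [h]; exact right_mem_segment ℝ _ _, rfl⟩

end Solutions

/-! ### Bijectivity of the restriction morphism -/

section Bijective

variable {s : ℂ} {k : ℝ}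

/-- The matrix of `z ↦ -1 / z`. -/
noncomputable def flipG : G := ⟨!![0, -1; 1, 0], by simp [Matrix.det_fin_two]⟩

theorem exists_actR_coe (t : P1R) : ∃ (g : G) (x : ℝ), actR g (x : P1R) = t := by
  induction t using OnePoint.rec with
  | infty =>
    refine ⟨flipG, 0, ?_⟩
    unfold actR
    rw [OnePoint.smul_some_eq_ite, if_pos]
    change flipG.1 1 0 * 0 + flipG.1 1 1 = 0
    simp [flipG]
  | coe x => exact ⟨1, x, actR_one _⟩

/-- The open subset of `P¹(ℂ)` given by an open subset of `ℂ`. -/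
def coeOpens (U : Set ℂ) (hU : IsOpen U) : Opens P1C :=
  ⟨(fun z : ℂ => (z : P1C)) '' U, OnePoint.isOpenEmbedding_coe.isOpenMap U hU⟩

theorem coe_mem_coeOpens {U : Set ℂ} {hU : IsOpen U} {z : ℂ} :
    (z : P1C) ∈ coeOpens U hU ↔ z ∈ U :=
  ⟨fun ⟨_, hw, h⟩ => OnePoint.coe_injective h ▸ hw, fun h => ⟨z, h, rfl⟩⟩

theorem infty_notMem_coeOpens {U : Set ℂ} {hU : IsOpen U} : (∞ : P1C) ∉ coeOpens U hU :=
  fun ⟨_, _, h⟩ => OnePoint.coe_ne_infty _ h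

/-- The image of a disc under an element of `G`. -/
noncomputable def discOpens (g : G) (x r : ℝ) : Opens P1C :=
  preC g⁻¹ (coeOpens (Metric.ball (x : ℂ) r) Metric.isOpen_ball)

theorem mem_discOpens {g : G} {x r : ℝ} {p : P1C} :
    p ∈ discOpens g x r ↔ ∃ z ∈ Metric.ball (x : ℂ) r, actC g z = p := by
  constructor
  · rintro ⟨z, hz, h⟩
    refine ⟨z, hz, ?_⟩
    change (z : P1C) = actC g⁻¹ p at h
    rw [h, actC_actC_inv]
  · rintro ⟨z, hz, rfl⟩
    refine ⟨z, hz, ?_⟩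
    change (z : P1C) = actC g⁻¹ (actC g z)
    rw [actC_inv_actC]

/-- Every neighbourhood of a real point contains a disc on which solutions can be transported. -/
theorem exists_disc {t : P1R} {O : Set P1C} (hO : O ∈ 𝓝 (realPt t)) :
    ∃ (g : G) (x r : ℝ), actR g (x : P1R) = t ∧ realPt t ∈ discOpens g x r ∧
      (∀ p ∈ discOpens g x r, p ∈ O) ∧ Metric.ball (x : ℂ) r ⊆ slitDomain ∧
      ∀ z ∈ Metric.ball (x : ℂ) r, (z : P1C) ∉ cut g := by
  obtain ⟨g, x, rfl⟩ := exists_actR_coe t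
  have e : actC g ((x : ℂ) : P1C) = realPt (actR g (x : P1R)) := actC_realPt g (x : P1R)
  have h1 : ∀ᶠ z : ℂ in 𝓝 (x : ℂ), actC g z ∈ O := by
    refine ((continuous_actC g).comp OnePoint.continuous_coe).continuousAt.eventually ?_
    change O ∈ 𝓝 (actC g ((x : ℂ) : P1C))
    rwa [e]
  have h2 : ∀ᶠ z : ℂ in 𝓝 (x : ℂ), z ∈ slitDomain :=
    isOpen_slitDomain.mem_nhds (mem_slitDomain_of_im (by simp))
  have h3 : ∀ᶠ z : ℂ in 𝓝 (x : ℂ), (z : P1C) ∉ cut g :=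
    ((isClosed_cut g).isOpen_compl.preimage OnePoint.continuous_coe).mem_nhds
      (realPt_notMem_cut g (x : P1R))
  obtain ⟨r, hr, hball⟩ := Metric.eventually_nhds_iff_ball.mp (h1.and (h2.and h3))
  refine ⟨g, x, r, rfl, mem_discOpens.mpr ⟨x, Metric.mem_ball_self hr, e⟩, fun p hp => ?_,
    fun z hz => (hball z hz).2.1, fun z hz => (hball z hz).2.2⟩
  obtain ⟨z, hz, rfl⟩ := mem_discOpens.mp hp
  exact (hball z hz).1

theorem Sol.eq_zero_on_disc (hs : ∀ n : ℕ, 2 * s ≠ -(n : ℂ)) {Ω : Opens P1C} {F : P1C → ℂ}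
    (h : Sol s k Ω F) {g : G} {x r : ℝ} (hΩ : discOpens g x r ≤ Ω)
    (hT : Metric.ball (x : ℂ) r ⊆ slitDomain)
    (hc : ∀ z ∈ Metric.ball (x : ℂ) r, (z : P1C) ∉ cut g)
    (h0 : ∀ᶠ t in 𝓝 (actR g (x : P1R)), F (realPt t) = 0) : ∀ p ∈ discOpens g x r, F p = 0 := by
  intro p hp
  obtain ⟨z, hz, rfl⟩ := mem_discOpens.mp hp
  exact h.eq_zero_on_image hs g (fun w hw => hΩ (mem_discOpens.mpr ⟨w, hw, rfl⟩)) hT hc h0 z hz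

theorem Sol.eventually_eq_zero (hs : ∀ n : ℕ, 2 * s ≠ -(n : ℂ)) {Ω : Opens P1C} {F : P1C → ℂ}
    (h : Sol s k Ω F) {t : P1R} (ht : realPt t ∈ Ω) (h0 : ∀ᶠ u in 𝓝 t, F (realPt u) = 0) :
    ∀ᶠ p in 𝓝 (realPt t), F p = 0 := by
  obtain ⟨g, x, r, rfl, h1, h2, h3, h4⟩ := exists_disc (Ω.isOpen.mem_nhds ht)
  filter_upwards [(discOpens g x r).isOpen.mem_nhds h1] with p hp
  exact h.eq_zero_on_disc hs (fun q hq => h2 q hq) h3 h4 h0 p hp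

theorem W.of_res {I : Opens P1R} {Ω Ω' : Nbhd I} (h : Ω'.1 ≤ Ω.1) (f : B s k Ω.1) :
    W.of s k I Ω' (B.res s k h f) = W.of s k I Ω f :=
  Module.DirectLimit.of_f
    (G := fun Ω : Nbhd I => B s k Ω.1)
    (f := fun Ω Ω' (h : Ω ≤ Ω') => B.res s k (Ω := Ω.1) (Ω' := Ω'.1) h)
    (i := Ω) (j := Ω') (hij := h) (x := f)

theorem rest_of_apply (I : Opens P1R) (Ω : Nbhd I) (f : B s k Ω.1) {F : P1C → ℂ}
    (hF : IsExt s k f.1 F) (t : I) : (rest s k I (W.of s k I Ω f)).1 t = F (realPt t) := by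
  have h := congrArg (fun φ : V I => φ.1 t) (rest_of s k I Ω f)
  exact h.trans (boundaryValue_eq s k f hF t (Ω.2 t t.2))

/-- If the boundary value is zero, F vanishes on a neighbourhood of I, and on this smaller member of
the direct system f = F / Φ_{s,k} is zero. -/
theorem rest_injective (hs : ∀ n : ℕ, 2 * s ≠ -(n : ℂ)) (I : Opens P1R) :
    Function.Injective (rest s k I) := by
  rw [injective_iff_map_eq_zero]
  intro φ hφ
  obtain ⟨Ω, f, rfl⟩ := W.exists_of s k φ
  have hres : ∀ (Ω' : Nbhd I) (h : Ω'.1 ≤ Ω.1), (∀ z : UpPart Ω'.1, f.1 ⟨z.1, h z.2⟩ = 0) →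
      W.of s k I Ω f = 0 := by
    intro Ω' h h0
    have h1 : B.res s k h f = 0 := Subtype.ext (funext h0)
    rw [← W.of_res h f, h1, map_zero]
  by_cases hI : ∃ t, t ∈ I
  · obtain ⟨t₀, ht₀⟩ := hI
    obtain ⟨F, hF⟩ := f.2.2 ⟨t₀, Ω.2 t₀ ht₀⟩
    have hsol : Sol s k Ω.1 F := Sol.of_isExt f.2.1 hF
    have hreal : ∀ t ∈ I, F (realPt t) = 0 := fun t ht => by
      rw [← rest_of_apply I Ω f hF ⟨t, ht⟩, hφ]; rfl
    refine hres ⟨Ω.1 ⊓ ⟨interior {p | F p = 0}, isOpen_interior⟩, fun t ht => ⟨Ω.2 t ht, ?_⟩⟩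
      (inf_le_left : Ω.1 ⊓ _ ≤ Ω.1) fun z => ?_
    · exact mem_interior_iff_mem_nhds.mpr (hsol.eventually_eq_zero hs (Ω.2 t ht)
        (by filter_upwards [I.isOpen.mem_nhds ht] with u hu using hreal u hu))
    · have h1 : F (upPt z.1) = 0 := interior_subset (s := {p | F p = 0}) z.2.2
      rw [hF.2 ⟨z.1, z.2.1⟩] at h1
      exact (mul_eq_zero.mp h1).resolve_left (Phi_ne_zero s k z.1)
  -- For I = ∅ the empty set is an admissible neighbourhood, so every germ is zero.
  · exact hres ⟨⊥, fun t ht => (hI ⟨t, ht⟩).elim⟩ (bot_le : ⊥ ≤ Ω.1) fun z => False.elim z.2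

/-- Holomorphic functions on vertically convex domains are the boundary values of solutions. -/
theorem exists_sol_of_holomorphic (hs : ∀ n : ℕ, 2 * s ≠ -(n : ℂ)) {U : Set ℂ} (hU : IsOpen U)
    (hV : VertConvex U) (hT : U ⊆ slitDomain) {H : ℂ → ℂ} (hH : DifferentiableOn ℂ H U) :
    ∃ F, Sol s k (coeOpens U hU) F ∧ ∀ x : ℝ, (x : ℂ) ∈ U → F ((x : ℂ) : P1C) = H x := by
  -- Dividing by the holomorphic product (z+i)^a (z-i)^b, which agrees with `weightM` on ℝ, gives
  -- the boundary values prescribed for A.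
  have hd : DifferentiableOn ℂ (fun z => H z / (powP (s + k / 2) z * powQ (s - k / 2) z)) U :=
    fun z hz => (hH z hz).div
      ((analyticAt_powP _ (hT hz)).mul (analyticAt_powQ _ (hT (hV.conj_mem hz)))
        ).differentiableAt.differentiableWithinAt
      (mul_ne_zero (Complex.exp_ne_zero _) (Complex.exp_ne_zero _))
  obtain ⟨A, hA⟩ := exists_isEpdSol hU hV hd (a := s + k / 2) (b := s - k / 2)
    (fun n hn => hs n (by linear_combination hn))
  -- The value at ∞ is arbitrary, since ∞ is not in the domain.
  refine ⟨fun p => p.elim 0 fun z => weightM s k z * A z, ⟨fun p hp => ?_, fun z hz => ?_⟩,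
    fun x hx => ?_⟩
  · induction p using OnePoint.rec with
    | infty => exact (infty_notMem_coeOpens hp).elim
    | coe z =>
      have hz := coe_mem_coeOpens.mp hp
      exact (analyticAt_weightM s k (hT hz)).mul (hA.analytic z hz)
  · have he : (fun w : ℂ => (OnePoint.elim (w : P1C) 0 (fun z => weightM s k z * A z) : ℂ)
        / weightM s k w) = A := by
      funext w
      rw [OnePoint.elim_some, mul_div_cancel_left₀ _ (weightM_ne_zero s k w)]
    rw [he]
    exact hA.eqn z (coe_mem_coeOpens.mp hz.2)
  · simp only [OnePoint.elim_some]
    rw [hA.real x hx, weightM, Complex.conj_ofReal]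
    exact mul_div_cancel₀ _ (mul_ne_zero (Complex.exp_ne_zero _) (Complex.exp_ne_zero _))

/-- The power series is kept and its variable made complex; the norms of the coefficients are
unchanged, so the radius stays positive. -/
theorem exists_holomorphic_extension {η : ℝ → ℂ} {x₀ : ℝ} (hη : AnalyticAt ℝ η x₀) :
    ∃ H : ℂ → ℂ, AnalyticAt ℂ H x₀ ∧ ∀ᶠ x : ℝ in 𝓝 x₀, H x = η x := by
  obtain ⟨p, r, hp⟩ := hη
  let q := FormalMultilinearSeries.ofScalars ℂ (fun n => p.coeff n)
  have hq : ∀ n z, q n (fun _ => z) = p.coeff n * z ^ n := fun n z => by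
    rw [FormalMultilinearSeries.ofScalars_apply_eq, smul_eq_mul]
  have hrad : 0 < q.radius := by
    obtain ⟨ρ, hρ0, hρ⟩ := ENNReal.lt_iff_exists_nnreal_btwn.mp (hp.r_pos.trans_le hp.r_le)
    obtain ⟨C, _, hC⟩ := p.norm_mul_pow_le_of_lt_radius hρ
    refine hρ0.trans_le (q.le_radius_of_bound C fun n => ?_)
    rw [FormalMultilinearSeries.ofScalars_norm, ← FormalMultilinearSeries.norm_apply_eq_norm_coef]
    exact hC n
  refine ⟨fun z => q.sum (z - x₀), ?_, ?_⟩
  · have h1 : AnalyticAt ℂ q.sum ((x₀ : ℂ) - x₀) := by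
      rw [sub_self]; exact (q.hasFPowerSeriesOnBall hrad).analyticAt
    exact AnalyticAt.comp (f := fun z : ℂ => z - x₀) h1 (analyticAt_id.sub analyticAt_const)
  · filter_upwards [Metric.eball_mem_nhds x₀ hp.r_pos] with x hx
    have h1 := hp.hasSum_sub hx
    rw [← h1.tsum_eq, FormalMultilinearSeries.sum]
    refine tsum_congr fun n => ?_
    rw [hq, FormalMultilinearSeries.apply_eq_pow_smul_coeff, Complex.real_smul]
    push_cast
    ring

theorem vertConvex_of_convex {U : Set ℂ} (hU : Convex ℝ U) (hc : ∀ z ∈ U, conj z ∈ U) :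
    VertConvex U := fun z hz t => by
  rw [segMap_apply]
  have := hU (hc z hz) hz (a := 1 - t) (b := t) (by linarith [t.2.2]) t.2.1 (by ring)
  simpa [Complex.real_smul] using this

/-- An element g with t = g x₀ moves the problem to a finite point. The data are divided by the
factor of g⁻¹ beforehand, so that transporting the solution back restores ψ. -/
theorem exists_local_sol (hs : ∀ n : ℕ, 2 * s ≠ -(n : ℂ)) {ψ : P1R → ℂ} {t : P1R}
    (hψ : AnalyticAtP1 ℝ ψ t) : ∃ (Ω : Opens P1C) (F : P1C → ℂ), realPt t ∈ Ω ∧ Sol s k Ω F ∧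
      ∀ u : P1R, realPt u ∈ Ω → F (realPt u) = ψ u := by
  obtain ⟨g, x₀, rfl⟩ := exists_actR_coe t
  have hfac : AnalyticAtP1 ℝ (prsFactor s k g⁻¹) (actR g (x₀ : P1R)) := by
    have := (analyticAtP1_mulFactor s k g⁻¹ (realPt_notMem_cut g⁻¹ (actR g (x₀ : P1R)))).comp_realPt
    simpa only [← prsFactor_eq] using this
  have hη : AnalyticAt ℝ
      (fun x : ℝ => ψ (actR g (x : P1R)) * (prsFactor s k g⁻¹ (actR g (x : P1R)))⁻¹) x₀ :=
    (hψ.mul (hfac.inv (prsFactor_ne_zero s k g⁻¹ _))).comp_actR g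
  obtain ⟨H, hH, hHη⟩ := exists_holomorphic_extension hη
  obtain ⟨r₁, hr₁, hball₁⟩ := Metric.eventually_nhds_iff_ball.mp hH.eventually_analyticAt
  obtain ⟨r₂, hr₂, hball₂⟩ := Metric.eventually_nhds_iff_ball.mp hHη
  obtain ⟨r₃, hr₃, hball₃⟩ := Metric.isOpen_iff.mp isOpen_slitDomain (x₀ : ℂ)
    (mem_slitDomain_of_im (by simp))
  set r := min r₁ (min r₂ r₃)
  have hr : 0 < r := lt_min hr₁ (lt_min hr₂ hr₃)
  set U := Metric.ball (x₀ : ℂ) r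
  have hU1 : U ⊆ Metric.ball (x₀ : ℂ) r₁ := Metric.ball_subset_ball (min_le_left _ _)
  have hU3 : U ⊆ slitDomain := (Metric.ball_subset_ball
    ((min_le_right _ _).trans (min_le_right _ _))).trans hball₃
  have hV : VertConvex U := by
    refine vertConvex_of_convex (convex_ball _ _) fun z hz => ?_
    have h1 : conj z - (x₀ : ℂ) = conj (z - x₀) := by simp
    rw [Metric.mem_ball, dist_eq_norm] at hz ⊢
    rwa [h1, Complex.norm_conj]
  obtain ⟨F, hF, hFH⟩ := exists_sol_of_holomorphic (k := k) hs Metric.isOpen_ball hV hU3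
    (H := H) fun z hz => (hball₁ z (hU1 hz)).differentiableAt.differentiableWithinAt
  refine ⟨slashDomain g⁻¹ (coeOpens U Metric.isOpen_ball), _, ?_, hF.slash g⁻¹, fun u hu => ?_⟩
  · rw [realPt_mem_slashDomain, actR_inv_actR]
    exact coe_mem_coeOpens.mpr (Metric.mem_ball_self hr)
  · rw [realPt_mem_slashDomain] at hu
    obtain ⟨x, hx⟩ : ∃ x : ℝ, actR g⁻¹ u = (x : P1R) := by
      generalize actR g⁻¹ u = v at hu
      induction v using OnePoint.rec with
      | infty => exact (infty_notMem_coeOpens hu).elim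
      | coe x => exact ⟨x, rfl⟩
    rw [hx] at hu
    have hxU : (x : ℂ) ∈ U := coe_mem_coeOpens.mp hu
    have hu' : u = actR g (x : P1R) := by rw [← hx, actR_actR_inv]
    have hx2 : x ∈ Metric.ball x₀ r₂ := by
      have h1 : dist (x : ℂ) x₀ < r := hxU
      rw [Complex.dist_of_im_eq (by simp)] at h1
      exact lt_of_lt_of_le h1 ((min_le_right r₁ _).trans (min_le_left r₂ r₃))
    have h2 := hFH x hxU
    rw [hball₂ x hx2] at h2
    rw [actC_realPt, hx, ← prsFactor_eq]
    change prsFactor s k g⁻¹ u * F ((x : ℂ) : P1C) = ψ u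
    rw [h2, hu']
    field_simp [prsFactor_ne_zero s k g⁻¹ (actR g (x : P1R))]

/-- Local solutions with the same boundary values can be glued. -/
theorem exists_glued_sol (hs : ∀ n : ℕ, 2 * s ≠ -(n : ℂ)) {I : Opens P1R} {ψ : P1R → ℂ}
    (hψ : ∀ t ∈ I, AnalyticAtP1 ℝ ψ t) : ∃ (Ω : Opens P1C) (F : P1C → ℂ),
      (∀ t ∈ I, realPt t ∈ Ω) ∧ Sol s k Ω F ∧ ∀ t ∈ I, F (realPt t) = ψ t := by
  choose Ω F hmem hsol hval using fun t : I => exists_local_sol (k := k) hs (hψ t.1 t.2)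
  -- The sphere supplies a metric on P¹(ℂ), in which ∞ plays no special role.
  let e : P1C ≃ₜ Metric.sphere (0 : EuclideanSpace ℝ (Fin 3)) 1 :=
    onePointEquivSphereOfFinrankEq (by simp)
  -- The factor 3 ensures that if the neighbourhoods of radii R t ≤ R t' around two points meet, the
  -- smaller one lies in Ω t'.
  have hR : ∀ t : I, ∃ R > 0, ∀ p, dist (e p) (e (realPt t)) < 3 * R → p ∈ Ω t := by
    intro t
    have h1 : e.symm ⁻¹' (Ω t : Set P1C) ∈ 𝓝 (e (realPt t)) :=
      ((Ω t).isOpen.preimage e.symm.continuous).mem_nhds (by simpa using hmem t)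
    obtain ⟨ε, hε, hball⟩ := Metric.mem_nhds_iff.mp h1
    refine ⟨ε / 3, by positivity, fun p hp => ?_⟩
    have := hball (show e p ∈ Metric.ball (e (realPt t)) ε by
      rw [Metric.mem_ball]; linarith)
    simpa using this
  choose R hRpos hRsub using hR
  have hdisc : ∀ t : I, {p | dist (e p) (e (realPt t)) < R t} ∈ 𝓝 (realPt t.1) := fun t =>
    (isOpen_lt (e.continuous.dist continuous_const) continuous_const).mem_nhds
      (by simpa using hRpos t)
  choose g x r hgx hself hsub hslit hcut using fun t : I => exists_disc (hdisc t)
  let N : I → Opens P1C := fun t => discOpens (g t) (x t) (r t)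
  have hNΩ : ∀ t, N t ≤ Ω t := fun t p hp => hRsub t p ((hsub t p hp).trans (by linarith [hRpos t]))
  -- On the whole of N t both solutions are defined. Their difference has boundary value zero near
  -- the real centre of N t, hence vanishes on N t, even where q is far from P¹(ℝ).
  have key : ∀ t t' : I, R t ≤ R t' → ∀ q, q ∈ N t → q ∈ N t' → F t q = F t' q := by
    intro t t' hle q hq hq'
    have hNΩ' : N t ≤ Ω t' := fun p hp => hRsub t' p (by
      have h1 : dist (e p) (e (realPt t)) < R t := hsub t p hp
      have h2 : dist (e q) (e (realPt t)) < R t := hsub t q hq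
      have h3 : dist (e q) (e (realPt t')) < R t' := hsub t' q hq'
      have h4 := dist_triangle (e p) (e (realPt t)) (e q)
      have h5 := dist_triangle (e p) (e q) (e (realPt t'))
      rw [dist_comm (e (realPt t))] at h4
      linarith)
    have hd := ((hsol t).mono (hNΩ t)).sub ((hsol t').mono hNΩ')
    have h0 : ∀ᶠ u in 𝓝 (actR (g t) (x t : P1R)), F t (realPt u) - F t' (realPt u) = 0 := by
      rw [hgx t]
      have hc : Continuous (realPt : P1R → P1C) := 
        OnePoint.continuous_map Complex.continuous_ofReal (by
          rw [coclosedCompact_eq_cocompact, coclosedCompact_eq_cocompact]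
          exact Complex.isometry_ofReal.isClosedEmbedding.tendsto_cocompact)
      have : ∀ᶠ u in 𝓝 t.1, realPt u ∈ N t :=
        hc.continuousAt.eventually ((N t).isOpen.mem_nhds (hself t))
      filter_upwards [this] with u hu
      rw [hval t u (hNΩ t hu), hval t' u (hNΩ' hu), sub_self]
    exact sub_eq_zero.mp (hd.eq_zero_on_disc hs le_rfl (hslit t) (hcut t) h0 q hq)
  have key' : ∀ t t' : I, ∀ q, q ∈ N t → q ∈ N t' → F t q = F t' q := fun t t' q hq hq' =>
    (le_total (R t) (R t')).elim (fun h => key t t' h q hq hq') fun h => (key t' t h q hq' hq).symm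
  classical
  let F₀ : P1C → ℂ := fun p => if h : ∃ t, p ∈ N t then F h.choose p else 0
  have hF₀ : ∀ t, ∀ q ∈ N t, F₀ q = F t q := fun t q hq => by
    have h : ∃ t, q ∈ N t := ⟨t, hq⟩
    simp only [F₀, h, dif_pos]
    exact key' _ _ q h.choose_spec hq
  refine ⟨⨆ t, N t, F₀, fun t ht => Opens.mem_iSup.mpr ⟨⟨t, ht⟩, hself ⟨t, ht⟩⟩,
    Sol.of_local fun p hp => ?_, fun t ht => ?_⟩
  · obtain ⟨t, ht⟩ := Opens.mem_iSup.mp hp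
    exact ⟨N t, F t, ht, (hsol t).mono (hNΩ t), hF₀ t⟩
  · rw [hF₀ ⟨t, ht⟩ _ (hself ⟨t, ht⟩)]
    exact hval ⟨t, ht⟩ t (hmem ⟨t, ht⟩)

theorem rest_surjective (hs : ∀ n : ℕ, 2 * s ≠ -(n : ℂ)) (I : Opens P1R) :
    Function.Surjective (rest s k I) := by
  rintro ⟨φ, ψ, hψ, hφ⟩
  obtain ⟨Ω, F, hmem, hsol, hval⟩ := exists_glued_sol (k := k) hs hψ
  refine ⟨W.of s k I ⟨Ω, hmem⟩ hsol.toB, Subtype.ext (funext fun t => ?_)⟩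
  rw [rest_of_apply I ⟨Ω, hmem⟩ hsol.toB hsol.isExt t, hval t t.2, hφ t]

end Bijective

/-! ### Convex neighbourhoods of intervals -/

section ConvexDomains

variable {s : ℂ} {k : ℝ}

/-- Iwasawa decomposition: every element of `G` is the product of a rotation, which fixes `-i`,
and of an upper triangular matrix. -/
theorem exists_rotation_mul (g : G) :
    ∃ κ m : G, g = κ * m ∧ m 1 0 = 0 ∧ mob κ (-I) = -I := by
  have hdet : g 0 0 * g 1 1 - g 0 1 * g 1 0 = 1 := by
    have := g.det_coe
    rwa [Matrix.det_fin_two] at this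
  have hpos : 0 < g 0 0 ^ 2 + g 1 0 ^ 2 := by
    by_contra! h
    have h1 : g 0 0 = 0 := by nlinarith [sq_nonneg (g 0 0), sq_nonneg (g 1 0)]
    have h2 : g 1 0 = 0 := by nlinarith [sq_nonneg (g 0 0), sq_nonneg (g 1 0)]
    simp [h1, h2] at hdet
  set r := Real.sqrt (g 0 0 ^ 2 + g 1 0 ^ 2)
  have hr : r ^ 2 = g 0 0 ^ 2 + g 1 0 ^ 2 := Real.sq_sqrt hpos.le
  have hr0 : r ≠ 0 := (Real.sqrt_pos.mpr hpos).ne'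
  -- The first column of g, normalized to length 1, is the first column of the rotation; hence κ⁻¹ g
  -- is upper triangular.
  let κ : G := ⟨!![g 0 0 / r, -(g 1 0 / r); g 1 0 / r, g 0 0 / r], by
    rw [Matrix.det_fin_two_of]
    field_simp
    linear_combination -hr⟩
  have k00 : κ 0 0 = g 0 0 / r := rfl
  have k01 : κ 0 1 = -(g 1 0 / r) := rfl
  have k10 : κ 1 0 = g 1 0 / r := rfl
  have k11 : κ 1 1 = g 0 0 / r := rfl
  refine ⟨κ, κ⁻¹ * g, by group, ?_, ?_⟩
  · obtain ⟨-, -, h3, h4⟩ := inv_apply κ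
    have : (κ⁻¹ * g : G) 1 0 = κ⁻¹ 1 0 * g 0 0 + κ⁻¹ 1 1 * g 1 0 := by
      rw [Matrix.SpecialLinearGroup.coe_mul, Matrix.mul_apply, Fin.sum_univ_two]
    rw [this, h3, h4, k10, k00]
    ring
  · have hd : den κ (-I) ≠ 0 := den_ne_zero κ (by simp)
    have e : mob κ (-I) = ((κ 0 0 : ℂ) * (-I) + (κ 0 1 : ℂ)) / den κ (-I) := rfl
    rw [e, div_eq_iff hd, den, k00, k01, k10, k11]
    push_cast
    linear_combination (-(g 1 0 : ℂ) / r) * Complex.I_sq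

/-- When g⁻¹ fixes -i, it also fixes i by conjugation; both quotients in the multiplier are then 1
at finite real points. -/
theorem mulFactor_realPt_of_pole {g : G} (hg : pole g = -I) (t : P1R) :
    mulFactor s k g (realPt t) = mulFactor s k g ∞ := by
  induction t using OnePoint.rec with
  | infty => rfl
  | coe x =>
    have h1 : (x : ℂ) + I ≠ 0 := fun h => by simpa using congrArg Complex.im h
    have h2 : (x : ℂ) - I ≠ 0 := fun h => by simpa using congrArg Complex.im h
    have h3 : mob g⁻¹ I = I := by rw [← conj_pole, hg]; simp
    simp only [mulFactor, realPt, OnePoint.map_some, OnePoint.elim_some, OnePoint.elim_infty,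
      Complex.conj_ofReal, h3, hg, sub_neg_eq_add, div_self h1, div_self h2, Complex.one_cpow,
      mul_one]

/-- A point z of U on the half-line below -i would have z̄ in U too, and the vertical segment
joining them passes through -i. -/
theorem convex_subset_slitDomain {U : Set ℂ} (hU : Convex ℝ U) (hc : ∀ z ∈ U, conj z ∈ U)
    (h : -I ∉ U) : U ⊆ slitDomain := by
  intro z hz
  by_contra hs
  have h1 : (1 - I * z).re ≤ 0 ∧ (1 - I * z).im = 0 := by
    rw [slitDomain, Set.mem_ofPred_eq, Complex.mem_slitPlane_iff] at hs
    push Not at hs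
    exact hs
  have hre : z.re = 0 := by simpa using h1.2
  have him : z.im ≤ -1 := by
    have := h1.1
    simp at this
    linarith
  apply h
  -- The weights, applied to z and z̄ in this order, are chosen so that the imaginary part is -1.
  have := hU hz (hc z hz) (a := (1 - 1 / z.im) / 2) (b := (1 + 1 / z.im) / 2)
    (by have : 1 / z.im < 0 := by apply one_div_neg.mpr; linarith
        linarith)
    (by have : -1 ≤ 1 / z.im := by rw [le_div_iff_of_neg (by linarith)]; linarith
        linarith) (by ring)
  convert this using 1
  have h0 : z.im ≠ 0 := by linarith
  apply Complex.ext
  · simp [hre]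
  · simp
    field_simp
    ring

theorem actC_upper_triangular {m : G} (hm : m 1 0 = 0) (z : ℂ) :
    actC m z = ((((m 0 1 / m 1 1 : ℝ) : ℂ) + (m 0 0 / m 1 1 : ℝ) • z : ℂ) : P1C) := by
  have hdet := det_eq_one m
  have h11 : (m 1 1 : ℂ) ≠ 0 := fun h => by simp [h, hm] at hdet
  have hd : den m z = m 1 1 := by simp [den, hm]
  rw [actC_coe m (by rw [hd]; exact h11)]
  congr 1
  have e : mob m z = ((m 0 0 : ℂ) * z + (m 0 1 : ℂ)) / den m z := rfl
  rw [e, hd, Complex.real_smul]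
  push_cast
  field_simp
  ring

/-- A boundary germ whose boundary value is holomorphic on a convex symmetric neighbourhood of an
interval is represented on this neighbourhood. -/
theorem exists_representative (hs : ∀ n : ℕ, 2 * s ≠ -(n : ℂ)) (I' : Opens P1R) (Ω : Nbhd I')
    (hconv : IsConvexP1 (Ω.1 : Set P1C)) (hsymm : ∀ p : P1C, p ∈ Ω.1 → conjP1 p ∈ Ω.1)
    (hI : ((-I : ℂ) : P1C) ∉ Ω.1) (φ : W s k I')
    (hφ : ∃ ψ : P1C → ℂ, (∀ p ∈ Ω.1, AnalyticAtP1 ℂ ψ p) ∧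
      ∀ t : I', ψ (realPt t) = (rest s k I' φ).1 t) :
    ∃ f : B s k Ω.1, W.of s k I' Ω f = φ := by
  obtain ⟨g, C, hC, hΩC⟩ := hconv
  -- The triangular part acts on ℂ by a real affine map and preserves convexity. Only the rotation
  -- can involve ∞, and it fixes -i.
  obtain ⟨κ, m, rfl, hm, hκ⟩ := exists_rotation_mul g
  obtain ⟨ψ, hψ, hψφ⟩ := hφ
  -- The cut of κ⁻¹ thus shrinks to the point -i, which is not in Ω, so no part of Ω is lost in
  -- transport.
  have hpole : pole κ⁻¹ = -I := by rw [pole, inv_inv, hκ]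
  have hκI : actC κ ((-I : ℂ) : P1C) = ((-I : ℂ) : P1C) := by
    rw [actC_coe κ (den_ne_zero κ (by simp)), hκ]
  let U : Set ℂ := {w | actC κ w ∈ Ω.1}
  have hUo : IsOpen U :=
    Ω.1.isOpen.preimage ((continuous_actC κ).comp OnePoint.continuous_coe)
  have hΩU : ∀ p ∈ Ω.1, actC κ⁻¹ p ∈ coeOpens U hUo := by
    intro p hp
    have hp' : p ∈ (Ω.1 : Set P1C) := hp
    rw [hΩC] at hp'
    obtain ⟨z, hz, rfl⟩ := hp'
    have e : actC κ⁻¹ (actC (κ * m) z) = actC m z := by rw [actC_mul, actC_inv_actC]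
    simp only [e]
    rw [actC_upper_triangular hm, coe_mem_coeOpens]
    show actC κ _ ∈ Ω.1
    rw [← actC_upper_triangular hm, ← actC_mul]
    exact hp
  have hU : Convex ℝ U := by
    have hUC : U = (fun z => ((m 0 1 / m 1 1 : ℝ) : ℂ) + (m 0 0 / m 1 1 : ℝ) • z) '' C := by
      ext w
      constructor
      · intro hw
        have hw' : actC κ w ∈ (Ω.1 : Set P1C) := hw
        rw [hΩC] at hw'
        obtain ⟨z, hz, h⟩ := hw'
        replace h : actC (κ * m) z = actC κ w := h
        refine ⟨z, hz, OnePoint.coe_injective ?_⟩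
        rw [← actC_upper_triangular hm, ← actC_inv_actC κ (w : P1C), ← h, actC_mul, actC_inv_actC]
      · rintro ⟨z, hz, rfl⟩
        show actC κ _ ∈ (Ω.1 : Set P1C)
        rw [← actC_upper_triangular hm, ← actC_mul, hΩC]
        exact ⟨z, hz, rfl⟩
    rw [hUC]
    exact hC.affinity _ _
  have hUc : ∀ z ∈ U, conj z ∈ U := by
    intro z hz
    have h := hsymm _ hz
    rw [conjP1_actC] at h
    exact h
  have hUI : -I ∉ U := fun h => hI (by rw [← hκI]; exact h)
  -- On P¹(ℝ) the multiplier of the rotation is this constant, so dividing by it keeps the boundary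
  -- data holomorphic.
  let c := mulFactor s k κ⁻¹ ∞
  have hc : c ≠ 0 := by simp [c, mulFactor]
  obtain ⟨F, hF, hFval⟩ := exists_sol_of_holomorphic (k := k) hs hUo (vertConvex_of_convex hU hUc)
    (convex_subset_slitDomain hU hUc hUI) (H := fun w => ψ (actC κ w) / c) (fun w hw => by
      have h : AnalyticAtP1 ℂ (fun q => ψ (actC κ q)) (w : P1C) := (hψ _ hw).comp_actC κ
      have h' : AnalyticAt ℂ (fun w : ℂ => ψ (actC κ w)) w := h
      exact (h'.differentiableAt.div_const c).differentiableWithinAt)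
  have hsol : Sol s k Ω.1 (fun q => mulFactor s k κ⁻¹ q * F (actC κ⁻¹ q)) := by
    refine (hF.slash κ⁻¹).mono fun p hp => mem_slashDomain.mpr ⟨hΩU p hp, ?_⟩
    rintro ⟨z, hz, rfl⟩
    rw [hpole, segment_same, Set.mem_singleton_iff] at hz
    exact hI (by rw [← hz]; exact hp)
  -- The new function represents φ because both germs have the same boundary value.
  refine ⟨hsol.toB, rest_injective hs I' (Subtype.ext (funext fun t => ?_))⟩
  have e := rest_of_apply I' Ω hsol.toB hsol.isExt t
  rw [e, ← hψφ t, mulFactor_realPt_of_pole hpole]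
  have hmem := hΩU _ (Ω.2 t t.2)
  have hval : ∀ u : P1R, realPt u ∈ coeOpens U hUo → F (realPt u) = ψ (actC κ (realPt u)) / c := by
    intro u hu
    induction u using OnePoint.rec with
    | infty => exact absurd hu infty_notMem_coeOpens
    | coe x => exact hFval x (coe_mem_coeOpens.mp hu)
  rw [actC_realPt] at hmem ⊢
  rw [hval _ hmem, ← actC_realPt, actC_actC_inv]
  exact mul_div_cancel₀ _ hc

end ConvexDomains

end BoundaryGerm

theorem mainTheorem4 (s : ℂ) (k : ℝ) (hs : ∀ n : ℕ, 2 * s ≠ -(n : ℂ))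
    (hk : 2 * s ≠ (k : ℂ)) (hk' : 2 * s ≠ -(k : ℂ)) :
    -- `rest` is a morphism of sheaves
    (∀ (I J : TopologicalSpace.Opens BoundaryGerm.P1R) (hJ : J ≤ I) (φ : BoundaryGerm.W s k I),
      BoundaryGerm.rest s k J (BoundaryGerm.W.res s k hJ φ) =
        BoundaryGerm.V.res hJ (BoundaryGerm.rest s k I φ)) ∧
    -- it is bijective
    (∀ I : TopologicalSpace.Opens BoundaryGerm.P1R,
      Function.Bijective (BoundaryGerm.rest s k I)) ∧
    -- it intertwines the two actions of `G`
    (∀ (g : BoundaryGerm.G) (I : TopologicalSpace.Opens BoundaryGerm.P1R)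
      (Ω : BoundaryGerm.Nbhd I) (f : BoundaryGerm.B s k Ω.1),
      ∃ (Ω' : BoundaryGerm.Nbhd (BoundaryGerm.preR g I)) (hΩ' : Ω'.1 ≤ (Ω.pre g).1)
        (hfg : BoundaryGerm.restrictUp hΩ' (BoundaryGerm.slash k g f.1) ∈ BoundaryGerm.B s k Ω'.1),
        BoundaryGerm.prs s k g (BoundaryGerm.rest s k I (BoundaryGerm.W.of s k I Ω f)).1 =
          (BoundaryGerm.rest s k (BoundaryGerm.preR g I)
            (BoundaryGerm.W.of s k (BoundaryGerm.preR g I) Ω'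
              ⟨BoundaryGerm.restrictUp hΩ' (BoundaryGerm.slash k g f.1), hfg⟩)).1) ∧
    -- domains of holomorphy are inherited by representatives
    (∀ (I : TopologicalSpace.Opens BoundaryGerm.P1R) (Ω : BoundaryGerm.Nbhd I),
      BoundaryGerm.IsOpenInterval I →
      BoundaryGerm.IsConvexP1 (Ω.1 : Set BoundaryGerm.P1C) →
      (∀ p : BoundaryGerm.P1C, p ∈ Ω.1 → BoundaryGerm.conjP1 p ∈ Ω.1) →
      ((Complex.I : ℂ) : OnePoint ℂ) ∉ Ω.1 →
      ((-Complex.I : ℂ) : OnePoint ℂ) ∉ Ω.1 →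
      ∀ φ : BoundaryGerm.W s k I,
        (∃ ψ : BoundaryGerm.P1C → ℂ,
          (∀ p ∈ Ω.1, BoundaryGerm.AnalyticAtP1 ℂ ψ p) ∧
          ∀ t : I, ψ (BoundaryGerm.realPt t) = (BoundaryGerm.rest s k I φ).1 t) →
        ∃ f : BoundaryGerm.B s k Ω.1, BoundaryGerm.W.of s k I Ω f = φ) :=
  ⟨BoundaryGerm.rest_res s k,
    fun I => ⟨BoundaryGerm.rest_injective hs I, BoundaryGerm.rest_surjective hs I⟩,
    BoundaryGerm.rest_slash s k,
    fun I Ω _ hconv hsymm _ hI φ hφ =>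
      BoundaryGerm.exists_representative hs I Ω hconv hsymm hI φ hφ⟩
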